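/- **Setting.** Let $\epsilon_0>0$ and let $\beta_*:[-8\epsilon_0,8\epsilon_0]\to\mathbb R$ be smooth with $\beta_*(t)=t$ for $4\epsilon_0\le|t|\le 8\epsilon_0$, $\beta_*(t)=0$ for $|t|\le2\epsilon_0$ and $\beta_*'(t)>0$ for $2\epsilon_0<|t|\le4\epsilon_0$; extend it to a smooth function on $\mathbb R$ by $\beta_*(t)=t$ for $|t|\geq 8\epsilon_0$. Let $(W,\Omega)$ be a closed symplectic manifold of dimension $2n+2$ ($n\ge0$), $H:W\to\mathbb R$ a smooth function with regular value $0$, $M=H^{-1}(0)$, $\omega=\Omega|_M$, and $\lambda$ a smooth one-form on $M$ with $\lambda\wedge\omega^n$ nowhere zero, so that $(\lambda,\omega)$ is a framed Hamiltonian structure. Write $W_-=\{H\le0\}$, $W_+=\{H\ge0\}$, and let $a$ be the coordinate on $\mathbb R$ in $\mathbb R\times M$. Make the following choices. * A diffeomorphism $\iota$ from $(-\epsilon,\epsilon)\times M$, $\epsilon>8\epsilon_0$, onto a neighborhood of $M$ with $\iota(0,m)=m$, $\iota^*\Omega=\omega+d(a\lambda)$, mapping $\{a\le0\}$ into $W_-$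 and $\{a\ge0\}$ into $W_+$. * An almost-complex structure $J_{\mathrm{Neck}}$ on $\mathbb R\times M$ adapted to $(\lambda,\omega)$: it is smooth and translation invariant, $J_{\mathrm{Neck}}\partial_a=X$ and $J_{\mathrm{Neck}}X=-\partial_a$ where $X$ is the vector field on $M$ with $\lambda(X)=1$, $\omega(X,-)=0$, and it preserves $\ker\lambda\subset TM$, where it is compatible with $\omega$. * With $\hat\omega=\omega+\beta_*(a)\,d\lambda$, a smooth almost-complex structure $J_{\mathrm{Between}}$ on $[-8\epsilon_0,8\epsilon_0]\times M$ with $J_{\mathrm{Between}}\partial_a=\bar X$ and $J_{\mathrm{Between}}\bar X=-\partial_a$, where $da(\bar X)=0$, $\lambda(\bar X)=1$, $\hat\omega(\bar X,-)=0$, that preserves $\ker(da\wedge\lambda)$ and $\ker\hat\omega$, such that $\hat\omega(-,J_{\mathrm{Between}}-)$ is symmetric and positive definite on $\ker(da\wedge\lambda)$, and $J_{\mathrm{Between}}=J_{\mathrm{Neck}}$ on $[-2\epsilon_0,2\epsilon_0]\times M$. * A smooth $\Omega$-compatible almost-complex structure $J_{\mathrm{Core}}$ on $W$ whose pullback by $\iota$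 equals $J_{\mathrm{Between}}$ where $6\epsilon_0\le|a|\le8\epsilon_0$. * A smooth $\chi:\mathbb R\to[0,1]$ with $\chi(t)=1$ for $t<3\epsilon_0$ and $\chi(t)=0$ for $t>5\epsilon_0$; put $\theta(t)=\chi(|t|)+(1-\chi(|t|))\beta_*'(t)$. Let $\mathrm{Core}(W)=W\setminus\iota((-6\epsilon_0,6\epsilon_0)\times M)$. For $L>0$ let $W_L$ be the smooth manifold obtained by gluing $W_-$, $[-L-8\epsilon_0,L+8\epsilon_0]\times M$ and $W_+$, identifying $\iota(a,m)$ with $(a-L,m)$ for $-8\epsilon_0\le a\le0$ and with $(a+L,m)$ for $0\le a\le8\epsilon_0$. Let $\bar J_L$ be the almost-complex structure on $W_L$ equal to $J_{\mathrm{Core}}$ on $\mathrm{Core}(W)$, to $J_{\mathrm{Neck}}$ on $[-L,L]\times M$, and on the rest of the neck to $J_{\mathrm{Between}}$ shifted: at $(t,m)$ it is $J_{\mathrm{Between}}$ at $(t+L,m)$ for $t\le-L$ and at $(t-L,m)$ for $t\ge L$. Let $\beta_L(t)$ be $\beta_*(t+L)$ for $t\le-L$, $0$ for $|t|\le L$ and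 $\beta_*(t-L)$ for $t\ge L$, and define $\theta_L$ from $\theta$ likewise, with value $1$ for $|t|\le L$. On the neck let $$g_L(-,-)=(\theta_L\,da\wedge\lambda+\omega+\beta_L\,d\lambda)(-,\bar J_L-).$$ Say that $\kappa_0\ge1$ is a *uniform bound* if, for all $L>0$, on the whole neck $[-L-8\epsilon_0,L+8\epsilon_0]\times M$ one has $|d\lambda(u,u')|\le\kappa_0\|u\|_{g_L}\|u'\|_{g_L}$ for all tangent vectors $u,u'$, and $(\omega+\beta_L\,d\lambda)(V,\bar J_LV)\ge\kappa_0^{-1}\|V\|_{g_L}^2$ for all $V\in\ker(da\wedge\lambda)$. **Proposition.** For any $\epsilon_0$ and $\beta_*$ as above there is a function $\kappa_0\mapsto L(\epsilon_0,\kappa_0,\beta_*)\ge1$, depending only on $\epsilon_0$ and $\beta_*$, such that the following holds for all $n$, $(W,\Omega)$, $H$, $\lambda$ and all choices as above. A uniform bound $\kappa_0\ge1$ exists. For every uniform bound $\kappa_0\ge1$ and every $L\ge L(\epsilon_0,\kappa_0,\beta_*)$ there is a diffeomorphism $\Phi_L:W_L\to W$ such that $\bar J_L$ is tamed by the symplectic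 form $\Phi_L^*\Omega$, that is, $\Phi_L^*\Omega(V,\bar J_LV)>0$ for every nonzero tangent vector $V$ of $W_L$. Moreover, $\Phi_L$ can be taken to be the identity on $\mathrm{Core}(W)$ and $(t,m)\mapsto\iota(h_L(t),m)$ on the neck, where, with $\kappa_*=10^{10}\kappa_0^3$, the smooth function $h_L:[-L-8\epsilon_0,L+8\epsilon_0]\to[-8\epsilon_0,8\epsilon_0]$ satisfies * $h_L'>0$ everywhere; * $h_L=\beta_L$ in a neighborhood of $[-L-8\epsilon_0,-L-\tfrac{11}4\epsilon_0]$ and of $[L+\tfrac{11}4\epsilon_0,L+8\epsilon_0]$; * $|h_L-\beta_L|\le100\,\kappa_*^{-1}L^{-1}$; * $h_L'\ge\tfrac12\kappa_*^{-1}L^{-2}$. -/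

import Mathlib

open scoped Manifold ContDiff Topology

noncomputable section

namespace NeckStretch

section Glue

variable {P Q : Type*} [TopologicalSpace P] [TopologicalSpace Q]

/-- The relation on the disjoint union of the open sets `U` and `V` that identifies
`v ∈ V ∩ ψ.source` with `ψ v` whenever `ψ v ∈ U`. -/
def GlueRel (U : TopologicalSpace.Opens P) (V : TopologicalSpace.Opens Q)
    (ψ : OpenPartialHomeomorph Q P) : U ⊕ V → U ⊕ V → Prop
  | .inl u, .inl u' => u = u'
  | .inl u, .inr v => (v : Q) ∈ ψ.source ∧ ψ v = u
  | .inr v, .inl u => (v : Q) ∈ ψ.source ∧ ψ v = u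
  | .inr v, .inr v' => v = v'

/-- `GlueRel` as an equivalence relation. -/
def glueSetoid (U : TopologicalSpace.Opens P) (V : TopologicalSpace.Opens Q)
    (ψ : OpenPartialHomeomorph Q P) : Setoid (U ⊕ V) where
  r := GlueRel U V ψ
  iseqv := by
    refine ⟨?_, ?_, ?_⟩
    · rintro (u | v) <;> simp [GlueRel]
    · rintro (u | v) (u' | v') h <;> simp_all [GlueRel]
    · rintro (u | v) (u' | v') (u'' | v'') h h'
      · exact Eq.trans h h'
      · obtain rfl : u = u' := h
        exact h'
      · exact Subtype.ext (h.2.symm.trans h'.2)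
      · obtain rfl : v' = v'' := h'
        exact h
      · obtain rfl : u' = u'' := h'
        exact h
      · exact Subtype.ext (ψ.injOn h.1 h'.1 (h.2.trans h'.2.symm))
      · obtain rfl : v = v' := h
        exact h'
      · exact Eq.trans h h'

/-- The space obtained by gluing the open sets `U` and `V` along `ψ`, with the quotient topology. -/
def Glue (U : TopologicalSpace.Opens P) (V : TopologicalSpace.Opens Q)
    (ψ : OpenPartialHomeomorph Q P) : Type _ :=
  Quotient (glueSetoid U V ψ)

namespace Glue

variable {U : TopologicalSpace.Opens P} {V : TopologicalSpace.Opens Q}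
  {ψ : OpenPartialHomeomorph Q P}

instance : TopologicalSpace (Glue U V ψ) :=
  inferInstanceAs (TopologicalSpace (Quotient (glueSetoid U V ψ)))

/-- The inclusion of the first piece. -/
def inl (u : U) : Glue U V ψ := Quotient.mk (glueSetoid U V ψ) (Sum.inl u)

/-- The inclusion of the second piece. -/
def inr (v : V) : Glue U V ψ := Quotient.mk (glueSetoid U V ψ) (Sum.inr v)

theorem exists_rep (x : Glue U V ψ) :
    (∃ u : U, (inl u : Glue U V ψ) = x) ∨ ∃ v : V, (inr v : Glue U V ψ) = x := by
  obtain ⟨y, rfl⟩ := Quotient.exists_rep x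
  rcases y with u | v
  · exact Or.inl ⟨u, rfl⟩
  · exact Or.inr ⟨v, rfl⟩

theorem inl_eq_inl {u u' : U} : (inl u : Glue U V ψ) = inl u' ↔ u = u' :=
  ⟨fun h => Quotient.exact h, fun h => h ▸ rfl⟩

theorem inr_eq_inr {v v' : V} : (inr v : Glue U V ψ) = inr v' ↔ v = v' :=
  ⟨fun h => Quotient.exact h, fun h => h ▸ rfl⟩

theorem inl_eq_inr {u : U} {v : V} :
    (inl u : Glue U V ψ) = inr v ↔ (v : Q) ∈ ψ.source ∧ ψ v = u :=
  ⟨fun h => Quotient.exact h, fun h => Quotient.sound h⟩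

theorem continuous_inl : Continuous (inl : U → Glue U V ψ) :=
  continuous_quotient_mk'.comp _root_.continuous_inl

theorem continuous_inr : Continuous (inr : V → Glue U V ψ) :=
  continuous_quotient_mk'.comp _root_.continuous_inr

theorem isOpen_iff {S : Set (Glue U V ψ)} :
    IsOpen S ↔ IsOpen (inl ⁻¹' S : Set U) ∧ IsOpen (inr ⁻¹' S : Set V) := by
  constructor
  · exact fun h => ⟨h.preimage continuous_inl, h.preimage continuous_inr⟩
  · rintro ⟨h1, h2⟩
    refine (isQuotientMap_quotient_mk'.isOpen_preimage (s := S)).1 ?_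
    exact isOpen_sum_iff.2 ⟨h1, h2⟩

theorem isOpenEmbedding_inl : Topology.IsOpenEmbedding (inl : U → Glue U V ψ) := by
  refine .of_continuous_injective_isOpenMap continuous_inl (fun u u' h => inl_eq_inl.1 h) ?_
  intro O hO
  refine isOpen_iff.2 ⟨?_, ?_⟩
  · rwa [Set.preimage_image_eq _ (fun u u' h => inl_eq_inl.1 h)]
  · have h1 : IsOpen ((↑) '' O : Set P) := U.2.isOpenMap_subtype_val O hO
    convert (ψ.isOpen_inter_preimage h1).preimage continuous_subtype_val using 1
    ext v
    constructor
    · rintro ⟨u, hu, h⟩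
      obtain ⟨h2, h3⟩ := inl_eq_inr.1 h
      exact ⟨h2, u, hu, h3.symm⟩
    · rintro ⟨h2, u, hu, h3⟩
      exact ⟨u, hu, inl_eq_inr.2 ⟨h2, h3.symm⟩⟩

theorem isOpenEmbedding_inr : Topology.IsOpenEmbedding (inr : V → Glue U V ψ) := by
  refine .of_continuous_injective_isOpenMap continuous_inr (fun u u' h => inr_eq_inr.1 h) ?_
  intro O hO
  refine isOpen_iff.2 ⟨?_, ?_⟩
  · have h1 : IsOpen ((↑) '' O : Set Q) := V.2.isOpenMap_subtype_val O hO
    convert (ψ.isOpen_image_source_inter h1).preimage continuous_subtype_val using 1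
    ext u
    constructor
    · rintro ⟨v, hv, h⟩
      obtain ⟨h2, h3⟩ := inl_eq_inr.1 h.symm
      exact ⟨v, ⟨h2, v, hv, rfl⟩, h3⟩
    · rintro ⟨_, ⟨h2, v, hv, rfl⟩, h3⟩
      exact ⟨v, hv, (inl_eq_inr.2 ⟨h2, h3⟩).symm⟩
  · rwa [Set.preimage_image_eq _ (fun u u' h => inr_eq_inr.1 h)]

/-- The inverse of `Glue.inl`, as a map from an open subset of the glued space to `P`. -/
def projLeft (ψ : OpenPartialHomeomorph Q P) (V : TopologicalSpace.Opens Q) (u : U) :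
    OpenPartialHomeomorph (Glue U V ψ) P :=
  haveI : Nonempty U := ⟨u⟩
  ((isOpenEmbedding_inl (U := U) (V := V) (ψ := ψ)).toOpenPartialHomeomorph inl).symm.trans
    (U.openPartialHomeomorphSubtypeCoe ⟨u⟩)

/-- The inverse of `Glue.inr`, as a map from an open subset of the glued space to `Q`. -/
def projRight (ψ : OpenPartialHomeomorph Q P) (U : TopologicalSpace.Opens P) (v : V) :
    OpenPartialHomeomorph (Glue U V ψ) Q :=
  haveI : Nonempty V := ⟨v⟩
  ((isOpenEmbedding_inr (U := U) (V := V) (ψ := ψ)).toOpenPartialHomeomorph inr).symm.trans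
    (V.openPartialHomeomorphSubtypeCoe ⟨v⟩)

theorem projLeft_source (u : U) : (projLeft ψ V u).source = Set.range inl := by
  simp [projLeft]

theorem projLeft_target (u : U) : (projLeft ψ V u).target = U := by
  simp [projLeft]

theorem projRight_source (v : V) : (projRight ψ U v).source = Set.range inr := by
  simp [projRight]

theorem projRight_target (v : V) : (projRight ψ U v).target = V := by
  simp [projRight]

theorem projLeft_inl (u u' : U) : projLeft ψ V u (inl u') = u' := by
  have : Nonempty U := ⟨u⟩
  simp [projLeft, Topology.IsOpenEmbedding.toOpenPartialHomeomorph_left_inv]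

theorem projRight_inr (v v' : V) : projRight ψ U v (inr v') = v' := by
  have : Nonempty V := ⟨v⟩
  simp [projRight, Topology.IsOpenEmbedding.toOpenPartialHomeomorph_left_inv]

theorem projLeft_symm (u u' : U) : (projLeft ψ V u).symm u' = inl u' := by
  have h := (projLeft ψ V u).left_inv (x := inl u') (by rw [projLeft_source]; exact ⟨u', rfl⟩)
  rwa [projLeft_inl] at h

theorem projRight_symm (v v' : V) : (projRight ψ U v).symm v' = inr v' := by
  have h := (projRight ψ U v).left_inv (x := inr v') (by rw [projRight_source]; exact ⟨v', rfl⟩)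
  rwa [projRight_inr] at h

end Glue

end Glue

section GlueManifold

variable {E F : Type*} [NormedAddCommGroup E] [NormedSpace ℝ E] [NormedAddCommGroup F]
  [NormedSpace ℝ F] {P Q : Type*} [TopologicalSpace P] [TopologicalSpace Q]
  [ChartedSpace E P] [ChartedSpace (ModelProd ℝ F) Q]
  {U : TopologicalSpace.Opens P} {V : TopologicalSpace.Opens Q} {ψ : OpenPartialHomeomorph Q P}

namespace Glue

/-- The chart of the glued space around `inl u`: the chart of `P` around `u`. -/
def chartLeft (ψ : OpenPartialHomeomorph Q P) (V : TopologicalSpace.Opens Q) (u : U) :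
    OpenPartialHomeomorph (Glue U V ψ) E :=
  (projLeft ψ V u).trans (chartAt E (u : P))

/-- The chart of the glued space around `inr v`: the chart of `Q` around `v`, followed by the linear
isomorphism `ℓ` between the model spaces. -/
def chartRight (ℓ : (ℝ × F) ≃L[ℝ] E) (ψ : OpenPartialHomeomorph Q P)
    (U : TopologicalSpace.Opens P) (v : V) : OpenPartialHomeomorph (Glue U V ψ) E :=
  (projRight ψ U v).trans
    ((chartAt (ModelProd ℝ F) (v : Q)).trans ℓ.toHomeomorph.toOpenPartialHomeomorph)

open Classical in
/-- The smooth atlas on the glued space that is induced by the atlases of the two pieces. -/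
@[reducible] def chartedSpace (ℓ : (ℝ × F) ≃L[ℝ] E) (U : TopologicalSpace.Opens P)
    (V : TopologicalSpace.Opens Q) (ψ : OpenPartialHomeomorph Q P) :
    ChartedSpace E (Glue U V ψ) where
  atlas := Set.range (chartLeft ψ V) ∪ Set.range (chartRight ℓ ψ U)
  chartAt x :=
    if h : ∃ u : U, (inl u : Glue U V ψ) = x then chartLeft ψ V h.choose
    else chartRight ℓ ψ U ((exists_rep x).resolve_left h).choose
  mem_chart_source x := by
    split_ifs with h
    · have h1 := h.choose_spec
      set u := h.choose
      rw [← h1, chartLeft, OpenPartialHomeomorph.trans_source, projLeft_source]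
      refine ⟨⟨u, rfl⟩, ?_⟩
      rw [Set.mem_preimage, projLeft_inl]
      exact mem_chart_source E (u : P)
    · have h1 := ((exists_rep x).resolve_left h).choose_spec
      set v := ((exists_rep x).resolve_left h).choose
      rw [← h1, chartRight, OpenPartialHomeomorph.trans_source, projRight_source]
      refine ⟨⟨v, rfl⟩, ?_⟩
      rw [Set.mem_preimage, projRight_inr]
      simp
  chart_mem_atlas x := by
    split_ifs with h
    · exact Or.inl ⟨_, rfl⟩
    · exact Or.inr ⟨_, rfl⟩

theorem contMDiffOn_chartRight_aux [IsManifold (𝓘(ℝ, ℝ).prod 𝓘(ℝ, F)) ∞ Q]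
    (ℓ : (ℝ × F) ≃L[ℝ] E) (v : Q) :
    ContMDiffOn (𝓘(ℝ, ℝ).prod 𝓘(ℝ, F)) 𝓘(ℝ, E) ∞
      ((chartAt (ModelProd ℝ F) v).trans ℓ.toHomeomorph.toOpenPartialHomeomorph)
      (chartAt (ModelProd ℝ F) v).source := by
  have h1 : ContMDiffOn (𝓘(ℝ, ℝ).prod 𝓘(ℝ, F)) 𝓘(ℝ, ℝ × F) ∞
      (extChartAt (𝓘(ℝ, ℝ).prod 𝓘(ℝ, F)) v) (chartAt (ModelProd ℝ F) v).source :=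
    contMDiffOn_extChartAt
  exact (ℓ.contDiff.contMDiff (n := ∞)).comp_contMDiffOn h1

theorem contMDiffOn_chartRight_symm_aux [IsManifold (𝓘(ℝ, ℝ).prod 𝓘(ℝ, F)) ∞ Q]
    (ℓ : (ℝ × F) ≃L[ℝ] E) (v : Q) :
    ContMDiffOn 𝓘(ℝ, E) (𝓘(ℝ, ℝ).prod 𝓘(ℝ, F)) ∞
      ((chartAt (ModelProd ℝ F) v).trans ℓ.toHomeomorph.toOpenPartialHomeomorph).symm
      ((chartAt (ModelProd ℝ F) v).trans ℓ.toHomeomorph.toOpenPartialHomeomorph).target := by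
  have h1 : ContMDiffOn 𝓘(ℝ, ℝ × F) (𝓘(ℝ, ℝ).prod 𝓘(ℝ, F)) ∞
      (extChartAt (𝓘(ℝ, ℝ).prod 𝓘(ℝ, F)) v).symm
      (extChartAt (𝓘(ℝ, ℝ).prod 𝓘(ℝ, F)) v).target :=
    contMDiffOn_extChartAt_symm v
  refine h1.comp (ℓ.symm.contDiff.contMDiff (n := ∞)).contMDiffOn ?_
  intro y hy
  simpa [extChartAt, ModelWithCorners.prod] using hy

/-- Two charts of the glued space are smoothly compatible if the coordinate change between the
pieces is smooth. -/
theorem transition_aux {HP HQ EP EQ X A B : Type*} [NormedAddCommGroup EP] [NormedSpace ℝ EP]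
    [NormedAddCommGroup EQ] [NormedSpace ℝ EQ] [TopologicalSpace HP] [TopologicalSpace HQ]
    [TopologicalSpace X] [TopologicalSpace A] [TopologicalSpace B] [ChartedSpace HP A]
    [ChartedSpace HQ B] {I : ModelWithCorners ℝ EP HP} {J : ModelWithCorners ℝ EQ HQ}
    (a : OpenPartialHomeomorph X A) (b : OpenPartialHomeomorph X B)
    (c : OpenPartialHomeomorph A E) (d : OpenPartialHomeomorph B E)
    (hc : ContMDiffOn 𝓘(ℝ, E) I ∞ c.symm c.target) (hd : ContMDiffOn J 𝓘(ℝ, E) ∞ d d.source)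
    (f : A → B) (S : Set A) (hf : ContMDiffOn I J ∞ f S)
    (hS : ∀ p ∈ a.target, a.symm p ∈ b.source → p ∈ S ∧ b (a.symm p) = f p) :
    ContDiffOn ℝ ∞ (𝓘(ℝ, E) ∘ (a.trans c).symm ≫ₕ (b.trans d) ∘ 𝓘(ℝ, E).symm)
      (𝓘(ℝ, E).symm ⁻¹' ((a.trans c).symm ≫ₕ (b.trans d)).source ∩ Set.range 𝓘(ℝ, E)) := by
  rw [← contMDiffOn_iff_contDiffOn]
  have key : ∀ y ∈ ((a.trans c).symm ≫ₕ (b.trans d)).source,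
      y ∈ c.target ∧ c.symm y ∈ S ∧ f (c.symm y) ∈ d.source ∧
        b (a.symm (c.symm y)) = f (c.symm y) := by
    intro y hy
    simp only [OpenPartialHomeomorph.trans_source, OpenPartialHomeomorph.symm_source,
      OpenPartialHomeomorph.trans_target, Set.mem_inter_iff, Set.mem_preimage,
      OpenPartialHomeomorph.coe_trans_symm, Function.comp_apply] at hy
    obtain ⟨⟨h1, h2⟩, h3, h4⟩ := hy
    obtain ⟨h5, h6⟩ := hS _ h2 h3
    exact ⟨h1, h5, h6 ▸ h4, h6⟩
  have h1 : ContMDiffOn 𝓘(ℝ, E) 𝓘(ℝ, E) ∞ (d ∘ f ∘ c.symm)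
      ((a.trans c).symm ≫ₕ (b.trans d)).source := by
    refine hd.comp (hf.comp (hc.mono ?_) ?_) ?_
    · exact fun y hy => (key y hy).1
    · exact fun y hy => (key y hy).2.1
    · exact fun y hy => (key y hy).2.2.1
  refine (h1.congr ?_).mono (by intro y hy; simpa using hy.1)
  intro y hy
  have := (key y hy).2.2.2
  simp [this]

/-- The glued space is a smooth manifold if the gluing map is a diffeomorphism. -/
theorem isManifold [IsManifold 𝓘(ℝ, E) ∞ P] [IsManifold (𝓘(ℝ, ℝ).prod 𝓘(ℝ, F)) ∞ Q]
    (ℓ : (ℝ × F) ≃L[ℝ] E)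
    (h1 : ContMDiffOn (𝓘(ℝ, ℝ).prod 𝓘(ℝ, F)) 𝓘(ℝ, E) ∞ ψ ψ.source)
    (h2 : ContMDiffOn 𝓘(ℝ, E) (𝓘(ℝ, ℝ).prod 𝓘(ℝ, F)) ∞ ψ.symm ψ.target) :
    letI := chartedSpace ℓ U V ψ
    IsManifold 𝓘(ℝ, E) ∞ (Glue U V ψ) := by
  let _ := chartedSpace ℓ U V ψ
  refine isManifold_of_contDiffOn 𝓘(ℝ, E) ∞ (Glue U V ψ) ?_
  have hd : ∀ v : Q, ContMDiffOn (𝓘(ℝ, ℝ).prod 𝓘(ℝ, F)) 𝓘(ℝ, E) ∞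
      ((chartAt (ModelProd ℝ F) v).trans ℓ.toHomeomorph.toOpenPartialHomeomorph)
      ((chartAt (ModelProd ℝ F) v).trans ℓ.toHomeomorph.toOpenPartialHomeomorph).source :=
    fun v => (contMDiffOn_chartRight_aux ℓ v).mono (fun y hy => hy.1)
  have hc := contMDiffOn_chartRight_symm_aux (Q := Q) ℓ
  rintro _ _ (⟨u, rfl⟩ | ⟨v, rfl⟩) (⟨u', rfl⟩ | ⟨v', rfl⟩)
  · refine transition_aux _ _ _ _ (contMDiffOn_chart_symm (I := 𝓘(ℝ, E)))
      (contMDiffOn_chart (I := 𝓘(ℝ, E))) id Set.univ contMDiffOn_id ?_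
    intro p hp hp'
    rw [projLeft_target] at hp
    refine ⟨trivial, ?_⟩
    rw [projLeft_symm u ⟨p, hp⟩, projLeft_inl]
    rfl
  · refine transition_aux _ _ _ _ (contMDiffOn_chart_symm (I := 𝓘(ℝ, E)))
      (hd v') ψ.symm ψ.target h2 ?_
    intro p hp hp'
    rw [projLeft_target] at hp
    rw [projLeft_symm u ⟨p, hp⟩, projRight_source] at hp'
    obtain ⟨w, hw⟩ := hp'
    rw [projLeft_symm u ⟨p, hp⟩, ← hw, projRight_inr]
    obtain ⟨h3, h4⟩ := inl_eq_inr.1 hw.symm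
    refine ⟨?_, ?_⟩
    · have := ψ.map_source h3
      rwa [h4] at this
    · have := ψ.left_inv h3
      rw [h4] at this
      exact this.symm
  · refine transition_aux _ _ _ _ (hc v) (contMDiffOn_chart (I := 𝓘(ℝ, E))) ψ ψ.source h1 ?_
    intro p hp hp'
    rw [projRight_target] at hp
    rw [projRight_symm v ⟨p, hp⟩, projLeft_source] at hp'
    obtain ⟨w, hw⟩ := hp'
    rw [projRight_symm v ⟨p, hp⟩, ← hw, projLeft_inl]
    obtain ⟨h3, h4⟩ := inl_eq_inr.1 hw
    exact ⟨h3, h4.symm⟩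
  · refine transition_aux _ _ _ _ (hc v) (hd v') id Set.univ contMDiffOn_id ?_
    intro p hp hp'
    rw [projRight_target] at hp
    refine ⟨trivial, ?_⟩
    rw [projRight_symm v ⟨p, hp⟩, projRight_inr]
    rfl

end Glue

end GlueManifold

section Forms

variable {E E' : Type*} [NormedAddCommGroup E] [NormedSpace ℝ E] [NormedAddCommGroup E']
  [NormedSpace ℝ E'] {N N' : Type*} [TopologicalSpace N] [ChartedSpace E N]
  [TopologicalSpace N'] [ChartedSpace E' N']

/-- A (not necessarily continuous) differential `k`-form on the manifold `N`. -/
abbrev DiffForm (E : Type*) [NormedAddCommGroup E] [NormedSpace ℝ E] (N : Type*)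
    [TopologicalSpace N] [ChartedSpace E N] (k : ℕ) :=
  ∀ x : N, TangentSpace 𝓘(ℝ, E) x [⋀^Fin k]→L[ℝ] ℝ

/-- The form `α` in the preferred chart around `x₀`: its pullback by the inverse of the chart. -/
def localForm {k : ℕ} (α : DiffForm E N k) (x₀ : N) (y : E) : E [⋀^Fin k]→L[ℝ] ℝ :=
  (α ((extChartAt 𝓘(ℝ, E) x₀).symm y)).compContinuousLinearMap
    (mfderiv 𝓘(ℝ, E) 𝓘(ℝ, E) (extChartAt 𝓘(ℝ, E) x₀).symm y)

/-- A differential form is smooth if it is smooth in charts. -/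
def IsSmoothForm {k : ℕ} (α : DiffForm E N k) : Prop :=
  ∀ x₀ : N, ContDiffOn ℝ ∞ (localForm α x₀) (extChartAt 𝓘(ℝ, E) x₀).target

/-- The exterior derivative. At `x` it is computed in the preferred chart around `x`, which is
the chart through which the tangent space at `x` is the model space. -/
def extD {k : ℕ} (α : DiffForm E N k) : DiffForm E N (k + 1) :=
  fun x => (extDeriv (localForm α x) (extChartAt 𝓘(ℝ, E) x x) : E [⋀^Fin (k + 1)]→L[ℝ] ℝ)

/-- The pullback of a differential form by a map. -/
def pullbackForm {k : ℕ} (f : N → N') (α : DiffForm E' N' k) : DiffForm E N k :=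
  fun x => (α (f x)).compContinuousLinearMap (mfderiv 𝓘(ℝ, E) 𝓘(ℝ, E') f x)

/-- A symplectic form: a smooth, closed, nondegenerate two-form. -/
structure IsSymplectic (Ω : DiffForm E N 2) : Prop where
  smooth : IsSmoothForm Ω
  closed : ∀ x, extD Ω x = 0
  nondegenerate : ∀ x (u : TangentSpace 𝓘(ℝ, E) x), (∀ v, Ω x ![u, v] = 0) → u = 0

/-- A field of endomorphisms of the tangent spaces. -/
abbrev EndoField (E : Type*) [NormedAddCommGroup E] [NormedSpace ℝ E] (N : Type*)
    [TopologicalSpace N] [ChartedSpace E N] :=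
  ∀ x : N, TangentSpace 𝓘(ℝ, E) x →L[ℝ] TangentSpace 𝓘(ℝ, E) x

/-- A smooth almost-complex structure that is compatible with the two-form `Ω`. -/
structure IsCompatible [IsManifold 𝓘(ℝ, E) ∞ N] (Ω : DiffForm E N 2) (J : EndoField E N) :
    Prop where
  smooth : ContMDiff 𝓘(ℝ, E) (𝓘(ℝ, E).prod 𝓘(ℝ, E →L[ℝ] E)) ∞
    (fun x => Bundle.TotalSpace.mk' (E →L[ℝ] E)
      (E := fun x : N => TangentSpace 𝓘(ℝ, E) x →L[ℝ] TangentSpace 𝓘(ℝ, E) x) x (J x))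
  sq : ∀ x u, J x (J x u) = -u
  invariant : ∀ x u v, Ω x ![J x u, J x v] = Ω x ![u, v]
  pos : ∀ x u, u ≠ 0 → 0 < Ω x ![u, J x u]

/-- The almost-complex structure `J` is tamed by the two-form `Ω`. -/
def IsTamedBy (J : EndoField E N) (Ω : DiffForm E N 2) : Prop :=
  ∀ x u, u ≠ 0 → 0 < Ω x ![u, J x u]

end Forms

/-- The model space of the symplectic manifold, of dimension `2n + 2`. -/
abbrev ModelW (n : ℕ) := EuclideanSpace ℝ (Fin (2 * n + 2))

/-- The model space of the hypersurface, of dimension `2n + 1`. -/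
abbrev ModelM (n : ℕ) := EuclideanSpace ℝ (Fin (2 * n + 1))

/-- A linear isomorphism between the model space of `ℝ × M` and that of `W`. -/
def modelIso (n : ℕ) : (ℝ × ModelM n) ≃L[ℝ] ModelW n :=
  ContinuousLinearEquiv.ofFinrankEq (by simp [Module.finrank_prod]; ring)

section Framed

variable {n : ℕ} {M : Type*} [TopologicalSpace M] [ChartedSpace (ModelM n) M]

/-- The value of `λ ∧ ωⁿ` on `v`, up to a positive constant that depends only on `n`. -/
def topWedge (lam : DiffForm (ModelM n) M 1) (om : DiffForm (ModelM n) M 2) (m : M)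
    (v : Fin (2 * n + 1) → TangentSpace 𝓘(ℝ, ModelM n) m) : ℝ :=
  ∑ σ : Equiv.Perm (Fin (2 * n + 1)), (Equiv.Perm.sign σ : ℝ) * lam m ![v (σ ⟨0, by omega⟩)] *
    ∏ i : Fin n, om m ![v (σ ⟨2 * i + 1, by omega⟩), v (σ ⟨2 * i + 2, by omega⟩)]

/-- A framed Hamiltonian structure: `ω` is closed and `λ ∧ ωⁿ` vanishes nowhere, so that it is
positive for the orientation of `M` which it defines. -/
structure IsFramedHamiltonian (lam : DiffForm (ModelM n) M 1) (om : DiffForm (ModelM n) M 2) :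
    Prop where
  smooth_lam : IsSmoothForm lam
  smooth_om : IsSmoothForm om
  closed : ∀ m, extD om m = 0
  volume : ∀ m (v : Fin (2 * n + 1) → TangentSpace 𝓘(ℝ, ModelM n) m),
    LinearIndependent ℝ v → topWedge lam om m v ≠ 0

/-- A field of endomorphisms of the tangent spaces `T_(t,m) (ℝ × M) = ℝ × T_m M`. The vector
`∂_a` is `(1, 0)`, the form `da` is the first projection, and forms on `M` are pulled back by the
second projection. -/
abbrev CylField (n : ℕ) (M : Type*) [TopologicalSpace M] [ChartedSpace (ModelM n) M] :=
  ℝ → ∀ m : M, (ℝ × TangentSpace 𝓘(ℝ, ModelM n) m) →L[ℝ] (ℝ × TangentSpace 𝓘(ℝ, ModelM n) m)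

/-- Smoothness of a field of endomorphisms on a subset of `ℝ × M`. -/
def CylField.SmoothOn [IsManifold 𝓘(ℝ, ModelM n) ∞ M] (J : CylField n M) (S : Set (ℝ × M)) :
    Prop :=
  ContMDiffOn (𝓘(ℝ, ℝ).prod 𝓘(ℝ, ModelM n))
    ((𝓘(ℝ, ℝ).prod 𝓘(ℝ, ModelM n)).prod 𝓘(ℝ, (ℝ × ModelM n) →L[ℝ] (ℝ × ModelM n))) ∞
    (fun p : ℝ × M => Bundle.TotalSpace.mk' ((ℝ × ModelM n) →L[ℝ] (ℝ × ModelM n))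
      (E := fun p : ℝ × M => TangentSpace (𝓘(ℝ, ℝ).prod 𝓘(ℝ, ModelM n)) p →L[ℝ]
        TangentSpace (𝓘(ℝ, ℝ).prod 𝓘(ℝ, ModelM n)) p) p (J p.1 p.2)) S

/-- The value of `da ∧ λ` on two tangent vectors of `ℝ × M`. -/
def daWedge (lam : DiffForm (ModelM n) M 1) (m : M)
    (u u' : ℝ × TangentSpace 𝓘(ℝ, ModelM n) m) : ℝ :=
  u.1 * lam m ![u'.2] - u'.1 * lam m ![u.2]

/-- The value of `ω + s dλ` on two tangent vectors of `ℝ × M`. -/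
def omegaHat (lam : DiffForm (ModelM n) M 1) (om : DiffForm (ModelM n) M 2) (s : ℝ) (m : M)
    (u u' : ℝ × TangentSpace 𝓘(ℝ, ModelM n) m) : ℝ :=
  om m ![u.2, u'.2] + s * extD lam m ![u.2, u'.2]

/-- `J (∂_a) = X` and `J X = -∂_a`, where `X` is the vector tangent to `M` such that
`λ(X) = 1` and `(ω + s dλ)(X, -) = 0`. -/
def SwapsHamiltonian (lam : DiffForm (ModelM n) M 1) (om : DiffForm (ModelM n) M 2) (s : ℝ)
    (m : M) (J : (ℝ × TangentSpace 𝓘(ℝ, ModelM n) m) →L[ℝ] (ℝ × TangentSpace 𝓘(ℝ, ModelM n) m)) :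
    Prop :=
  ∃ X : TangentSpace 𝓘(ℝ, ModelM n) m, lam m ![X] = 1 ∧
    (∀ u, omegaHat lam om s m (0, X) u = 0) ∧ J (1, 0) = (0, X) ∧ J (0, X) = (-1, 0)

/-- An almost-complex structure on `ℝ × M` that is adapted to the framed Hamiltonian structure
`(λ, ω)`. -/
structure IsAdapted [IsManifold 𝓘(ℝ, ModelM n) ∞ M] (lam : DiffForm (ModelM n) M 1)
    (om : DiffForm (ModelM n) M 2) (J : CylField n M) : Prop where
  smooth : J.SmoothOn Set.univ
  sq : ∀ t m u, J t m (J t m u) = -u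
  translation : ∀ t t' m, J t m = J t' m
  swaps : ∀ t m, SwapsHamiltonian lam om 0 m (J t m)
  preserves : ∀ t m v, lam m ![v] = 0 → (J t m (0, v)).1 = 0 ∧ lam m ![(J t m (0, v)).2] = 0
  invariant : ∀ t m v v', lam m ![v] = 0 → lam m ![v'] = 0 →
    omegaHat lam om 0 m (J t m (0, v)) (J t m (0, v')) = omegaHat lam om 0 m (0, v) (0, v')
  pos : ∀ t m v, lam m ![v] = 0 → v ≠ 0 → 0 < omegaHat lam om 0 m (0, v) (J t m (0, v))

/-- The interpolating almost-complex structures on `[-8ε₀, 0] × M` and `[0, 8ε₀] × M`, seen as one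
almost-complex structure on `[-8ε₀, 8ε₀] × M`; both agree with `JNeck` near `{0} × M`.
The two-form `ω̂` at `(t, m)` is `ω + β(t) dλ`. -/
structure IsInterpolating [IsManifold 𝓘(ℝ, ModelM n) ∞ M] (ε₀ : ℝ) (β : ℝ → ℝ)
    (lam : DiffForm (ModelM n) M 1) (om : DiffForm (ModelM n) M 2) (JNeck J : CylField n M) :
    Prop where
  smooth : J.SmoothOn (Set.Icc (-8 * ε₀) (8 * ε₀) ×ˢ Set.univ)
  sq : ∀ t ∈ Set.Icc (-8 * ε₀) (8 * ε₀), ∀ m u, J t m (J t m u) = -u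
  swaps : ∀ t ∈ Set.Icc (-8 * ε₀) (8 * ε₀), ∀ m, SwapsHamiltonian lam om (β t) m (J t m)
  preserves : ∀ t ∈ Set.Icc (-8 * ε₀) (8 * ε₀), ∀ m v, lam m ![v] = 0 →
    (J t m (0, v)).1 = 0 ∧ lam m ![(J t m (0, v)).2] = 0
  preserves_ker : ∀ t ∈ Set.Icc (-8 * ε₀) (8 * ε₀), ∀ m u,
    (∀ u', omegaHat lam om (β t) m u u' = 0) → ∀ u', omegaHat lam om (β t) m (J t m u) u' = 0
  symmetric : ∀ t ∈ Set.Icc (-8 * ε₀) (8 * ε₀), ∀ m v v', lam m ![v] = 0 → lam m ![v'] = 0 →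
    omegaHat lam om (β t) m (0, v) (J t m (0, v')) =
      omegaHat lam om (β t) m (0, v') (J t m (0, v))
  pos : ∀ t ∈ Set.Icc (-8 * ε₀) (8 * ε₀), ∀ m v, lam m ![v] = 0 → v ≠ 0 →
    0 < omegaHat lam om (β t) m (0, v) (J t m (0, v))
  eq_neck : ∀ t ∈ Set.Icc (-2 * ε₀) (2 * ε₀), ∀ m, J t m = JNeck t m

end Framed

/-- The conditions on the function `β_*`. It is defined on all of `ℝ`, extending it by the identity
from `[-8ε₀, 8ε₀]`. -/
structure IsCutoff (ε₀ : ℝ) (β : ℝ → ℝ) : Prop where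
  smooth : ContDiff ℝ ∞ β
  eq_self : ∀ t, 4 * ε₀ ≤ |t| → β t = t
  eq_zero : ∀ t, |t| ≤ 2 * ε₀ → β t = 0
  deriv_pos : ∀ t, 2 * ε₀ < |t| → |t| ≤ 4 * ε₀ → 0 < deriv β t

/-- The conditions on the function `χ`. -/
structure IsMetricCutoff (ε₀ : ℝ) (χ : ℝ → ℝ) : Prop where
  smooth : ContDiff ℝ ∞ χ
  mem_Icc : ∀ t, χ t ∈ Set.Icc (0 : ℝ) 1
  eq_one : ∀ t, t < 3 * ε₀ → χ t = 1
  eq_zero : ∀ t, 5 * ε₀ < t → χ t = 0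

/-- The function `β_L`. -/
def betaL (β : ℝ → ℝ) (L t : ℝ) : ℝ :=
  if t < -L then β (t + L) else if t ≤ L then 0 else β (t - L)

/-- The function `θ`. -/
def theta (β χ : ℝ → ℝ) (t : ℝ) : ℝ := χ |t| + (1 - χ |t|) * deriv β t

/-- The function `θ` on the neck of length parameter `L`; it is `1` for `|t| ≤ L`. -/
def thetaL (β χ : ℝ → ℝ) (L t : ℝ) : ℝ :=
  if t < -L then theta β χ (t + L) else if t ≤ L then 1 else theta β χ (t - L)

/-- The properties of the increasing function `h_L` that squeezes the neck `[-L-8ε₀, L+8ε₀]` to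
`[-8ε₀, 8ε₀]`. -/
structure IsSqueeze (ε₀ : ℝ) (β : ℝ → ℝ) (κ L : ℝ) (h : ℝ → ℝ) : Prop where
  smooth : ContDiff ℝ ∞ h
  mapsTo : Set.MapsTo h (Set.Icc (-L - 8 * ε₀) (L + 8 * ε₀)) (Set.Icc (-8 * ε₀) (8 * ε₀))
  deriv_pos : ∀ t ∈ Set.Icc (-L - 8 * ε₀) (L + 8 * ε₀), 0 < deriv h t
  eq_betaL : ∃ δ > 0, ∀ t ∈ Set.Icc (-L - 8 * ε₀) (L + 8 * ε₀),
    t < -L - 11 * ε₀ / 4 + δ ∨ L + 11 * ε₀ / 4 - δ < t → h t = betaL β L t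
  abs_sub_le : ∀ t ∈ Set.Icc (-L - 8 * ε₀) (L + 8 * ε₀), |h t - betaL β L t| ≤ 100 * κ⁻¹ * L⁻¹
  le_deriv : ∀ t ∈ Set.Icc (-L - 8 * ε₀) (L + 8 * ε₀), 1 / 2 * κ⁻¹ * (L ^ 2)⁻¹ ≤ deriv h t

section Neck

/-- The partial homeomorphism `t ↦ t - L` for `t > L`, `t ↦ t + L` for `t < -L`, from
`L < |t| < L + r` to `0 < |t| < r`. -/
def shrink (L r : ℝ) (hL : 0 < L) : OpenPartialHomeomorph ℝ ℝ where
  toFun t := if 0 < t then t - L else t + L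
  invFun t := if 0 < t then t + L else t - L
  source := {t | L < |t| ∧ |t| < L + r}
  target := {t | 0 < |t| ∧ |t| < r}
  map_source' t ht := by
    simp only [Set.mem_ofPred_eq] at ht ⊢
    split_ifs with h
    · rw [abs_of_pos h] at ht
      rw [abs_of_pos] <;> first | constructor <;> linarith | linarith
    · rw [abs_of_nonpos (not_lt.1 h)] at ht
      rw [abs_of_neg] <;> first | constructor <;> linarith | linarith
  map_target' t ht := by
    simp only [Set.mem_ofPred_eq] at ht ⊢
    split_ifs with h
    · rw [abs_of_pos h] at ht
      rw [abs_of_pos] <;> first | constructor <;> linarith | linarith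
    · rw [abs_of_nonpos (not_lt.1 h)] at ht
      rw [abs_of_neg] <;> first | constructor <;> linarith | linarith
  left_inv' t ht := by
    simp only [Set.mem_ofPred_eq] at ht
    by_cases h : 0 < t
    · rw [abs_of_pos h] at ht
      simp [h, ht.1]
    · rw [abs_of_nonpos (not_lt.1 h)] at ht
      have : ¬ 0 < t + L := by linarith
      simp [h, this]
  right_inv' t ht := by
    simp only [Set.mem_ofPred_eq] at ht
    by_cases h : 0 < t
    · have : 0 < t + L := by linarith
      simp [h, this]
    · have : ¬ 0 < t - L := by linarith
      simp [h, this]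
  open_source := (isOpen_lt continuous_const continuous_abs).inter
    (isOpen_lt continuous_abs continuous_const)
  open_target := (isOpen_lt continuous_const continuous_abs).inter
    (isOpen_lt continuous_abs continuous_const)
  continuousOn_toFun := by
    refine ContinuousOn.if ?_ (by fun_prop) (by fun_prop)
    rintro t ⟨ht, h⟩
    have h0 : t = 0 := by simpa using (frontier_lt_subset_eq continuous_const continuous_id h).symm
    simp only [Set.mem_ofPred_eq, h0, abs_zero] at ht
    linarith
  continuousOn_invFun := by
    refine ContinuousOn.if ?_ (by fun_prop) (by fun_prop)
    rintro t ⟨ht, h⟩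
    have h0 : t = 0 := by simpa using (frontier_lt_subset_eq continuous_const continuous_id h).symm
    simp [h0] at ht

variable (n : ℕ) (ε₀ : ℝ) (β : ℝ → ℝ) (W M : Type*) [TopologicalSpace W]
  [ChartedSpace (ModelW n) W] [IsManifold 𝓘(ℝ, ModelW n) ∞ W] [TopologicalSpace M]
  [ChartedSpace (ModelM n) M] [IsManifold 𝓘(ℝ, ModelM n) ∞ M]

/-- A symplectic manifold `(W, Ω)` with a regular energy level `M = H⁻¹(0)`, where the
manifold `M` is given with its inclusion into `W`, and a one-form `λ` such that `(λ, Ω|_M)` is a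
framed Hamiltonian structure on `M`. -/
structure EnergyLevel where
  Om : DiffForm (ModelW n) W 2
  symplectic : IsSymplectic Om
  H : W → ℝ
  smooth_H : ContMDiff 𝓘(ℝ, ModelW n) 𝓘(ℝ, ℝ) ∞ H
  regular : ∀ w, H w = 0 → mfderiv 𝓘(ℝ, ModelW n) 𝓘(ℝ, ℝ) H w ≠ 0
  incl : M → W
  embedding : Manifold.IsSmoothEmbedding 𝓘(ℝ, ModelM n) 𝓘(ℝ, ModelW n) ∞ incl
  range_incl : Set.range incl = H ⁻¹' {0}
  lam : DiffForm (ModelM n) M 1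
  framed : IsFramedHamiltonian lam (pullbackForm incl Om)

variable {n W M}

/-- The two-form `ω = Ω|_M`. -/
def EnergyLevel.om (S : EnergyLevel n W M) : DiffForm (ModelM n) M 2 := pullbackForm S.incl S.Om

/-- A normal form of `Ω` near `M`: a diffeomorphism `ι` from `(-ε, ε) × M` onto a neighborhood of
`M`, with `ι(0, m) = m` and `ι^*Ω = ω + d(aλ) = ω + a dλ + da ∧ λ`, that maps the parts `a ≤ 0`
and `a ≥ 0` to `H ≤ 0` and `H ≥ 0`. -/
structure Collar (S : EnergyLevel n W M) where
  ε : ℝ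
  toMap : OpenPartialHomeomorph (ℝ × M) W
  source_eq : toMap.source = Set.Ioo (-ε) ε ×ˢ Set.univ
  smooth : ContMDiffOn (𝓘(ℝ, ℝ).prod 𝓘(ℝ, ModelM n)) 𝓘(ℝ, ModelW n) ∞ toMap toMap.source
  smooth_symm : ContMDiffOn 𝓘(ℝ, ModelW n) (𝓘(ℝ, ℝ).prod 𝓘(ℝ, ModelM n)) ∞ toMap.symm
    toMap.target
  zero : ∀ m, toMap (0, m) = S.incl m
  nonpos : ∀ t ∈ Set.Ioo (-ε) ε, ∀ m, t ≤ 0 → S.H (toMap (t, m)) ≤ 0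
  nonneg : ∀ t ∈ Set.Ioo (-ε) ε, ∀ m, 0 ≤ t → 0 ≤ S.H (toMap (t, m))
  pullback_eq : ∀ t ∈ Set.Ioo (-ε) ε, ∀ (m : M) (u u' : ℝ × TangentSpace 𝓘(ℝ, ModelM n) m),
    S.Om (toMap (t, m))
      ![mfderiv (𝓘(ℝ, ℝ).prod 𝓘(ℝ, ModelM n)) 𝓘(ℝ, ModelW n) toMap (t, m) u,
        mfderiv (𝓘(ℝ, ℝ).prod 𝓘(ℝ, ModelM n)) 𝓘(ℝ, ModelW n) toMap (t, m) u'] =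
      omegaHat S.lam S.om t m u u' + daWedge S.lam m u u'

variable (W M)

/-- All the choices that enter the neck-stretching construction with parameters `ε₀` and `β_*`. -/
structure NeckData extends EnergyLevel n W M where
  collar : Collar toEnergyLevel
  lt_collar : 8 * ε₀ < collar.ε
  χ : ℝ → ℝ
  metricCutoff : IsMetricCutoff ε₀ χ
  JNeck : CylField n M
  adapted : IsAdapted lam toEnergyLevel.om JNeck
  JBetween : CylField n M
  interpolating : IsInterpolating ε₀ β lam toEnergyLevel.om JNeck JBetween
  JCore : EndoField (ModelW n) W
  compatible : IsCompatible Om JCore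
  core_eq : ∀ t, 6 * ε₀ ≤ |t| → |t| ≤ 8 * ε₀ →
    ∀ (m : M) (u : ℝ × TangentSpace 𝓘(ℝ, ModelM n) m),
      mfderiv (𝓘(ℝ, ℝ).prod 𝓘(ℝ, ModelM n)) 𝓘(ℝ, ModelW n) collar.toMap (t, m)
        (JBetween t m u) =
      JCore (collar.toMap (t, m))
        (mfderiv (𝓘(ℝ, ℝ).prod 𝓘(ℝ, ModelM n)) 𝓘(ℝ, ModelW n) collar.toMap (t, m) u)

variable {ε₀ β W M}

namespace NeckData

/-- `Core(W)`, the complement of `ι((-6ε₀, 6ε₀) × M)` in `W`. -/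
def core (D : NeckData (n := n) ε₀ β W M) : Set W :=
  (D.collar.toMap '' (Set.Ioo (-6 * ε₀) (6 * ε₀) ×ˢ Set.univ))ᶜ

/-- The complement of `M` in `W`, that is, the union of the interiors of `W₋` and `W₊`. -/
def openPart (D : NeckData (n := n) ε₀ β W M) : TopologicalSpace.Opens W :=
  ⟨{w | D.H w ≠ 0}, isOpen_ne.preimage D.smooth_H.continuous⟩

/-- The open neck `(-L-8ε₀, L+8ε₀) × M`. -/
def neck (_D : NeckData (n := n) ε₀ β W M) (L : ℝ) : TopologicalSpace.Opens (ℝ × M) :=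
  ⟨{p | |p.1| < L + 8 * ε₀}, isOpen_lt (continuous_abs.comp continuous_fst) continuous_const⟩

/-- The gluing map: it sends `(t, m)` to `ι(t - L, m)` if `L < t < L + 8ε₀` and to
`ι(t + L, m)` if `-L - 8ε₀ < t < -L`. -/
def gluingMap (D : NeckData (n := n) ε₀ β W M) (L : ℝ) (hL : 0 < L) :
    OpenPartialHomeomorph (ℝ × M) W :=
  ((shrink L (8 * ε₀) hL).prod (OpenPartialHomeomorph.refl M)).trans D.collar.toMap

/-- The manifold `W_L`, obtained by gluing `W₋`, `[-L-8ε₀, L+8ε₀] × M` and `W₊` together.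
It is written as the gluing of their interiors, which cover it. -/
def Stretched (D : NeckData (n := n) ε₀ β W M) (L : ℝ) (hL : 0 < L) : Type _ :=
  Glue D.openPart (D.neck L) (D.gluingMap L hL)

instance (D : NeckData (n := n) ε₀ β W M) (L : ℝ) (hL : 0 < L) :
    TopologicalSpace (D.Stretched L hL) :=
  inferInstanceAs (TopologicalSpace (Glue D.openPart (D.neck L) (D.gluingMap L hL)))

instance (D : NeckData (n := n) ε₀ β W M) (L : ℝ) (hL : 0 < L) :
    ChartedSpace (ModelW n) (D.Stretched L hL) :=
  Glue.chartedSpace (modelIso n) D.openPart (D.neck L) (D.gluingMap L hL)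

/-- The inclusion of `W ∖ M` into `W_L`. -/
def fromW (D : NeckData (n := n) ε₀ β W M) (L : ℝ) (hL : 0 < L) :
    D.openPart → D.Stretched L hL := Glue.inl

/-- The inclusion of the neck into `W_L`. -/
def fromNeck (D : NeckData (n := n) ε₀ β W M) (L : ℝ) (hL : 0 < L) :
    D.neck L → D.Stretched L hL := Glue.inr

theorem contDiffOn_shrink (L r : ℝ) (hL : 0 < L) :
    ContDiffOn ℝ ∞ (shrink L r hL) (shrink L r hL).source := by
  intro t ht
  have ht1 : L < |t| := ht.1
  have ht0 : t ≠ 0 := by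
    rintro rfl
    simp at ht1
    linarith
  rcases lt_or_gt_of_ne ht0 with h | h
  · refine (ContDiffAt.congr_of_eventuallyEq (f := fun t => t + L) (by fun_prop) ?_).contDiffWithinAt
    filter_upwards [Iio_mem_nhds h] with s hs
    exact if_neg (not_lt.2 (le_of_lt hs))
  · refine (ContDiffAt.congr_of_eventuallyEq (f := fun t => t - L) (by fun_prop) ?_).contDiffWithinAt
    filter_upwards [Ioi_mem_nhds h] with s hs
    exact if_pos hs

theorem contDiffOn_shrink_symm (L r : ℝ) (hL : 0 < L) :
    ContDiffOn ℝ ∞ (shrink L r hL).symm (shrink L r hL).target := by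
  intro t ht
  have ht0 : t ≠ 0 := abs_pos.1 ht.1
  rcases lt_or_gt_of_ne ht0 with h | h
  · refine (ContDiffAt.congr_of_eventuallyEq (f := fun t => t - L) (by fun_prop) ?_).contDiffWithinAt
    filter_upwards [Iio_mem_nhds h] with s hs
    exact if_neg (not_lt.2 (le_of_lt hs))
  · refine (ContDiffAt.congr_of_eventuallyEq (f := fun t => t + L) (by fun_prop) ?_).contDiffWithinAt
    filter_upwards [Ioi_mem_nhds h] with s hs
    exact if_pos hs

instance (D : NeckData (n := n) ε₀ β W M) (L : ℝ) (hL : 0 < L) :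
    IsManifold 𝓘(ℝ, ModelW n) ∞ (D.Stretched L hL) := by
  refine Glue.isManifold (modelIso n) ?_ ?_
  · refine (D.collar.smooth.comp (t := D.collar.toMap.source)
      (((contDiffOn_shrink L (8 * ε₀) hL).contMDiffOn.prodMap
        (contMDiffOn_id (s := Set.univ))).mono (fun p hp => hp.1)) (fun p hp => hp.2))
  · refine ((contDiffOn_shrink_symm L (8 * ε₀) hL).contMDiffOn.prodMap
      (contMDiffOn_id (s := Set.univ))).comp (D.collar.smooth_symm.mono (fun p hp => hp.1)) (fun p hp => hp.2)

/-- The almost-complex structure on the neck `[-L-8ε₀, L+8ε₀] × M`: it is `JNeck` for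
`|t| ≤ L`, and `JBetween` shifted by `± L` outside. -/
def cylJ (D : NeckData (n := n) ε₀ β W M) (L : ℝ) : CylField n M := fun t m =>
  if t < -L then D.JBetween (t + L) m
  else if t ≤ L then D.JNeck t m
  else D.JBetween (t - L) m

/-- The metric `g_L` on the neck: it is `(da ∧ λ + ω)(-, JNeck -)` for `|t| ≤ L`, and
`(θ da ∧ λ + ω + β_* dλ)(-, JBetween -)` shifted by `± L` outside. -/
def cylMetric (D : NeckData (n := n) ε₀ β W M) (L t : ℝ) (m : M)
    (u u' : ℝ × TangentSpace 𝓘(ℝ, ModelM n) m) : ℝ :=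
  thetaL β D.χ L t * daWedge D.lam m u (D.cylJ L t m u') +
    omegaHat D.lam D.om (betaL β L t) m u (D.cylJ L t m u')

/-- The constant `κ₀` bounds the `g_L`-norm of `dλ` on the neck from above, and `κ₀⁻¹` bounds the
form `(ω + β_L dλ)(-, J_L -)` on `ker (da ∧ λ)` from below, for all `L`. -/
structure UniformBound (D : NeckData (n := n) ε₀ β W M) (κ₀ : ℝ) : Prop where
  extD_le : ∀ L > 0, ∀ t ∈ Set.Icc (-L - 8 * ε₀) (L + 8 * ε₀), ∀ (m : M)
    (u u' : ℝ × TangentSpace 𝓘(ℝ, ModelM n) m),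
    |extD D.lam m ![u.2, u'.2]| ≤
      κ₀ * √(D.cylMetric L t m u u) * √(D.cylMetric L t m u' u')
  le_omegaHat : ∀ L > 0, ∀ t ∈ Set.Icc (-L - 8 * ε₀) (L + 8 * ε₀), ∀ (m : M)
    (v : TangentSpace 𝓘(ℝ, ModelM n) m), D.lam m ![v] = 0 →
    κ₀⁻¹ * D.cylMetric L t m (0, v) (0, v) ≤
      omegaHat D.lam D.om (betaL β L t) m (0, v) (D.cylJ L t m (0, v))

/-- The differential of the inclusion `W ∖ M → W_L`, as a map on `T_w W`. -/
def tangentFromW (D : NeckData (n := n) ε₀ β W M) (L : ℝ) (hL : 0 < L) (w : D.openPart) :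
    TangentSpace 𝓘(ℝ, ModelW n) (w : W) →L[ℝ] TangentSpace 𝓘(ℝ, ModelW n) (D.fromW L hL w) :=
  (mfderiv 𝓘(ℝ, ModelW n) 𝓘(ℝ, ModelW n) (D.fromW L hL) w).comp
    (mfderiv 𝓘(ℝ, ModelW n) 𝓘(ℝ, ModelW n) ((↑) : D.openPart → W) w).inverse

/-- The differential of the inclusion of the neck into `W_L`, as a map on `T_p (ℝ × M)`. -/
def tangentFromNeck (D : NeckData (n := n) ε₀ β W M) (L : ℝ) (hL : 0 < L) (p : D.neck L) :
    TangentSpace (𝓘(ℝ, ℝ).prod 𝓘(ℝ, ModelM n)) (p : ℝ × M) →L[ℝ]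
      TangentSpace 𝓘(ℝ, ModelW n) (D.fromNeck L hL p) :=
  (mfderiv (𝓘(ℝ, ℝ).prod 𝓘(ℝ, ModelM n)) 𝓘(ℝ, ModelW n) (D.fromNeck L hL) p).comp
    (mfderiv (𝓘(ℝ, ℝ).prod 𝓘(ℝ, ModelM n)) (𝓘(ℝ, ℝ).prod 𝓘(ℝ, ModelM n))
      ((↑) : D.neck L → ℝ × M) p).inverse

open Classical in
/-- The almost-complex structure on `W_L`: it is the pushforward of `JCore` on the image of
`Core(W)`, and the pushforward of `cylJ` on the rest, which lies in the neck. -/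
def stretchedJ (D : NeckData (n := n) ε₀ β W M) (L : ℝ) (hL : 0 < L) :
    EndoField (ModelW n) (D.Stretched L hL) := fun x =>
  if h : ∃ w : D.openPart, (w : W) ∈ D.core ∧ D.fromW L hL w = x then
    h.choose_spec.2 ▸ ((D.tangentFromW L hL h.choose).comp
      ((D.JCore h.choose).comp (D.tangentFromW L hL h.choose).inverse))
  else if h' : ∃ p : D.neck L, D.fromNeck L hL p = x then
    h'.choose_spec ▸ ((D.tangentFromNeck L hL h'.choose).comp
      (ContinuousLinearMap.comp (D.cylJ L (h'.choose : ℝ × M).1 (h'.choose : ℝ × M).2)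
        (D.tangentFromNeck L hL h'.choose).inverse))
  else 0

end NeckData

end Neck

end NeckStretch

end

universe u v

/-!
Both parts of the theorem rest on the map `collapse L`, which shrinks the middle `[-L, L]` of the
neck to `0`: the data `J̄_L`, `β_L`, `θ_L` and `g_L` on the neck are the pullbacks by `collapse L`
of data on `[-8ε₀, 8ε₀] × M` that do not depend on `L` (`cylJ_eq`, `IsCutoff.betaL_eq`,
`cylMetric_eq`).

A uniform bound therefore exists by compactness of `[-8ε₀, 8ε₀] × M`
(`NeckData.exists_uniformBound`). The metric is positive definite (`NeckData.metric_pos`), so that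
near a given point it bounds `dλ` as soon as the coefficients of `λ`, `ω`, `dλ` and of the
almost-complex structure in a chart are continuous. For `dλ` this needs that the exterior
derivative, which is defined through the preferred chart at each point, can be computed in one
chart for all nearby points (`extD_apply_frame`). On `ker (da ∧ λ)` the form `(ω + β_L dλ)(-, J̄_L
-)` is the metric itself, and the second inequality is trivial.

The squeezing function is `h_L(t) = β_L(t) + η t ρ(t)` with slope `η = κ_*⁻¹ L⁻²` and a plateau
function `ρ` which falls from `1` to `0` for `|t|` between `L + 5ε₀/2` and `L + 21ε₀/8`. There
`β_L` has slope bounded below while `η t` is of order `1 / L`, so `h_L' ≥ η / 2` for large `L`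
(`IsCutoff.exists_le_deriv_squeeze`), where "large" depends only on `ε₀` and `β_*`. Further out
`h_L` is a translation, so that `(t, m) ↦ ι(h_L(t), m)` and the identity of the outer part of `W`
agree where both are defined and together form the diffeomorphism `Φ_L`
(`NeckData.exists_diffeomorph`).

On the neck the pullback of `Ω` by `Φ_L` is `ω + h_L dλ + h_L' da ∧ λ`. On `u = x ∂_a + y X + v`
with `v ∈ ker (da ∧ λ)` the form `ω + β_L dλ + h_L' da ∧ λ` gives `q + h_L' (x² + y²)` for `(u,
J̄_L u)`, where `q = ‖v‖²`. The error `(h_L - β_L) dλ(u, J̄_L u)` consists of a term of size at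
most `|h_L - β_L| κ₀ q` and of mixed terms of size at most `|h_L - β_L| κ₀ |x| √q` and `|h_L -
β_L| κ₀ |y| √q`; there is no term in `x` and `y` alone, because `dλ(X, X) = 0`. The mixed terms
are absorbed if `2 (|h_L - β_L| κ₀)² < h_L'` (`quadratic_pos`, `NeckData.tames_of_close`). Since
`|h_L - β_L| ≤ 2 η L`, the left side is at most `8 κ₀² κ_*⁻² L⁻²`, which is less than `η / 2 =
κ_*⁻¹ L⁻² / 2` because `κ_* = 10¹⁰ κ₀³` (`mixed_lt_slope`).
-/

namespace NeckStretch

/-! ### The squeezing function -/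

/-- The point of `[-8ε₀, 8ε₀]` over which the neck of length parameter `L` looks at `t` like
the unstretched neck: the interval `[-L, L]` is collapsed to `0`. -/
noncomputable def collapse (L t : ℝ) : ℝ := if t < -L then t + L else if t ≤ L then 0 else t - L

theorem collapse_of_abs_le {L t : ℝ} (ht : |t| ≤ L) : collapse L t = 0 := by
  rw [abs_le] at ht
  rw [collapse, if_neg (not_lt.2 ht.1), if_pos ht.2]

theorem abs_collapse {L t : ℝ} (hL : 0 ≤ L) (ht : L ≤ |t|) : |collapse L t| = |t| - L := by
  unfold collapse
  rcases le_total 0 t with h | h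
  · rw [abs_of_nonneg h] at ht ⊢
    rw [if_neg (by linarith)]
    split_ifs with h'
    · rw [abs_zero]; linarith
    · rw [abs_of_pos]; linarith
  · rw [abs_of_nonpos h] at ht ⊢
    split_ifs with h1 h2
    · rw [abs_of_neg] <;> linarith
    · rw [abs_zero]; linarith
    · linarith

theorem collapse_mem_Icc {L r t : ℝ} (hr : 0 ≤ r) (ht : t ∈ Set.Icc (-L - r) (L + r)) :
    collapse L t ∈ Set.Icc (-r) r := by
  obtain ⟨h1, h2⟩ := ht
  unfold collapse
  split_ifs <;> constructor <;> linarith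

variable {ε₀ : ℝ} {β : ℝ → ℝ}

theorem IsCutoff.zero (hβ : IsCutoff ε₀ β) (hε₀ : 0 < ε₀) : β 0 = 0 :=
  hβ.eq_zero 0 (by simp [hε₀.le])

theorem IsCutoff.betaL_eq (hβ : IsCutoff ε₀ β) (hε₀ : 0 < ε₀) (L t : ℝ) :
    betaL β L t = β (collapse L t) := by
  unfold betaL collapse
  split_ifs <;> simp [hβ.zero hε₀]

theorem IsCutoff.deriv_eq_zero (hβ : IsCutoff ε₀ β) {s : ℝ} (hs : |s| < 2 * ε₀) :
    deriv β s = 0 := by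
  have : β =ᶠ[𝓝 s] fun _ => 0 := by
    filter_upwards [(isOpen_lt continuous_abs continuous_const).mem_nhds hs] with t ht
    exact hβ.eq_zero t (le_of_lt ht)
  rw [this.deriv_eq, deriv_const]

theorem IsCutoff.deriv_eq_one (hβ : IsCutoff ε₀ β) {s : ℝ} (hs : 4 * ε₀ < |s|) :
    deriv β s = 1 := by
  have : β =ᶠ[𝓝 s] id := by
    filter_upwards [(isOpen_lt continuous_const continuous_abs).mem_nhds hs] with t ht
    exact hβ.eq_self t (le_of_lt ht)
  rw [this.deriv_eq, deriv_id]

theorem IsCutoff.deriv_pos' (hβ : IsCutoff ε₀ β) {s : ℝ} (hs : 2 * ε₀ < |s|) :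
    0 < deriv β s := by
  rcases le_or_gt |s| (4 * ε₀) with h | h
  · exact hβ.deriv_pos s hs h
  · rw [hβ.deriv_eq_one h]
    exact one_pos

theorem IsCutoff.continuous_deriv (hβ : IsCutoff ε₀ β) : Continuous (deriv β) :=
  hβ.smooth.continuous_deriv (by simp)

theorem IsCutoff.deriv_nonneg (hβ : IsCutoff ε₀ β) (hε₀ : 0 < ε₀) (s : ℝ) :
    0 ≤ deriv β s := by
  have h1 : IsClosed {s | 0 ≤ deriv β s} := isClosed_le continuous_const hβ.continuous_deriv
  rcases lt_trichotomy |s| (2 * ε₀) with h | h | h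
  · rw [hβ.deriv_eq_zero h]
  · -- at `|s| = 2 ε₀` the derivative is a limit of values at points further out
    have h2 : Filter.Tendsto (fun r : ℝ => (1 + r) * s) (𝓝[>] 0) (𝓝 s) := by
      have : Filter.Tendsto (fun r : ℝ => (1 + r) * s) (𝓝 0) (𝓝 ((1 + 0) * s)) := by
        apply Continuous.tendsto
        fun_prop
      rw [add_zero, one_mul] at this
      exact this.mono_left nhdsWithin_le_nhds
    refine h1.mem_of_tendsto h2 ?_
    filter_upwards [self_mem_nhdsWithin] with r hr
    have hr : 0 < r := hr
    refine (hβ.deriv_pos' ?_).le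
    rw [abs_mul, abs_of_pos (by linarith), h]
    nlinarith
  · exact (hβ.deriv_pos' h).le

/-- The derivative of `β_*` is bounded below away from the flat part. -/
theorem IsCutoff.exists_le_deriv (hβ : IsCutoff ε₀ β) (hε₀ : 0 < ε₀) :
    ∃ c, 0 < c ∧ c ≤ 1 ∧ ∀ s, 5 / 2 * ε₀ ≤ |s| → c ≤ deriv β s := by
  have hK : IsCompact (Set.Icc (-(4 * ε₀)) (4 * ε₀) ∩ {s | 5 / 2 * ε₀ ≤ |s|}) :=
    isCompact_Icc.inter_right (isClosed_le continuous_const continuous_abs)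
  have hne : (Set.Icc (-(4 * ε₀)) (4 * ε₀) ∩ {s | 5 / 2 * ε₀ ≤ |s|}).Nonempty := by
    refine ⟨4 * ε₀, ⟨by linarith, le_rfl⟩, ?_⟩
    rw [Set.mem_ofPred_eq, abs_of_pos (by linarith)]
    linarith
  obtain ⟨s₀, hs₀, hmin⟩ := hK.exists_isMinOn hne hβ.continuous_deriv.continuousOn
  have hpos : 0 < deriv β s₀ := hβ.deriv_pos' (lt_of_lt_of_le (by linarith) hs₀.2)
  refine ⟨min (deriv β s₀) 1, lt_min hpos one_pos, min_le_right _ _, fun s hs => ?_⟩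
  rcases le_or_gt |s| (4 * ε₀) with h | h
  · exact (min_le_left _ _).trans (hmin ⟨abs_le.1 h, hs⟩)
  · rw [hβ.deriv_eq_one h]
    exact min_le_right _ _

/-- Near every point `β_L` is a translate of `β_*`: in the middle of the neck, where it vanishes,
one puts `0` over the point itself. -/
theorem IsCutoff.betaL_eventuallyEq (hβ : IsCutoff ε₀ β) (hε₀ : 0 < ε₀) {L : ℝ} (hL : 0 ≤ L)
    (t : ℝ) : ∃ a : ℝ, betaL β L =ᶠ[𝓝 t] (fun s => β (s - a)) ∧
      deriv β (t - a) = deriv β (collapse L t) := by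
  rcases lt_or_ge t (-L) with h | h
  · refine ⟨-L, ?_, by simp [collapse, h]⟩
    filter_upwards [Iio_mem_nhds h] with s hs
    have hs : s < -L := hs
    rw [betaL, if_pos hs, sub_neg_eq_add]
  rcases lt_or_ge L t with h' | h'
  · refine ⟨L, ?_, ?_⟩
    · filter_upwards [Ioi_mem_nhds h'] with s hs
      have hs : L < s := hs
      rw [betaL, if_neg (by linarith), if_neg (by linarith)]
    · rw [collapse, if_neg (by linarith), if_neg (by linarith)]
  · refine ⟨t, ?_, ?_⟩
    · filter_upwards [Ioo_mem_nhds (show t - ε₀ < t by linarith) (show t < t + ε₀ by linarith)]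
        with s hs
      obtain ⟨h1, h2⟩ := hs
      rw [hβ.betaL_eq hε₀, hβ.eq_zero, hβ.eq_zero]
      · rw [abs_le]; constructor <;> linarith
      · unfold collapse
        split_ifs <;> rw [abs_le] <;> constructor <;> linarith
    · rw [collapse_of_abs_le (abs_le.2 ⟨h, h'⟩), sub_self]

theorem IsCutoff.contDiff_betaL (hβ : IsCutoff ε₀ β) (hε₀ : 0 < ε₀) {L : ℝ} (hL : 0 ≤ L) :
    ContDiff ℝ ∞ (betaL β L) := by
  rw [contDiff_iff_contDiffAt]
  intro t
  obtain ⟨a, h, -⟩ := hβ.betaL_eventuallyEq hε₀ hL t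
  exact (hβ.smooth.comp (contDiff_id.sub contDiff_const)).contDiffAt.congr_of_eventuallyEq h

theorem IsCutoff.deriv_betaL (hβ : IsCutoff ε₀ β) (hε₀ : 0 < ε₀) {L : ℝ} (hL : 0 ≤ L) (t : ℝ) :
    deriv (betaL β L) t = deriv β (collapse L t) := by
  obtain ⟨a, h, h'⟩ := hβ.betaL_eventuallyEq hε₀ hL t
  rw [h.deriv_eq, deriv_comp_sub_const, h']

/-- A smooth step that is `1` on `(-∞, 5ε₀/2]` and `0` on `[21ε₀/8, ∞)`. The derivative of `β_*` is
positive from `2ε₀` on, and the step is over before `11ε₀/4`. -/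
noncomputable def step (ε₀ s : ℝ) : ℝ := Real.smoothTransition ((21 / 8 * ε₀ - s) / (ε₀ / 8))

theorem step_eq_one (hε₀ : 0 < ε₀) {s : ℝ} (hs : s ≤ 5 / 2 * ε₀) : step ε₀ s = 1 := by
  apply Real.smoothTransition.one_of_one_le
  rw [le_div_iff₀ (by linarith)]
  linarith

theorem step_eq_zero (hε₀ : 0 < ε₀) {s : ℝ} (hs : 21 / 8 * ε₀ ≤ s) : step ε₀ s = 0 := by
  apply Real.smoothTransition.zero_of_nonpos
  exact div_nonpos_of_nonpos_of_nonneg (by linarith) (by linarith)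

theorem contDiff_step : ContDiff ℝ ∞ (step ε₀) :=
  Real.smoothTransition.contDiff.comp (by fun_prop)

theorem step_mem_Icc (s : ℝ) : step ε₀ s ∈ Set.Icc (0 : ℝ) 1 :=
  ⟨Real.smoothTransition.nonneg _, Real.smoothTransition.le_one _⟩

theorem exists_abs_deriv_step_le (hε₀ : 0 < ε₀) : ∃ R, 0 ≤ R ∧ ∀ s, |deriv (step ε₀) s| ≤ R := by
  have hc : Continuous (deriv (step ε₀)) := contDiff_step.continuous_deriv (by simp)
  obtain ⟨R, hR⟩ :=
    (isCompact_Icc (a := 5 / 2 * ε₀) (b := 21 / 8 * ε₀)).exists_bound_of_continuousOn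
      hc.continuousOn
  have h0 : 0 ≤ R := (norm_nonneg _).trans (hR (5 / 2 * ε₀) ⟨le_rfl, by linarith⟩)
  refine ⟨R, h0, fun s => ?_⟩
  rcases lt_or_ge s (5 / 2 * ε₀) with h | h
  · have : step ε₀ =ᶠ[𝓝 s] fun _ => 1 := by
      filter_upwards [Iio_mem_nhds h] with t ht
      exact step_eq_one hε₀ (le_of_lt ht)
    rw [this.deriv_eq, deriv_const, abs_zero]
    exact h0
  rcases lt_or_ge (21 / 8 * ε₀) s with h' | h'
  · have : step ε₀ =ᶠ[𝓝 s] fun _ => 0 := by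
      filter_upwards [Ioi_mem_nhds h'] with t ht
      exact step_eq_zero hε₀ (le_of_lt ht)
    rw [this.deriv_eq, deriv_const, abs_zero]
    exact h0
  · exact hR s ⟨h, h'⟩

/-- A smooth plateau that is `1` for `|t| ≤ L + 5ε₀/2` and `0` for `|t| ≥ L + 21ε₀/8`. -/
noncomputable def plateau (ε₀ L t : ℝ) : ℝ := step ε₀ (t - L) * step ε₀ (-t - L)

theorem plateau_eq_one (hε₀ : 0 < ε₀) {L t : ℝ} (ht : |t| ≤ L + 5 / 2 * ε₀) :
    plateau ε₀ L t = 1 := by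
  rw [abs_le] at ht
  rw [plateau, step_eq_one hε₀, step_eq_one hε₀, one_mul] <;> linarith

theorem plateau_eq_zero (hε₀ : 0 < ε₀) {L t : ℝ} (ht : L + 21 / 8 * ε₀ ≤ |t|) :
    plateau ε₀ L t = 0 := by
  rw [plateau]
  rcases le_abs.1 ht with h | h
  · rw [step_eq_zero hε₀ (by linarith), zero_mul]
  · rw [step_eq_zero hε₀ (s := -t - L) (by linarith), mul_zero]

theorem contDiff_plateau (L : ℝ) : ContDiff ℝ ∞ (plateau ε₀ L) :=
  (contDiff_step.comp (by fun_prop)).mul (contDiff_step.comp (by fun_prop))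

theorem plateau_mem_Icc (L t : ℝ) : plateau ε₀ L t ∈ Set.Icc (0 : ℝ) 1 := by
  obtain ⟨h1, h2⟩ := step_mem_Icc (ε₀ := ε₀) (t - L)
  obtain ⟨h3, h4⟩ := step_mem_Icc (ε₀ := ε₀) (-t - L)
  exact ⟨mul_nonneg h1 h3, mul_le_one₀ h2 h3 h4⟩

theorem abs_deriv_plateau_le {R : ℝ} (hR0 : 0 ≤ R) (hR : ∀ s, |deriv (step ε₀) s| ≤ R) (L t : ℝ) :
    |deriv (plateau ε₀ L) t| ≤ 2 * R := by
  have hd : ∀ s, HasDerivAt (step ε₀) (deriv (step ε₀) s) s := fun s =>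
    (contDiff_step.differentiable (by simp)).differentiableAt.hasDerivAt
  have h1 : HasDerivAt (fun t : ℝ => t - L) 1 t := (hasDerivAt_id t).sub_const L
  have h2 : HasDerivAt (fun t : ℝ => -t - L) (-1) t := (hasDerivAt_neg t).sub_const L
  have h3 := ((hd _).comp t h1).mul ((hd _).comp t h2)
  have h4 : deriv (plateau ε₀ L) t = _ := h3.deriv
  rw [h4]
  obtain ⟨h5, h6⟩ := step_mem_Icc (ε₀ := ε₀) (t - L)
  obtain ⟨h7, h8⟩ := step_mem_Icc (ε₀ := ε₀) (-t - L)
  have h9 := abs_le.1 (hR (t - L))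
  have h10 := abs_le.1 (hR (-t - L))
  simp only [Function.comp_apply]
  rw [abs_le]
  constructor <;> nlinarith

/-- The squeezing function with slope `η` in the middle of the neck. -/
noncomputable def squeeze (ε₀ : ℝ) (β : ℝ → ℝ) (L η t : ℝ) : ℝ :=
  betaL β L t + η * t * plateau ε₀ L t

theorem IsCutoff.contDiff_squeeze (hβ : IsCutoff ε₀ β) (hε₀ : 0 < ε₀) {L : ℝ} (hL : 0 ≤ L) (η : ℝ) :
    ContDiff ℝ ∞ (squeeze ε₀ β L η) :=
  (hβ.contDiff_betaL hε₀ hL).add ((contDiff_const.mul contDiff_id).mul (contDiff_plateau L))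

theorem squeeze_eq_betaL (hε₀ : 0 < ε₀) {L η t : ℝ} (ht : L + 21 / 8 * ε₀ ≤ |t|) :
    squeeze ε₀ β L η t = betaL β L t := by
  rw [squeeze, plateau_eq_zero hε₀ ht, mul_zero, add_zero]

theorem abs_squeeze_sub_le (hε₀ : 0 < ε₀) {L η t : ℝ} (hL : 3 * ε₀ ≤ L) (hη : 0 ≤ η) :
    |squeeze ε₀ β L η t - betaL β L t| ≤ 2 * (η * L) := by
  rcases le_total (L + 21 / 8 * ε₀) |t| with h | h
  · rw [squeeze_eq_betaL hε₀ h, sub_self, abs_zero]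
    have : 0 ≤ L := by linarith
    positivity
  · obtain ⟨h1, h2⟩ := plateau_mem_Icc (ε₀ := ε₀) L t
    rw [squeeze, add_sub_cancel_left, abs_mul, abs_mul, abs_of_nonneg hη, abs_of_nonneg h1]
    have h3 : |t| ≤ 2 * L := by linarith
    calc η * |t| * plateau ε₀ L t ≤ η * |t| * 1 := by gcongr
      _ ≤ η * (2 * L) * 1 := by gcongr
      _ = 2 * (η * L) := by ring

/-- For long necks the squeezing function has slope at least `η / 2`: in the middle the slope is
`η`, and the interpolation takes place where `β_*` has slope bounded below. -/
theorem IsCutoff.exists_le_deriv_squeeze (hβ : IsCutoff ε₀ β) (hε₀ : 0 < ε₀) :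
    ∃ L₁ : ℝ, 1 ≤ L₁ ∧ 3 * ε₀ ≤ L₁ ∧ ∀ L, L₁ ≤ L → ∀ η, 0 < η → η * L ^ 2 ≤ 1 →
      ∀ t, η / 2 ≤ deriv (squeeze ε₀ β L η) t := by
  obtain ⟨c, hc0, hc1, hc⟩ := hβ.exists_le_deriv hε₀
  obtain ⟨R, hR0, hR⟩ := exists_abs_deriv_step_le hε₀
  -- where the plateau falls, the derivative of the correction `η t ρ(t)` is at least `-4 R / L`,
  -- which together with `η / 2 ≤ 1 / L` has to be compensated by the slope `c` of `β_*`
  refine ⟨max (max 1 (3 * ε₀)) ((4 * R + 1) / c), (le_max_left _ _).trans (le_max_left _ _),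
    (le_max_right _ _).trans (le_max_left _ _), fun L hL η hη0 hη t => ?_⟩
  have hL1 : 1 ≤ L := ((le_max_left _ _).trans (le_max_left _ _)).trans hL
  have hL2 : 3 * ε₀ ≤ L := ((le_max_right _ _).trans (le_max_left _ _)).trans hL
  have hL3 : 4 * R + 1 ≤ c * L := by
    have := (le_max_right _ _).trans hL
    rw [div_le_iff₀ hc0] at this
    linarith
  have hL0 : 0 < L := by linarith
  have hd1 : HasDerivAt (betaL β L) (deriv β (collapse L t)) t := by
    rw [← hβ.deriv_betaL hε₀ hL0.le]
    exact ((hβ.contDiff_betaL hε₀ hL0.le).differentiable (by simp)).differentiableAt.hasDerivAt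
  have hd2 : HasDerivAt (plateau ε₀ L) (deriv (plateau ε₀ L) t) t :=
    ((contDiff_plateau L).differentiable (by simp)).differentiableAt.hasDerivAt
  have hd3 := hd1.add (((hasDerivAt_id t).const_mul η).mul hd2)
  have hd4 : deriv (squeeze ε₀ β L η) t = deriv β (collapse L t) +
      (η * plateau ε₀ L t + η * t * deriv (plateau ε₀ L) t) := by
    have := hd3.deriv
    simp only [mul_one, id_eq] at this
    exact this
  rw [hd4]
  obtain ⟨hp0, hp1⟩ := plateau_mem_Icc (ε₀ := ε₀) L t
  have hηL : η * L ≤ L⁻¹ := by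
    rw [← one_div, le_div_iff₀ hL0]
    nlinarith
  have hη1 : η ≤ L⁻¹ := le_trans (by nlinarith) hηL
  have hcL : (4 * R + 1) * L⁻¹ ≤ c := by
    rw [← div_eq_mul_inv, div_le_iff₀ hL0]
    exact hL3
  rcases lt_or_ge |t| (L + 5 / 2 * ε₀) with h | h
  · have h1 : plateau ε₀ L =ᶠ[𝓝 t] fun _ => 1 := by
      filter_upwards [(isOpen_lt continuous_abs continuous_const).mem_nhds h] with s hs
      exact plateau_eq_one hε₀ (le_of_lt hs)
    rw [h1.deriv_eq, deriv_const, h1.eq_of_nhds]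
    have := hβ.deriv_nonneg hε₀ (collapse L t)
    linarith
  · have h1 : c ≤ deriv β (collapse L t) := by
      apply hc
      rw [abs_collapse (by linarith) (by linarith)]
      linarith
    rcases le_or_gt |t| (L + 3 * ε₀) with h2 | h2
    · have h3 : |η * t * deriv (plateau ε₀ L) t| ≤ η * (2 * L) * (2 * R) := by
        rw [abs_mul, abs_mul, abs_of_pos hη0]
        have := abs_deriv_plateau_le hR0 hR L t
        gcongr
        linarith
      have h4 := (abs_le.1 h3).1
      have h5 : η * (2 * L) * (2 * R) ≤ 4 * R * L⁻¹ := by nlinarith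
      have h6 : 0 ≤ η * plateau ε₀ L t := by positivity
      nlinarith
    · have h3 : plateau ε₀ L =ᶠ[𝓝 t] fun _ => 0 := by
        filter_upwards [(isOpen_lt continuous_const continuous_abs).mem_nhds h2] with s hs
        have hs : L + 3 * ε₀ < |s| := hs
        exact plateau_eq_zero hε₀ (by linarith)
      rw [h3.deriv_eq, deriv_const, h3.eq_of_nhds]
      have : 0 ≤ R * L⁻¹ := by positivity
      nlinarith

theorem IsCutoff.squeeze_end (hβ : IsCutoff ε₀ β) (hε₀ : 0 < ε₀) {L η t : ℝ} (hL : 0 ≤ L)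
    (ht : L + 4 * ε₀ ≤ |t|) : squeeze ε₀ β L η t = collapse L t := by
  rw [squeeze_eq_betaL hε₀ (by linarith), hβ.betaL_eq hε₀, hβ.eq_self]
  rw [abs_collapse (by linarith) (by linarith)]
  linarith

/-- The squeezing function is a diffeomorphism of the line: it has positive derivative and is a
translation far out on either side. -/
theorem IsCutoff.exists_homeomorph_squeeze (hβ : IsCutoff ε₀ β) (hε₀ : 0 < ε₀) {L η : ℝ}
    (hL : 0 < L) (h : ∀ t, 0 < deriv (squeeze ε₀ β L η) t) :
    ∃ e : ℝ ≃ₜ ℝ, (∀ t, e t = squeeze ε₀ β L η t) ∧ StrictMono e ∧ ContDiff ℝ ∞ e ∧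
      ContDiff ℝ ∞ e.symm := by
  have hsm := hβ.contDiff_squeeze hε₀ hL.le η
  have hmono : StrictMono (squeeze ε₀ β L η) := strictMono_of_deriv_pos h
  have hsurj : Function.Surjective (squeeze ε₀ β L η) := by
    apply hsm.continuous.surjective
    · refine (Filter.tendsto_atTop_add_const_right _ (-L) Filter.tendsto_id).congr' ?_
      filter_upwards [Filter.eventually_ge_atTop (L + 4 * ε₀)] with t ht
      rw [hβ.squeeze_end hε₀ hL.le (ht.trans (le_abs_self t)), collapse, if_neg (by linarith),
        if_neg (by linarith)]
      rfl
    · refine (Filter.tendsto_atBot_add_const_right _ L Filter.tendsto_id).congr' ?_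
      filter_upwards [Filter.eventually_le_atBot (-(L + 4 * ε₀))] with t ht
      rw [hβ.squeeze_end hε₀ hL.le (le_trans (by linarith) (neg_le_abs t)), collapse,
        if_pos (by linarith)]
      rfl
  let e := (hmono.orderIsoOfSurjective _ hsurj).toHomeomorph
  have he : ∀ t, e t = squeeze ε₀ β L η t := fun t => rfl
  refine ⟨e, he, hmono, hsm, ?_⟩
  exact e.contDiff_symm_deriv (fun t => (h t).ne')
    (fun t => (hsm.differentiable (by simp)).differentiableAt.hasDerivAt) hsm

/-! ### The smooth structure of the stretched manifold -/

namespace NeckData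

variable {n : ℕ} {ε₀ : ℝ} {β : ℝ → ℝ} {W : Type u} {M : Type v} [TopologicalSpace W]
  [ChartedSpace (ModelW n) W] [IsManifold 𝓘(ℝ, ModelW n) ∞ W] [TopologicalSpace M]
  [ChartedSpace (ModelM n) M] [IsManifold 𝓘(ℝ, ModelM n) ∞ M]

/-- The partial homeomorphism from `W_L` to `W` that is inverse to `fromW`. It does not depend on
the point `u`, which only shows that its source is nonempty. -/
noncomputable def toW (D : NeckData (n := n) ε₀ β W M) (L : ℝ) (hL : 0 < L) (u : D.openPart) :
    OpenPartialHomeomorph (D.Stretched L hL) W :=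
  Glue.projLeft (D.gluingMap L hL) (D.neck L) u

/-- The partial homeomorphism from `W_L` to `ℝ × M` that is inverse to `fromNeck`. It does not
depend on the point `v`, which only shows that its source is nonempty. -/
noncomputable def toNeck (D : NeckData (n := n) ε₀ β W M) (L : ℝ) (hL : 0 < L) (v : D.neck L) :
    OpenPartialHomeomorph (D.Stretched L hL) (ℝ × M) :=
  Glue.projRight (D.gluingMap L hL) D.openPart v

variable (D : NeckData (n := n) ε₀ β W M) {L : ℝ} (hL : 0 < L)

theorem toW_source (u : D.openPart) : (D.toW L hL u).source = Set.range (D.fromW L hL) :=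
  Glue.projLeft_source u

theorem toW_target (u : D.openPart) : (D.toW L hL u).target = D.openPart := Glue.projLeft_target u

theorem toW_fromW (u u' : D.openPart) : D.toW L hL u (D.fromW L hL u') = u' :=
  Glue.projLeft_inl u u'

theorem toNeck_source (v : D.neck L) :
    (D.toNeck L hL v).source = Set.range (D.fromNeck L hL) := Glue.projRight_source v

theorem toNeck_target (v : D.neck L) : (D.toNeck L hL v).target = D.neck L :=
  Glue.projRight_target v

theorem toNeck_fromNeck (v v' : D.neck L) : D.toNeck L hL v (D.fromNeck L hL v') = v' :=
  Glue.projRight_inr v v'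

theorem toW_symm (u u' : D.openPart) : (D.toW L hL u).symm u' = D.fromW L hL u' :=
  Glue.projLeft_symm u u'

theorem toNeck_symm (v v' : D.neck L) : (D.toNeck L hL v).symm v' = D.fromNeck L hL v' :=
  Glue.projRight_symm v v'

theorem chartLeft_mem_maximalAtlas (u : D.openPart) :
    (D.toW L hL u).trans (chartAt (ModelW n) (u : W)) ∈
      IsManifold.maximalAtlas 𝓘(ℝ, ModelW n) ∞ (D.Stretched L hL) :=
  IsManifold.subset_maximalAtlas (Or.inl ⟨u, rfl⟩)

theorem chartRight_mem_maximalAtlas (v : D.neck L) :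
    (D.toNeck L hL v).trans ((chartAt (ModelProd ℝ (ModelM n)) (v : ℝ × M)).trans
      (modelIso n).toHomeomorph.toOpenPartialHomeomorph) ∈
      IsManifold.maximalAtlas 𝓘(ℝ, ModelW n) ∞ (D.Stretched L hL) :=
  IsManifold.subset_maximalAtlas (Or.inr ⟨v, rfl⟩)

/-- The charts of `W_L` over `W ∖ M` are those of `W`, so that `toW` is smooth. -/
theorem contMDiffOn_toW (u : D.openPart) :
    ContMDiffOn 𝓘(ℝ, ModelW n) 𝓘(ℝ, ModelW n) ∞ (D.toW L hL u) (D.toW L hL u).source := by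
  rw [toW_source]
  rintro _ ⟨u', rfl⟩
  have h1 := contMDiffOn_of_mem_maximalAtlas (D.chartLeft_mem_maximalAtlas hL u')
  have h2 := contMDiffOn_chart_symm (I := 𝓘(ℝ, ModelW n)) (n := ∞) (x := (u' : W))
  have hmem : D.fromW L hL u' ∈
      ((D.toW L hL u').trans (chartAt (ModelW n) (u' : W))).source := by
    rw [OpenPartialHomeomorph.trans_source, toW_source]
    refine ⟨⟨u', rfl⟩, ?_⟩
    rw [Set.mem_preimage, toW_fromW]
    exact mem_chart_source _ _
  have h3 : ContMDiffOn 𝓘(ℝ, ModelW n) 𝓘(ℝ, ModelW n) ∞ (D.toW L hL u)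
      ((D.toW L hL u').trans (chartAt (ModelW n) (u' : W))).source := by
    refine (h2.comp h1 ?_).congr ?_
    · intro x hx
      exact OpenPartialHomeomorph.map_source _ hx.2
    · intro x hx
      have hx1 : x ∈ (D.toW L hL u').source := hx.1
      rw [toW_source] at hx1
      obtain ⟨w, rfl⟩ := hx1
      have hx2 : D.toW L hL u' (D.fromW L hL w) ∈ (chartAt (ModelW n) (u' : W)).source := hx.2
      change D.toW L hL u (D.fromW L hL w) = (chartAt (ModelW n) (u' : W)).symm
        (chartAt (ModelW n) (u' : W) (D.toW L hL u' (D.fromW L hL w)))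
      rw [toW_fromW] at hx2 ⊢
      rw [toW_fromW, OpenPartialHomeomorph.left_inv _ hx2]
  exact (h3.contMDiffAt (OpenPartialHomeomorph.open_source _ |>.mem_nhds hmem)).contMDiffWithinAt

theorem contMDiffOn_toW_symm (u : D.openPart) :
    ContMDiffOn 𝓘(ℝ, ModelW n) 𝓘(ℝ, ModelW n) ∞ (D.toW L hL u).symm (D.toW L hL u).target := by
  rw [toW_target]
  intro w hw
  lift w to D.openPart using hw
  have h1 := contMDiffOn_symm_of_mem_maximalAtlas (D.chartLeft_mem_maximalAtlas hL w)
  have h2 := contMDiffOn_chart (I := 𝓘(ℝ, ModelW n)) (n := ∞) (x := (w : W))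
  have h3 : ContMDiffOn 𝓘(ℝ, ModelW n) 𝓘(ℝ, ModelW n) ∞ (D.toW L hL u).symm
      ((chartAt (ModelW n) (w : W)).source ∩ D.openPart) := by
    refine (h1.comp (h2.mono Set.inter_subset_left) ?_).congr ?_
    · intro x hx
      rw [Set.mem_preimage, OpenPartialHomeomorph.trans_target]
      refine ⟨(chartAt (ModelW n) (w : W)).map_source hx.1, ?_⟩
      rw [Set.mem_preimage, (chartAt (ModelW n) (w : W)).left_inv hx.1, toW_target]
      exact hx.2
    · intro x hx
      simp only [Function.comp_apply, OpenPartialHomeomorph.coe_trans_symm,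
        (chartAt (ModelW n) (w : W)).left_inv hx.1]
      rw [D.toW_symm hL w ⟨x, hx.2⟩, D.toW_symm hL u ⟨x, hx.2⟩]
  exact (h3.contMDiffAt (((chartAt (ModelW n) (w : W)).open_source.inter D.openPart.2).mem_nhds
    ⟨mem_chart_source _ _, w.2⟩)).contMDiffWithinAt

/-- The charts of `W_L` over the neck are those of `ℝ × M` up to a linear isomorphism of the model
spaces, so that `toNeck` is smooth. -/
theorem contMDiffOn_toNeck (v : D.neck L) :
    ContMDiffOn 𝓘(ℝ, ModelW n) (𝓘(ℝ, ℝ).prod 𝓘(ℝ, ModelM n)) ∞ (D.toNeck L hL v)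
      (D.toNeck L hL v).source := by
  rw [toNeck_source]
  rintro _ ⟨u', rfl⟩
  set c := (chartAt (ModelProd ℝ (ModelM n)) (u' : ℝ × M)).trans
      (modelIso n).toHomeomorph.toOpenPartialHomeomorph with hc
  have h1 := contMDiffOn_of_mem_maximalAtlas (D.chartRight_mem_maximalAtlas hL u')
  have h2 := Glue.contMDiffOn_chartRight_symm_aux (modelIso n) (u' : ℝ × M)
  rw [← hc] at h1 h2
  have hcs : (u' : ℝ × M) ∈ c.source := by
    rw [hc, OpenPartialHomeomorph.trans_source]
    exact ⟨mem_chart_source _ _, trivial⟩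
  have hmem : D.fromNeck L hL u' ∈ ((D.toNeck L hL u').trans c).source := by
    rw [OpenPartialHomeomorph.trans_source, toNeck_source]
    refine ⟨⟨u', rfl⟩, ?_⟩
    rwa [Set.mem_preimage, toNeck_fromNeck]
  have h3 : ContMDiffOn 𝓘(ℝ, ModelW n) (𝓘(ℝ, ℝ).prod 𝓘(ℝ, ModelM n)) ∞ (D.toNeck L hL v)
      ((D.toNeck L hL u').trans c).source := by
    refine (h2.comp h1 ?_).congr ?_
    · intro x hx
      exact c.map_source hx.2
    · intro x hx
      have hx1 : x ∈ (D.toNeck L hL u').source := hx.1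
      rw [toNeck_source] at hx1
      obtain ⟨w, rfl⟩ := hx1
      have hx2 : D.toNeck L hL u' (D.fromNeck L hL w) ∈ c.source := hx.2
      change D.toNeck L hL v (D.fromNeck L hL w) =
        c.symm (c (D.toNeck L hL u' (D.fromNeck L hL w)))
      rw [toNeck_fromNeck] at hx2 ⊢
      rw [toNeck_fromNeck, OpenPartialHomeomorph.left_inv _ hx2]
  exact (h3.contMDiffAt (OpenPartialHomeomorph.open_source _ |>.mem_nhds hmem)).contMDiffWithinAt

theorem contMDiffOn_toNeck_symm (v : D.neck L) :
    ContMDiffOn (𝓘(ℝ, ℝ).prod 𝓘(ℝ, ModelM n)) 𝓘(ℝ, ModelW n) ∞ (D.toNeck L hL v).symm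
      (D.toNeck L hL v).target := by
  rw [toNeck_target]
  intro w hw
  lift w to D.neck L using hw
  set c := (chartAt (ModelProd ℝ (ModelM n)) (w : ℝ × M)).trans
      (modelIso n).toHomeomorph.toOpenPartialHomeomorph with hc
  have h1 := contMDiffOn_symm_of_mem_maximalAtlas (D.chartRight_mem_maximalAtlas hL w)
  have h2 := Glue.contMDiffOn_chartRight_aux (modelIso n) (w : ℝ × M)
  have hcs : c.source = (chartAt (ModelProd ℝ (ModelM n)) (w : ℝ × M)).source := by
    rw [hc, OpenPartialHomeomorph.trans_source]
    exact Set.inter_univ _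
  rw [← hc] at h1 h2
  rw [← hcs] at h2
  have h3 : ContMDiffOn (𝓘(ℝ, ℝ).prod 𝓘(ℝ, ModelM n)) 𝓘(ℝ, ModelW n) ∞ (D.toNeck L hL v).symm
      (c.source ∩ D.neck L) := by
    refine (h1.comp (h2.mono Set.inter_subset_left) ?_).congr ?_
    · intro x hx
      rw [Set.mem_preimage, OpenPartialHomeomorph.trans_target]
      refine ⟨c.map_source hx.1, ?_⟩
      rw [Set.mem_preimage, c.left_inv hx.1, toNeck_target]
      exact hx.2
    · intro x hx
      simp only [Function.comp_apply, OpenPartialHomeomorph.coe_trans_symm (D.toNeck L hL w),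
        c.left_inv hx.1]
      rw [D.toNeck_symm hL w ⟨x, hx.2⟩, D.toNeck_symm hL v ⟨x, hx.2⟩]
  refine (h3.contMDiffAt ((c.open_source.inter (D.neck L).2).mem_nhds
    ⟨?_, w.2⟩)).contMDiffWithinAt
  rw [hcs]
  exact mem_chart_source _ _

theorem contMDiff_fromW :
    ContMDiff 𝓘(ℝ, ModelW n) 𝓘(ℝ, ModelW n) ∞ (D.fromW L hL) := by
  intro u
  have h := (D.contMDiffOn_toW_symm hL u).comp (contMDiff_subtype_val (n := ∞)).contMDiffOn
    (s := Set.univ) (fun x _ => by rw [toW_target]; exact x.2)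
  refine (h.contMDiffAt Filter.univ_mem).congr_of_eventuallyEq (.of_forall fun x => ?_)
  exact (D.toW_symm hL u x).symm

theorem contMDiff_fromNeck :
    ContMDiff (𝓘(ℝ, ℝ).prod 𝓘(ℝ, ModelM n)) 𝓘(ℝ, ModelW n) ∞ (D.fromNeck L hL) := by
  intro u
  have h := (D.contMDiffOn_toNeck_symm hL u).comp (contMDiff_subtype_val (n := ∞)).contMDiffOn
    (s := Set.univ) (fun x _ => by rw [toNeck_target]; exact x.2)
  refine (h.contMDiffAt Filter.univ_mem).congr_of_eventuallyEq (.of_forall fun x => ?_)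
  exact (D.toNeck_symm hL u x).symm

end NeckData

/-! ### The diffeomorphism from the stretched manifold -/

/-- An increasing diffeomorphism `e` of the line which is `collapse L` for `|t| ≥ L + 4ε₀`, that
is, a translation by `L` on either end of the neck. -/
structure IsNeckDiffeo (ε₀ L : ℝ) (e : ℝ ≃ₜ ℝ) : Prop where
  strictMono : StrictMono e
  contDiff : ContDiff ℝ ∞ e
  contDiff_symm : ContDiff ℝ ∞ e.symm
  eq_collapse : ∀ t, L + 4 * ε₀ ≤ |t| → e t = collapse L t

theorem IsNeckDiffeo.abs_lt_iff {ε₀ L : ℝ} {e : ℝ ≃ₜ ℝ} (he : IsNeckDiffeo ε₀ L e) (hL : 0 < L)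
    (hε₀ : 0 < ε₀) {r : ℝ} (hr : 4 * ε₀ ≤ r) (t : ℝ) : |e t| < r ↔ |t| < L + r := by
  have h1 : e (L + r) = r := by
    rw [he.eq_collapse _ (by rw [abs_of_pos] <;> linarith), collapse, if_neg (by linarith),
      if_neg (by linarith)]
    ring
  have h2 : e (-(L + r)) = -r := by
    rw [he.eq_collapse _ (by rw [abs_neg, abs_of_pos] <;> linarith), collapse,
      if_pos (by linarith)]
    ring
  rw [abs_lt, abs_lt]
  nth_rewrite 1 [← h2]
  nth_rewrite 2 [← h1]
  rw [he.strictMono.lt_iff_lt, he.strictMono.lt_iff_lt]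

theorem collapse_shrink_symm {L r : ℝ} (hL : 0 < L) {a : ℝ} (ha : a ≠ 0) :
    L < |(shrink L r hL).symm a| ∧ |(shrink L r hL).symm a| = L + |a| ∧
      collapse L ((shrink L r hL).symm a) = a := by
  have h1 : (shrink L r hL).symm a = if 0 < a then a + L else a - L := rfl
  rw [h1]
  rcases lt_or_gt_of_ne ha with h | h
  · rw [if_neg (by linarith), abs_of_neg (by linarith), abs_of_neg h, collapse,
      if_pos (by linarith)]
    refine ⟨by linarith, by ring, by ring⟩
  · rw [if_pos h, abs_of_pos (by linarith), abs_of_pos h, collapse,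
      if_neg (by linarith), if_neg (by linarith)]
    refine ⟨by linarith, by ring, by ring⟩

theorem shrink_eq_collapse {L r : ℝ} (hL : 0 < L) {t : ℝ} (ht : L < |t|) :
    shrink L r hL t = collapse L t := by
  have h1 : shrink L r hL t = if 0 < t then t - L else t + L := rfl
  rw [h1, collapse]
  rcases lt_abs.1 ht with h | h
  · rw [if_pos (by linarith), if_neg (by linarith), if_neg (by linarith)]
  · rw [if_neg (by linarith), if_pos (by linarith)]

/-- A bijective map that is smooth with smooth inverse near every point is a diffeomorphism. -/
theorem exists_diffeomorph_of_bijective {E H E' H' N N' : Type*} [NormedAddCommGroup E]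
    [NormedSpace ℝ E] [TopologicalSpace H] [NormedAddCommGroup E'] [NormedSpace ℝ E']
    [TopologicalSpace H'] {I : ModelWithCorners ℝ E H} {I' : ModelWithCorners ℝ E' H'}
    [TopologicalSpace N] [ChartedSpace H N] [TopologicalSpace N'] [ChartedSpace H' N']
    {f : N → N'} (hf : Function.Bijective f)
    (hloc : ∀ x, ∃ c : OpenPartialHomeomorph N N', x ∈ c.source ∧ Set.EqOn f c c.source ∧
      ContMDiffOn I I' ∞ c c.source ∧ ContMDiffOn I' I ∞ c.symm c.target) :
    ∃ Φ : Diffeomorph I I' N N' ∞, ∀ x, Φ x = f x := by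
  refine ⟨{ Equiv.ofBijective f hf with
    contMDiff_toFun := fun x => ?_
    contMDiff_invFun := fun y => ?_ }, fun x => rfl⟩
  · obtain ⟨c, hx, hc, h1, -⟩ := hloc x
    exact (h1.congr hc).contMDiffAt (c.open_source.mem_nhds hx)
  · obtain ⟨x, rfl⟩ := hf.2 y
    obtain ⟨c, hx, hc, -, h2⟩ := hloc x
    refine (h2.congr (fun z hz => ?_)).contMDiffAt (c.open_target.mem_nhds ?_)
    · change (Equiv.ofBijective f hf).symm z = c.symm z
      rw [Equiv.symm_apply_eq, Equiv.ofBijective_apply, hc (c.map_target hz), c.right_inv hz]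
    · rw [hc hx]
      exact c.map_source hx

namespace NeckData

variable {n : ℕ} {ε₀ : ℝ} {β : ℝ → ℝ} {W : Type u} {M : Type v} [TopologicalSpace W]
  [ChartedSpace (ModelW n) W] [IsManifold 𝓘(ℝ, ModelW n) ∞ W] [TopologicalSpace M]
  [ChartedSpace (ModelM n) M] [IsManifold 𝓘(ℝ, ModelM n) ∞ M]

variable (D : NeckData (n := n) ε₀ β W M) {L : ℝ} (hL : 0 < L)

theorem mem_collar_source {t : ℝ} (ht : |t| ≤ 8 * ε₀) (m : M) :
    (t, m) ∈ D.collar.toMap.source := by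
  rw [D.collar.source_eq]
  have h1 := D.lt_collar
  rw [abs_le] at ht
  exact ⟨⟨by linarith, by linarith⟩, trivial⟩

theorem collar_injOn {t t' : ℝ} (ht : |t| ≤ 8 * ε₀) (ht' : |t'| ≤ 8 * ε₀) {m m' : M}
    (h : D.collar.toMap (t, m) = D.collar.toMap (t', m')) : t = t' ∧ m = m' := by
  have := D.collar.toMap.injOn (D.mem_collar_source ht m) (D.mem_collar_source ht' m') h
  exact Prod.mk.inj this

theorem fromNeck_injective : Function.Injective (D.fromNeck L hL) :=
  fun _ _ h => Glue.inr_eq_inr.1 h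

theorem fromW_injective : Function.Injective (D.fromW L hL) :=
  fun _ _ h => Glue.inl_eq_inl.1 h

/-- The points of `W ∖ M` and of the neck which are identified in `W_L`. -/
theorem fromW_eq_fromNeck_iff {u : D.openPart} {p : D.neck L} :
    D.fromW L hL u = D.fromNeck L hL p ↔
      L < |(p : ℝ × M).1| ∧ D.collar.toMap (collapse L (p : ℝ × M).1, (p : ℝ × M).2) = u := by
  have hp : |(p : ℝ × M).1| < L + 8 * ε₀ := p.2
  have key : L < |(p : ℝ × M).1| → D.gluingMap L hL p =
      D.collar.toMap (collapse L (p : ℝ × M).1, (p : ℝ × M).2) := by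
    intro h
    rw [← shrink_eq_collapse (r := 8 * ε₀) hL h]
    rfl
  refine Glue.inl_eq_inr.trans ⟨?_, ?_⟩
  · rintro ⟨h1, h2⟩
    have h3 : L < |(p : ℝ × M).1| := h1.1.1.1
    exact ⟨h3, by rw [← h2, key h3]⟩
  · rintro ⟨h1, h2⟩
    refine ⟨⟨⟨⟨h1, hp⟩, trivial⟩, ?_⟩, by rw [key h1, h2]⟩
    change (shrink L (8 * ε₀) hL (p : ℝ × M).1, (p : ℝ × M).2) ∈ D.collar.toMap.source
    apply D.mem_collar_source
    rw [shrink_eq_collapse hL h1, abs_collapse hL.le h1.le]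
    linarith

/-- The complement of `ι([-4ε₀, 4ε₀] × M)`. It is an open set which contains `Core(W)` and on which
`squeezeMap` is the identity. -/
def outer : Set W := (D.collar.toMap '' (Set.Icc (-(4 * ε₀)) (4 * ε₀) ×ˢ Set.univ))ᶜ

theorem isOpen_outer [T2Space W] [CompactSpace M] (hε₀ : 0 < ε₀) : IsOpen D.outer := by
  refine (IsCompact.isClosed ?_).isOpen_compl
  refine (isCompact_Icc.prod isCompact_univ).image_of_continuousOn
    (D.collar.smooth.continuousOn.mono ?_)
  rintro ⟨t, m⟩ ⟨ht, -⟩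
  exact D.mem_collar_source ((abs_le.2 ht).trans (by linarith)) m

theorem core_subset_outer (hε₀ : 0 < ε₀) : D.core ⊆ D.outer := by
  refine Set.compl_subset_compl.2 (Set.image_mono ?_)
  rintro ⟨t, m⟩ ⟨⟨h1, h2⟩, -⟩
  exact ⟨⟨by linarith, by linarith⟩, trivial⟩

theorem mem_outer_iff {t : ℝ} (ht : |t| ≤ 8 * ε₀) (hε₀ : 0 < ε₀) (m : M) :
    D.collar.toMap (t, m) ∈ D.outer ↔ 4 * ε₀ < |t| := by
  rw [outer, Set.mem_compl_iff, ← not_iff_not, not_not, not_lt]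
  constructor
  · rintro ⟨⟨t', m'⟩, ⟨h1, -⟩, h2⟩
    have h1 : |t'| ≤ 4 * ε₀ := abs_le.2 h1
    obtain ⟨rfl, -⟩ := D.collar_injOn (h1.trans (by linarith)) ht h2
    exact h1
  · intro h
    exact ⟨(t, m), ⟨abs_le.1 h, trivial⟩, rfl⟩

/-- A point of `W ∖ M` in the collar, seen as a point of the neck. -/
theorem exists_fromNeck_eq {t : ℝ} (ht : |t| < 8 * ε₀) (m : M) (u : D.openPart)
    (hu : D.collar.toMap (t, m) = u) : ∃ p, D.fromNeck L hL p = D.fromW L hL u := by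
  have ht0 : t ≠ 0 := by
    rintro rfl
    have h1 : D.collar.toMap (0, m) ∈ D.H ⁻¹' {0} := by
      rw [← D.range_incl, D.collar.zero]
      exact ⟨m, rfl⟩
    rw [hu] at h1
    exact u.2 h1
  obtain ⟨h1, h2, h3⟩ := collapse_shrink_symm (r := 8 * ε₀) hL ht0
  refine ⟨⟨((shrink L (8 * ε₀) hL).symm t, m), ?_⟩, ?_⟩
  · change |(shrink L (8 * ε₀) hL).symm t| < _
    rw [h2]
    linarith
  · rw [eq_comm, fromW_eq_fromNeck_iff]
    refine ⟨h1, ?_⟩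
    simp only [h3, hu]

theorem exists_rep (x : D.Stretched L hL) :
    (∃ u, D.fromW L hL u = x) ∨ ∃ p, D.fromNeck L hL p = x := Glue.exists_rep x

open Classical in
/-- The map `W_L → W` that is `(t, m) ↦ ι(e(t), m)` on the neck and the identity on the rest. -/
noncomputable def squeezeMap (e : ℝ ≃ₜ ℝ) (x : D.Stretched L hL) : W :=
  if h : ∃ p, D.fromNeck L hL p = x then
    D.collar.toMap (e (h.choose : ℝ × M).1, (h.choose : ℝ × M).2)
  else (((D.exists_rep hL x).resolve_right h).choose : D.openPart)

theorem squeezeMap_fromNeck (e : ℝ ≃ₜ ℝ) (p : D.neck L) :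
    D.squeezeMap hL e (D.fromNeck L hL p) =
      D.collar.toMap (e (p : ℝ × M).1, (p : ℝ × M).2) := by
  have h : ∃ q, D.fromNeck L hL q = D.fromNeck L hL p := ⟨p, rfl⟩
  rw [squeezeMap, dif_pos h, D.fromNeck_injective hL h.choose_spec]

theorem squeezeMap_fromW_of_not_exists (e : ℝ ≃ₜ ℝ) (u : D.openPart)
    (h : ¬ ∃ p, D.fromNeck L hL p = D.fromW L hL u) :
    D.squeezeMap hL e (D.fromW L hL u) = u := by
  rw [squeezeMap, dif_neg h]
  exact congrArg _ (D.fromW_injective hL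
    ((D.exists_rep hL (D.fromW L hL u)).resolve_right h).choose_spec)

theorem squeezeMap_fromW {e : ℝ ≃ₜ ℝ} (he : IsNeckDiffeo ε₀ L e) (hε₀ : 0 < ε₀)
    (u : D.openPart) (hu : (u : W) ∈ D.outer) :
    D.squeezeMap hL e (D.fromW L hL u) = u := by
  by_cases h : ∃ p, D.fromNeck L hL p = D.fromW L hL u
  · obtain ⟨p, hp⟩ := h
    rw [← hp, squeezeMap_fromNeck]
    obtain ⟨h1, h2⟩ := (D.fromW_eq_fromNeck_iff hL).1 hp.symm
    have hp : |(p : ℝ × M).1| < L + 8 * ε₀ := p.2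
    have h3 := abs_collapse hL.le h1.le
    rw [← h2, D.mem_outer_iff (by linarith) hε₀] at hu
    rw [he.eq_collapse _ (by linarith), h2]
  · exact D.squeezeMap_fromW_of_not_exists hL e u h

theorem squeezeMap_bijective {e : ℝ ≃ₜ ℝ} (he : IsNeckDiffeo ε₀ L e) (hε₀ : 0 < ε₀) :
    Function.Bijective (D.squeezeMap hL e) := by
  have hlt : ∀ p : D.neck L, |e (p : ℝ × M).1| < 8 * ε₀ := fun p =>
    (he.abs_lt_iff hL hε₀ (by linarith) _).2 p.2
  have hmix : ∀ (p : D.neck L) (u : D.openPart), ¬ (∃ q, D.fromNeck L hL q = D.fromW L hL u) →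
      D.squeezeMap hL e (D.fromNeck L hL p) ≠ D.squeezeMap hL e (D.fromW L hL u) := by
    intro p u hu h
    rw [squeezeMap_fromNeck, D.squeezeMap_fromW_of_not_exists hL e u hu] at h
    exact hu (D.exists_fromNeck_eq hL (hlt p) _ u h)
  constructor
  · intro x y hxy
    by_cases hx : ∃ p, D.fromNeck L hL p = x <;> by_cases hy : ∃ p, D.fromNeck L hL p = y
    · obtain ⟨p, rfl⟩ := hx
      obtain ⟨q, rfl⟩ := hy
      rw [squeezeMap_fromNeck, squeezeMap_fromNeck] at hxy
      obtain ⟨h1, h2⟩ := D.collar_injOn (hlt p).le (hlt q).le hxy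
      exact congrArg _ (Subtype.ext (Prod.ext (e.injective h1) h2))
    · obtain ⟨p, rfl⟩ := hx
      obtain ⟨u, rfl⟩ := (D.exists_rep hL y).resolve_right hy
      exact absurd hxy (hmix p u hy)
    · obtain ⟨p, rfl⟩ := hy
      obtain ⟨u, rfl⟩ := (D.exists_rep hL x).resolve_right hx
      exact absurd hxy.symm (hmix p u hx)
    · obtain ⟨u, rfl⟩ := (D.exists_rep hL x).resolve_right hx
      obtain ⟨u', rfl⟩ := (D.exists_rep hL y).resolve_right hy
      rw [D.squeezeMap_fromW_of_not_exists hL e u hx,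
        D.squeezeMap_fromW_of_not_exists hL e u' hy] at hxy
      exact congrArg _ (Subtype.ext hxy)
  · intro w
    by_cases hw : ∃ t m, |t| < 8 * ε₀ ∧ D.collar.toMap (t, m) = w
    · obtain ⟨t, m, ht, rfl⟩ := hw
      refine ⟨D.fromNeck L hL ⟨(e.symm t, m), ?_⟩, ?_⟩
      · change |e.symm t| < _
        rwa [← he.abs_lt_iff hL hε₀ (by linarith), e.apply_symm_apply]
      · rw [squeezeMap_fromNeck]
        simp
    · have h0 : D.H w ≠ 0 := by
        intro h
        have h1 : w ∈ D.H ⁻¹' {0} := h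
        rw [← D.range_incl] at h1
        obtain ⟨m, rfl⟩ := h1
        exact hw ⟨0, m, by rw [abs_zero]; linarith, D.collar.zero m⟩
      refine ⟨D.fromW L hL ⟨w, h0⟩, D.squeezeMap_fromW hL he hε₀ _ ?_⟩
      rintro ⟨⟨t, m⟩, ⟨ht, -⟩, h⟩
      exact hw ⟨t, m, (abs_le.2 ht).trans_lt (by linarith), h⟩

/-- The map `squeezeMap` is a diffeomorphism. Near a point of the neck it is the composition of
`toNeck`, of `e` and of `ι`, and near every other point it is `toW`. -/
theorem exists_diffeomorph [T2Space W] [CompactSpace M] {e : ℝ ≃ₜ ℝ} (he : IsNeckDiffeo ε₀ L e)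
    (hε₀ : 0 < ε₀) :
    ∃ Φ : D.Stretched L hL ≃ₘ^∞⟮𝓘(ℝ, ModelW n), 𝓘(ℝ, ModelW n)⟯ W,
      (∀ u : D.openPart, (u : W) ∈ D.outer → Φ (D.fromW L hL u) = u) ∧
      ∀ p : D.neck L, Φ (D.fromNeck L hL p) =
        D.collar.toMap (e (p : ℝ × M).1, (p : ℝ × M).2) := by
  suffices hloc : ∀ x, ∃ c : OpenPartialHomeomorph (D.Stretched L hL) W, x ∈ c.source ∧
      Set.EqOn (D.squeezeMap hL e) c c.source ∧
      ContMDiffOn 𝓘(ℝ, ModelW n) 𝓘(ℝ, ModelW n) ∞ c c.source ∧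
      ContMDiffOn 𝓘(ℝ, ModelW n) 𝓘(ℝ, ModelW n) ∞ c.symm c.target by
    obtain ⟨Φ, hΦ⟩ := exists_diffeomorph_of_bijective (D.squeezeMap_bijective hL he hε₀) hloc
    refine ⟨Φ, fun u hu => ?_, fun p => ?_⟩
    · rw [hΦ, D.squeezeMap_fromW hL he hε₀ u hu]
    · rw [hΦ, squeezeMap_fromNeck]
  intro x
  by_cases hx : ∃ p, D.fromNeck L hL p = x
  · obtain ⟨p, rfl⟩ := hx
    let c₀ : OpenPartialHomeomorph (ℝ × M) (ℝ × M) :=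
      e.toOpenPartialHomeomorph.prod (OpenPartialHomeomorph.refl M)
    have hc1 : ContMDiff (𝓘(ℝ, ℝ).prod 𝓘(ℝ, ModelM n)) (𝓘(ℝ, ℝ).prod 𝓘(ℝ, ModelM n)) ∞ c₀ :=
      he.contDiff.contMDiff.prodMap contMDiff_id
    have hc2 : ContMDiff (𝓘(ℝ, ℝ).prod 𝓘(ℝ, ModelM n)) (𝓘(ℝ, ℝ).prod 𝓘(ℝ, ModelM n)) ∞
        c₀.symm := he.contDiff_symm.contMDiff.prodMap contMDiff_id
    refine ⟨(D.toNeck L hL p).trans (c₀.trans D.collar.toMap), ?_, ?_, ?_, ?_⟩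
    · rw [OpenPartialHomeomorph.trans_source, toNeck_source]
      refine ⟨⟨p, rfl⟩, ?_⟩
      rw [Set.mem_preimage, toNeck_fromNeck]
      refine ⟨⟨trivial, trivial⟩, ?_⟩
      exact D.mem_collar_source ((he.abs_lt_iff hL hε₀ (by linarith) _).2 p.2).le _
    · intro y hy
      have hy1 : y ∈ (D.toNeck L hL p).source := hy.1
      rw [toNeck_source] at hy1
      obtain ⟨q, rfl⟩ := hy1
      change _ = D.collar.toMap (c₀ (D.toNeck L hL p (D.fromNeck L hL q)))
      rw [squeezeMap_fromNeck, toNeck_fromNeck]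
      rfl
    · exact D.collar.smooth.comp (hc1.comp_contMDiffOn
        ((D.contMDiffOn_toNeck hL p).mono fun y hy => hy.1)) (fun y hy => hy.2.2)
    · exact (D.contMDiffOn_toNeck_symm hL p).comp (hc2.comp_contMDiffOn
        (D.collar.smooth_symm.mono fun y hy => hy.1.1)) (fun y hy => hy.2)
  · obtain ⟨u, rfl⟩ := (D.exists_rep hL x).resolve_right hx
    let c₀ := OpenPartialHomeomorph.ofSet D.outer (D.isOpen_outer hε₀)
    refine ⟨(D.toW L hL u).trans c₀, ?_, ?_, ?_, ?_⟩
    · rw [OpenPartialHomeomorph.trans_source, toW_source]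
      refine ⟨⟨u, rfl⟩, ?_⟩
      rw [Set.mem_preimage, toW_fromW]
      rintro ⟨⟨t, m⟩, ⟨ht, -⟩, h⟩
      exact hx (D.exists_fromNeck_eq hL ((abs_le.2 ht).trans_lt (by linarith)) m u h)
    · intro y hy
      have hy1 : y ∈ (D.toW L hL u).source := hy.1
      have hy2 : D.toW L hL u y ∈ D.outer := hy.2
      rw [toW_source] at hy1
      obtain ⟨q, rfl⟩ := hy1
      change _ = D.toW L hL u (D.fromW L hL q)
      rw [toW_fromW] at hy2 ⊢
      exact D.squeezeMap_fromW hL he hε₀ q hy2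
    · exact (D.contMDiffOn_toW hL u).mono fun y hy => hy.1
    · exact (D.contMDiffOn_toW_symm hL u).mono fun y hy => hy.2

end NeckData

/-! ### Linear algebra at a point of the neck -/

section Alternating

variable {T : Type*} [AddCommGroup T] [Module ℝ T] [TopologicalSpace T]

theorem form_one_add (l : T [⋀^Fin 1]→L[ℝ] ℝ) (u v : T) : l ![u + v] = l ![u] + l ![v] :=
  l.toAlternatingMap.map_vecCons_add ![] u v

theorem form_one_smul (l : T [⋀^Fin 1]→L[ℝ] ℝ) (c : ℝ) (u : T) : l ![c • u] = c * l ![u] :=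
  l.toAlternatingMap.map_vecCons_smul ![] c u

theorem form_one_zero (l : T [⋀^Fin 1]→L[ℝ] ℝ) : l ![0] = 0 := by
  simpa using form_one_smul l 0 0

theorem form_two_swap (α : T [⋀^Fin 2]→L[ℝ] ℝ) (u v : T) : α ![u, v] = -α ![v, u] := by
  have h := α.toAlternatingMap.map_swap ![v, u] (i := 0) (j := 1) (by decide)
  have h2 : (![v, u] ∘ Equiv.swap (0 : Fin 2) 1) = ![u, v] := by
    ext i
    fin_cases i <;> simp
  rw [h2] at h
  exact h

theorem form_two_self (α : T [⋀^Fin 2]→L[ℝ] ℝ) (u : T) : α ![u, u] = 0 := by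
  have := form_two_swap α u u
  linarith

theorem form_two_add_left (α : T [⋀^Fin 2]→L[ℝ] ℝ) (u v w : T) :
    α ![u + v, w] = α ![u, w] + α ![v, w] :=
  α.toAlternatingMap.map_vecCons_add ![w] u v

theorem form_two_smul_left (α : T [⋀^Fin 2]→L[ℝ] ℝ) (c : ℝ) (u w : T) :
    α ![c • u, w] = c * α ![u, w] :=
  α.toAlternatingMap.map_vecCons_smul ![w] c u

theorem form_two_add_right (α : T [⋀^Fin 2]→L[ℝ] ℝ) (u v w : T) :
    α ![w, u + v] = α ![w, u] + α ![w, v] := by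
  rw [form_two_swap, form_two_add_left, form_two_swap α u, form_two_swap α v]
  ring

theorem form_two_smul_right (α : T [⋀^Fin 2]→L[ℝ] ℝ) (c : ℝ) (u w : T) :
    α ![w, c • u] = c * α ![w, u] := by
  rw [form_two_swap, form_two_smul_left, form_two_swap α u]
  ring

/-- The value of a two-form on two vectors with components in the same direction `X` has no term in
`α(X, X)`. -/
theorem form_two_expand (α : T [⋀^Fin 2]→L[ℝ] ℝ) (x y : ℝ) (X v v' : T) :
    α ![y • X + v, x • X + v'] = y * α ![X, v'] + x * α ![v, X] + α ![v, v'] := by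
  simp only [form_two_add_left, form_two_add_right, form_two_smul_left, form_two_smul_right,
    form_two_self]
  ring

end Alternating

/-- The positivity of `q + b' (x² + y²)` survives the error `d (y A + x B + C)`: by the inequality
between the geometric and the arithmetic mean each mixed term is at most
`2 (|d| κ₀)² x² + q / 8`, respectively `2 (|d| κ₀)² y² + q / 8`. -/
theorem quadratic_pos {κ₀ b' d q x y A B C : ℝ} (hκ₀ : 0 < κ₀) (hq0 : 0 ≤ q)
    (hb1 : |d| * κ₀ ≤ 1 / 4) (hb2 : 2 * (|d| * κ₀) ^ 2 < b') (hne : 0 < x ^ 2 + y ^ 2 ∨ 0 < q)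
    (hA : |A| ≤ κ₀ * √q) (hB : |B| ≤ κ₀ * √q) (hC : |C| ≤ κ₀ * q) :
    0 < q + d * (y * A + x * B + C) + b' * (x ^ 2 + y ^ 2) := by
  have hxy : 0 ≤ x ^ 2 + y ^ 2 := by positivity
  set r := √q
  have hr : r ^ 2 = q := Real.sq_sqrt hq0
  set k := |d| * κ₀ with hk
  have hk0 : 0 ≤ k := by positivity
  have hr0 : 0 ≤ r := Real.sqrt_nonneg q
  have h1 : |d * (y * A)| ≤ k * (|y| * r) := by
    rw [abs_mul, abs_mul, hk]
    calc |d| * (|y| * |A|) ≤ |d| * (|y| * (κ₀ * r)) := by gcongr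
      _ = _ := by ring
  have h2 : |d * (x * B)| ≤ k * (|x| * r) := by
    rw [abs_mul, abs_mul, hk]
    calc |d| * (|x| * |B|) ≤ |d| * (|x| * (κ₀ * r)) := by gcongr
      _ = _ := by ring
  have h3 : |d * C| ≤ k * q := by
    rw [abs_mul, hk]
    calc |d| * |C| ≤ |d| * (κ₀ * q) := by gcongr
      _ = _ := by ring
  have h4 : k * (|y| * r) ≤ 2 * k ^ 2 * y ^ 2 + q / 8 := by
    rw [← hr, ← sq_abs y]
    nlinarith [sq_nonneg (4 * k * |y| - r)]
  have h5 : k * (|x| * r) ≤ 2 * k ^ 2 * x ^ 2 + q / 8 := by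
    rw [← hr, ← sq_abs x]
    nlinarith [sq_nonneg (4 * k * |x| - r)]
  have h6 : k * q ≤ q / 4 := by nlinarith
  have h7 := (abs_le.1 h1).1
  have h8 := (abs_le.1 h2).1
  have h9 := (abs_le.1 h3).1
  have h10 : 0 < (b' - 2 * k ^ 2) * (x ^ 2 + y ^ 2) + q / 2 := by
    have hb3 : 0 < b' - 2 * k ^ 2 := by linarith
    have h11 : 0 ≤ (b' - 2 * k ^ 2) * (x ^ 2 + y ^ 2) := mul_nonneg hb3.le hxy
    rcases hne with h | h
    · have := mul_pos hb3 h
      linarith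
    · linarith
  linarith

theorem IsCutoff.theta_pos {ε₀ : ℝ} {β χ : ℝ → ℝ} (hβ : IsCutoff ε₀ β) (hχ : IsMetricCutoff ε₀ χ)
    (hε₀ : 0 < ε₀) (s : ℝ) : 0 < theta β χ s := by
  obtain ⟨h0, h1⟩ := hχ.mem_Icc |s|
  rw [theta]
  rcases lt_or_ge |s| (3 * ε₀) with h | h
  · rw [hχ.eq_one _ h]
    norm_num
  · have h2 := hβ.deriv_pos' (s := s) (by linarith)
    rcases h0.eq_or_lt with h3 | h3
    · rw [← h3]
      linarith
    · have : 0 ≤ (1 - χ |s|) * deriv β s := mul_nonneg (by linarith) h2.le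
      linarith

theorem theta_eq_one {ε₀ : ℝ} {β χ : ℝ → ℝ} (hχ : IsMetricCutoff ε₀ χ) {s : ℝ}
    (hs : |s| < 3 * ε₀) : theta β χ s = 1 := by
  rw [theta, hχ.eq_one _ hs]
  ring

theorem thetaL_eq {ε₀ : ℝ} {β χ : ℝ → ℝ} (hχ : IsMetricCutoff ε₀ χ) (hε₀ : 0 < ε₀) (L t : ℝ) :
    thetaL β χ L t = theta β χ (collapse L t) := by
  unfold thetaL collapse
  split_ifs
  · rfl
  · rw [theta_eq_one hχ (by simpa using hε₀)]
  · rfl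

namespace NeckData

variable {n : ℕ} {ε₀ : ℝ} {β : ℝ → ℝ} {W : Type u} {M : Type v} [TopologicalSpace W]
  [ChartedSpace (ModelW n) W] [IsManifold 𝓘(ℝ, ModelW n) ∞ W] [TopologicalSpace M]
  [ChartedSpace (ModelM n) M] [IsManifold 𝓘(ℝ, ModelM n) ∞ M]

variable (D : NeckData (n := n) ε₀ β W M)

/-- On the whole neck the almost-complex structure is `JBetween` at the collapsed coordinate. -/
theorem cylJ_eq (hε₀ : 0 < ε₀) (L t : ℝ) (m : M) :
    D.cylJ L t m = D.JBetween (collapse L t) m := by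
  unfold cylJ collapse
  split_ifs
  · rfl
  · rw [D.interpolating.eq_neck 0 ⟨by linarith, by linarith⟩, D.adapted.translation t 0]
  · rfl

/-- The metric `(θ da ∧ λ + ω + β_* dλ)(-, JBetween -)` on `[-8ε₀, 8ε₀] × M`. -/
noncomputable def metric (s : ℝ) (m : M) (u u' : ℝ × TangentSpace 𝓘(ℝ, ModelM n) m) : ℝ :=
  theta β D.χ s * daWedge D.lam m u (D.JBetween s m u') +
    omegaHat D.lam D.om (β s) m u (D.JBetween s m u')

theorem cylMetric_eq (hβ : IsCutoff ε₀ β) (hε₀ : 0 < ε₀) (L t : ℝ) (m : M)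
    (u u' : ℝ × TangentSpace 𝓘(ℝ, ModelM n) m) :
    D.cylMetric L t m u u' = D.metric (collapse L t) m u u' := by
  rw [cylMetric, metric, thetaL_eq D.metricCutoff hε₀, hβ.betaL_eq hε₀, D.cylJ_eq hε₀]

/-- Every tangent vector of the neck is of the form `x ∂_a + y X + v` with `v ∈ ker (da ∧ λ)`, and
in these terms the almost-complex structure, the metric and the two-forms are explicit. -/
theorem exists_decomposition {s : ℝ} (hs : s ∈ Set.Icc (-8 * ε₀) (8 * ε₀)) (m : M)
    (u : ℝ × TangentSpace 𝓘(ℝ, ModelM n) m) :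
    ∃ (X v v' : TangentSpace 𝓘(ℝ, ModelM n) m) (y q : ℝ),
      u.2 = y • X + v ∧ D.JBetween s m u = (-y, u.1 • X + v') ∧ 0 ≤ q ∧ (v ≠ 0 → 0 < q) ∧
      daWedge D.lam m u (D.JBetween s m u) = u.1 ^ 2 + y ^ 2 ∧
      omegaHat D.lam D.om (β s) m u (D.JBetween s m u) = q ∧
      D.metric s m (0, X) (0, X) = theta β D.χ s ∧ D.metric s m (0, v) (0, v) = q ∧
      D.metric s m (0, v') (0, v') = q := by
  obtain ⟨X, hX1, hX0, hJ1, hJX⟩ := D.interpolating.swaps s hs m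
  obtain ⟨x, w⟩ := u
  set y := D.lam m ![w] with hy
  set v := w - y • X with hv
  have hw : w = y • X + v := by rw [hv]; abel
  have hlv : D.lam m ![v] = 0 := by
    have h := form_one_add (D.lam m) (y • X) v
    rw [← hw, form_one_smul, hX1] at h
    linarith
  obtain ⟨h1, h2⟩ := D.interpolating.preserves s hs m v hlv
  set v' := (D.JBetween s m (0, v)).2 with hv'
  have hJv : D.JBetween s m (0, v) = (0, v') := Prod.ext h1 rfl
  have hJv' : D.JBetween s m (0, v') = (0, -v) := by
    rw [← hJv, D.interpolating.sq s hs]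
    simp
  have hJu : D.JBetween s m (x, w) = (-y, x • X + v') := by
    have h3 : ((x, w) : ℝ × TangentSpace 𝓘(ℝ, ModelM n) m) =
        x • ((1, 0) : ℝ × TangentSpace 𝓘(ℝ, ModelM n) m) + y • (0, X) + (0, v) := by
      rw [Prod.ext_iff]
      refine ⟨by simp, ?_⟩
      simpa using hw
    rw [h3, map_add, map_add, map_smul, map_smul, hJ1, hJX, hJv]
    rw [Prod.ext_iff]
    exact ⟨by simp, by simp⟩
  have hda : ∀ z z' : TangentSpace 𝓘(ℝ, ModelM n) m, daWedge D.lam m (0, z) (0, z') = 0 := by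
    intro z z'
    simp [daWedge]
  have hneg : omegaHat D.lam D.om (β s) m (0, v') (0, -v) =
      omegaHat D.lam D.om (β s) m (0, v) (0, v') := by
    simp only [omegaHat]
    rw [← neg_one_smul ℝ v, form_two_smul_right, form_two_smul_right, form_two_swap (D.om m) v',
      form_two_swap (extD D.lam m) v']
    ring
  have hpos : v ≠ 0 → 0 < omegaHat D.lam D.om (β s) m (0, v) (0, v') := by
    intro h
    rw [← hJv]
    exact D.interpolating.pos s hs m v hlv h
  refine ⟨X, v, v', y, omegaHat D.lam D.om (β s) m (0, v) (0, v'), hw, hJu, ?_, hpos, ?_, ?_, ?_,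
    ?_, ?_⟩
  · by_cases h : v = 0
    · rw [h, omegaHat, ← zero_smul ℝ X, form_two_smul_left, form_two_smul_left]
      simp
    · exact (hpos h).le
  · rw [hJu]
    simp only [daWedge, form_one_add, form_one_smul, hX1, h2, ← hy]
    ring
  · rw [hJu]
    have h3 := hX0 (0, v')
    have h4 := hX0 (0, v)
    simp only [omegaHat] at h3 h4 ⊢
    rw [hw, form_two_expand, form_two_expand, form_two_swap (D.om m) v X,
      form_two_swap (extD D.lam m) v X]
    linear_combination y * h3 - x * h4
  · rw [metric, hJX, hX0]
    simp [daWedge, hX1]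
  · rw [metric, hJv, hda]
    ring
  · rw [metric, hJv', hda, hneg]
    ring

/-- The form `ω + b dλ + b' da ∧ λ` tames `JBetween` if `b` is `β_*`, or if it is close to `β_*`
compared with `b'`. The mixed terms of `dλ` contain only one of the vectors `∂_a`, `X`, so that they
are bounded by the geometric mean of the other two terms. -/
theorem tames_of_close {s : ℝ} (hs : s ∈ Set.Icc (-8 * ε₀) (8 * ε₀)) (m : M) {κ₀ b b' : ℝ}
    (hκ₀ : 0 < κ₀)
    (hext : ∀ u u' : ℝ × TangentSpace 𝓘(ℝ, ModelM n) m, |extD D.lam m ![u.2, u'.2]| ≤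
      κ₀ * √(D.metric s m u u) * √(D.metric s m u' u')) (hb' : 0 < b')
    (hb : b = β s ∨ theta β D.χ s = 1 ∧ |b - β s| * κ₀ ≤ 1 / 4 ∧
      2 * (|b - β s| * κ₀) ^ 2 < b') (u : ℝ × TangentSpace 𝓘(ℝ, ModelM n) m) (hu : u ≠ 0) :
    0 < omegaHat D.lam D.om b m u (D.JBetween s m u) +
      b' * daWedge D.lam m u (D.JBetween s m u) := by
  obtain ⟨X, v, v', y, q, hw, hJ, hq0, hqpos, hda, hom, hgX, hgv, hgv'⟩ :=
    D.exists_decomposition hs m u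
  have hne : 0 < u.1 ^ 2 + y ^ 2 ∨ 0 < q := by
    by_contra! h
    have hx : u.1 = 0 := by nlinarith [sq_nonneg u.1, sq_nonneg y]
    have hy : y = 0 := by nlinarith [sq_nonneg u.1, sq_nonneg y]
    have hv : v = 0 := by
      by_contra hv
      exact absurd (hqpos hv) (not_lt.2 h.2)
    apply hu
    rw [Prod.ext_iff]
    exact ⟨hx, by rw [hw, hy, hv]; simp⟩
  have hsplit : omegaHat D.lam D.om b m u (D.JBetween s m u) =
      q + (b - β s) * extD D.lam m ![u.2, (D.JBetween s m u).2] := by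
    rw [← hom]
    simp only [omegaHat]
    ring
  rw [hsplit, hda]
  have hxy : 0 ≤ u.1 ^ 2 + y ^ 2 := by positivity
  rcases hb with rfl | ⟨hθ, hb1, hb2⟩
  · rw [sub_self, zero_mul, add_zero]
    rcases hne with h | h
    · positivity
    · positivity
  rw [hJ, hw, form_two_expand]
  have hA := hext (0, X) (0, v')
  have hB := hext (0, v) (0, X)
  have hC := hext (0, v) (0, v')
  rw [hgX, hgv', hθ, Real.sqrt_one, mul_one] at hA
  rw [hgX, hgv, hθ, Real.sqrt_one, mul_one] at hB
  rw [hgv, hgv', mul_assoc, Real.mul_self_sqrt hq0] at hC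
  simp only at hA hB hC ⊢
  exact quadratic_pos hκ₀ hq0 hb1 hb2 hne hA hB hC

/-- The metric is positive definite. -/
theorem metric_pos (hβ : IsCutoff ε₀ β) (hε₀ : 0 < ε₀) {s : ℝ}
    (hs : s ∈ Set.Icc (-8 * ε₀) (8 * ε₀)) (m : M) (u : ℝ × TangentSpace 𝓘(ℝ, ModelM n) m)
    (hu : u ≠ 0) : 0 < D.metric s m u u := by
  obtain ⟨X, v, v', y, q, hw, hJ, hq0, hqpos, hda, hom, -, -, -⟩ :=
    D.exists_decomposition hs m u
  rw [metric, hda, hom]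
  have hθ := hβ.theta_pos D.metricCutoff hε₀ s
  by_cases hv : v = 0
  · have : 0 < u.1 ^ 2 + y ^ 2 := by
      by_contra! h
      have hx : u.1 = 0 := by nlinarith [sq_nonneg u.1, sq_nonneg y]
      have hy : y = 0 := by nlinarith [sq_nonneg u.1, sq_nonneg y]
      apply hu
      rw [Prod.ext_iff]
      exact ⟨hx, by rw [hw, hy, hv]; simp⟩
    positivity
  · have := hqpos hv
    positivity

/-- On `ker (da ∧ λ)` the metric is `(ω + β_* dλ)(-, JBetween -)`. -/
theorem metric_eq_omegaHat {s : ℝ} {m : M} {v : TangentSpace 𝓘(ℝ, ModelM n) m}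
    (hv : D.lam m ![v] = 0) :
    D.metric s m (0, v) (0, v) =
      omegaHat D.lam D.om (β s) m (0, v) (D.JBetween s m (0, v)) := by
  simp [metric, daWedge, hv]

end NeckData

/-! ### Differential forms in coordinates -/

section Coordinates

variable {E : Type*} [NormedAddCommGroup E] [NormedSpace ℝ E] {N : Type*} [TopologicalSpace N]
  [ChartedSpace E N]

theorem IsSmoothForm.continuousAt_localForm {k : ℕ} {α : DiffForm E N k} (hα : IsSmoothForm α)
    (x₀ : N) : ContinuousAt (fun x => localForm α x₀ (extChartAt 𝓘(ℝ, E) x₀ x)) x₀ :=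
  ContinuousAt.comp (f := extChartAt 𝓘(ℝ, E) x₀) (x := x₀) (g := localForm α x₀)
    ((hα x₀).contDiffAt ((isOpen_extChartAt_target x₀).mem_nhds
      (mem_extChartAt_target x₀))).continuousAt (continuousAt_extChartAt x₀)

theorem IsSmoothForm.continuousAt_extDeriv {k : ℕ} {α : DiffForm E N k} (hα : IsSmoothForm α)
    (x₀ : N) :
    ContinuousAt (fun x => extDeriv (localForm α x₀) (extChartAt 𝓘(ℝ, E) x₀ x)) x₀ := by
  have h1 : ContDiffAt ℝ ∞ (localForm α x₀) (extChartAt 𝓘(ℝ, E) x₀ x₀) :=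
    (hα x₀).contDiffAt ((isOpen_extChartAt_target x₀).mem_nhds (mem_extChartAt_target x₀))
  have h2 : ContinuousAt (fderiv ℝ (localForm α x₀)) (extChartAt 𝓘(ℝ, E) x₀ x₀) :=
    (h1.fderiv_right (m := 0) (by simp)).continuousAt
  exact ((ContinuousAlternatingMap.alternatizeUncurryFinCLM ℝ E ℝ).continuous.continuousAt.comp
    h2).comp (continuousAt_extChartAt x₀)

variable [IsManifold 𝓘(ℝ, E) ∞ N]

/-- The linear map from the model space to the tangent space at `x` that is given by the chart
around `x₀`. -/
noncomputable def frame (x₀ x : N) : E →L[ℝ] TangentSpace 𝓘(ℝ, E) x :=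
  (trivializationAt E (TangentSpace 𝓘(ℝ, E)) x₀).symmL ℝ x

/-- A differential form as a function into the alternating forms on the model space, of which every
tangent space is a copy. -/
def modelForm {k : ℕ} (α : DiffForm E N k) (x : N) : E [⋀^Fin k]→L[ℝ] ℝ := α x

theorem frame_surjective {x₀ x : N} (hx : x ∈ (chartAt E x₀).source) :
    Function.Surjective (frame (E := E) x₀ x) := by
  intro u
  refine ⟨(trivializationAt E (TangentSpace 𝓘(ℝ, E)) x₀).continuousLinearMapAt ℝ x u, ?_⟩
  exact Bundle.Trivialization.symmL_continuousLinearMapAt _ hx u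

theorem frame_injective {x₀ x : N} (hx : x ∈ (chartAt E x₀).source) :
    Function.Injective (frame (E := E) x₀ x) := by
  intro u v huv
  have := congrArg ((trivializationAt E (TangentSpace 𝓘(ℝ, E)) x₀).continuousLinearMapAt ℝ x) huv
  rwa [frame, Bundle.Trivialization.continuousLinearMapAt_symmL _ hx,
    Bundle.Trivialization.continuousLinearMapAt_symmL _ hx] at this

theorem frame_eq {x₀ x : N} (hx : x ∈ (chartAt E x₀).source) :
    (frame x₀ x : E →L[ℝ] E) =
      mfderiv 𝓘(ℝ, E) 𝓘(ℝ, E) (extChartAt 𝓘(ℝ, E) x₀).symm (extChartAt 𝓘(ℝ, E) x₀ x) := by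
  have : IsManifold 𝓘(ℝ, E) 1 N := .of_le (n := ∞) (by simp)
  have h := TangentBundle.symmL_trivializationAt (I := 𝓘(ℝ, E)) hx
  rw [ModelWithCorners.range_eq_univ, mfderivWithin_univ] at h
  exact h

/-- The coordinate expression of a form, evaluated on coordinate vectors. -/
theorem localForm_apply {k : ℕ} (α : DiffForm E N k) {x₀ x : N} (hx : x ∈ (chartAt E x₀).source)
    (v : Fin k → E) :
    localForm α x₀ (extChartAt 𝓘(ℝ, E) x₀ x) v = α x (fun i => frame x₀ x (v i)) := by
  have h1 : (extChartAt 𝓘(ℝ, E) x₀).symm (extChartAt 𝓘(ℝ, E) x₀ x) = x :=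
    (extChartAt 𝓘(ℝ, E) x₀).left_inv (by rwa [extChartAt_source])
  have h2 := congrArg (modelForm α) h1
  have h3 := frame_eq hx
  change (α ((extChartAt 𝓘(ℝ, E) x₀).symm (extChartAt 𝓘(ℝ, E) x₀ x)) : E [⋀^Fin k]→L[ℝ] ℝ)
    (fun i => (mfderiv 𝓘(ℝ, E) 𝓘(ℝ, E) (extChartAt 𝓘(ℝ, E) x₀).symm
      (extChartAt 𝓘(ℝ, E) x₀ x) : E →L[ℝ] E) (v i)) =
    (α x : E [⋀^Fin k]→L[ℝ] ℝ) (fun i => (frame x₀ x : E →L[ℝ] E) (v i))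
  rw [h3]
  exact congrArg (fun A : E [⋀^Fin k]→L[ℝ] ℝ => A _) h2

/-- The exterior derivative can be computed in every chart, by its naturality under the coordinate
change. -/
theorem extD_apply_frame {k : ℕ} {α : DiffForm E N k} (hα : IsSmoothForm α) {x₀ x : N}
    (hx : x ∈ (chartAt E x₀).source) (v : Fin (k + 1) → E) :
    extD α x (fun i => frame x₀ x (v i)) =
      extDeriv (localForm α x₀) (extChartAt 𝓘(ℝ, E) x₀ x) v := by
  set φ := extChartAt 𝓘(ℝ, E) x₀ with hφ
  set ψ := extChartAt 𝓘(ℝ, E) x with hψ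
  set y := φ x with hy
  have hxs : x ∈ φ.source := by rwa [hφ, extChartAt_source]
  have hyx : φ.symm y = x := φ.left_inv hxs
  have hyt : y ∈ φ.target := φ.map_source hxs
  set f : E → E := fun z => ψ (φ.symm z) with hf
  have hfy : f y = ψ x := by rw [hf]; simp only [hyx]
  -- near `y` the inverse chart `φ.symm` is smooth and takes values in the domain of `ψ`
  have hO : ∀ᶠ z in 𝓝 y, z ∈ φ.target ∧ φ.symm z ∈ (chartAt E x).source := by
    have h1 : φ.target ∈ 𝓝 y := (isOpen_extChartAt_target x₀).mem_nhds hyt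
    have h2 : ContinuousAt φ.symm y := continuousAt_extChartAt_symm'' hyt
    have h3 : (chartAt E x).source ∈ 𝓝 (φ.symm y) := by
      rw [hyx]
      exact (chartAt E x).open_source.mem_nhds (mem_chart_source E x)
    exact (Filter.eventually_mem_set.2 h1).and (h2 h3)
  have hsymm : ∀ z ∈ φ.target, ContMDiffAt 𝓘(ℝ, E) 𝓘(ℝ, E) ∞ φ.symm z := fun z hz =>
    (contMDiffOn_extChartAt_symm x₀).contMDiffAt ((isOpen_extChartAt_target x₀).mem_nhds hz)
  have hfsm : ∀ z, z ∈ φ.target ∧ φ.symm z ∈ (chartAt E x).source → ContDiffAt ℝ ∞ f z := by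
    rintro z ⟨h1, h2⟩
    exact ((contMDiffAt_extChartAt' h2).comp z (hsymm z h1)).contDiffAt
  have hloc : localForm α x₀ =ᶠ[𝓝 y]
      fun z => (localForm α x (f z)).compContinuousLinearMap (fderiv ℝ f z) := by
    filter_upwards [hO.eventually_nhds] with z hz
    obtain ⟨h1, h2⟩ := hz.self_of_nhds
    have h2' : φ.symm z ∈ ψ.source := by rwa [hψ, extChartAt_source]
    have h3 : ψ.symm (f z) = φ.symm z := ψ.left_inv h2'
    have h4 : φ.symm =ᶠ[𝓝 z] ψ.symm ∘ f := by
      filter_upwards [hz] with w hw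
      refine (ψ.left_inv ?_).symm
      rw [hψ, extChartAt_source]
      exact hw.2
    have h5 : f z ∈ ψ.target := ψ.map_source h2'
    have h6 : (mfderiv 𝓘(ℝ, E) 𝓘(ℝ, E) φ.symm z : E →L[ℝ] E) =
        (mfderiv 𝓘(ℝ, E) 𝓘(ℝ, E) ψ.symm (f z) : E →L[ℝ] E).comp (fderiv ℝ f z) := by
      have h7 := h4.mfderiv_eq (I := 𝓘(ℝ, E)) (I' := 𝓘(ℝ, E))
      have h8 : MDifferentiableAt 𝓘(ℝ, E) 𝓘(ℝ, E) ψ.symm (f z) :=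
        ((contMDiffOn_extChartAt_symm (n := ∞) x).contMDiffAt
          ((isOpen_extChartAt_target x).mem_nhds h5)).mdifferentiableAt (by simp)
      have h9 : MDifferentiableAt 𝓘(ℝ, E) 𝓘(ℝ, E) f z :=
        ((hfsm z ⟨h1, h2⟩).differentiableAt (by simp)).mdifferentiableAt
      rw [mfderiv_comp z h8 h9, mfderiv_eq_fderiv] at h7
      exact h7
    have h10 := congrArg (modelForm α) h3
    ext w
    change (α (φ.symm z) : E [⋀^Fin k]→L[ℝ] ℝ)
      (fun i => (mfderiv 𝓘(ℝ, E) 𝓘(ℝ, E) φ.symm z : E →L[ℝ] E) (w i)) =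
      (α (ψ.symm (f z)) : E [⋀^Fin k]→L[ℝ] ℝ)
        (fun i => (mfderiv 𝓘(ℝ, E) 𝓘(ℝ, E) ψ.symm (f z) : E →L[ℝ] E) (fderiv ℝ f z (w i)))
    rw [h6]
    exact (congrArg (fun A : E [⋀^Fin k]→L[ℝ] ℝ => A _) h10).symm
  have hdiff : DifferentiableAt ℝ (localForm α x) (f y) := by
    rw [hfy]
    exact ((hα x).contDiffAt ((isOpen_extChartAt_target x).mem_nhds
      (mem_extChartAt_target x))).differentiableAt (by simp)
  have hfr : (frame x₀ x : E →L[ℝ] E) = fderiv ℝ f y := by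
    rw [frame_eq hx]
    have h1 := ((hsymm y hyt).mdifferentiableAt (by simp))
    refine h1.mfderiv.trans ?_
    rw [ModelWithCorners.range_eq_univ, fderivWithin_univ]
    have h2 : writtenInExtChartAt 𝓘(ℝ, E) 𝓘(ℝ, E) y φ.symm = f := by
      ext z
      simp only [writtenInExtChartAt, hyx, hf, hψ, Function.comp_apply]
      rfl
    rw [h2]
    rfl
  rw [hloc.extDeriv_eq, extDeriv_pullback (r := ∞) hdiff
    (hfsm y hO.self_of_nhds)
    (by rw [minSmoothness_of_isRCLikeNormedField]; exact WithTop.coe_le_coe.2 le_top), hfy]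
  change (extDeriv (localForm α x) (ψ x) : E [⋀^Fin (k + 1)]→L[ℝ] ℝ)
    (fun i => (frame x₀ x : E →L[ℝ] E) (v i)) = _
  rw [hfr]
  rfl

end Coordinates

/-! ### Existence of a uniform bound -/

/-- A quadratic form that is positive definite at one parameter bounds bilinear expressions
uniformly for all nearby parameters, by compactness of the unit sphere. -/
theorem eventually_le_sqrt_mul_sqrt {X V : Type*} [TopologicalSpace X] [NormedAddCommGroup V]
    [NormedSpace ℝ V] [FiniteDimensional ℝ V] {Γ : X → V → ℝ} {δ : X → V → V → ℝ} {ν : X → ℝ}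
    (hΓ : Continuous fun z : X × V => Γ z.1 z.2)
    (hsmul : ∀ x (r : ℝ) ξ, Γ x (r • ξ) = r ^ 2 * Γ x ξ)
    (hν : Continuous ν) (hν0 : ∀ x, 0 ≤ ν x) (hδ : ∀ x ξ ξ', |δ x ξ ξ'| ≤ ν x * ‖ξ‖ * ‖ξ'‖)
    {x₀ : X} (hpos : ∀ ξ, ξ ≠ 0 → 0 < Γ x₀ ξ) :
    ∃ C : ℝ, ∀ᶠ x in 𝓝 x₀, ∀ ξ ξ', |δ x ξ ξ'| ≤ C * √(Γ x ξ) * √(Γ x ξ') := by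
  have hK : IsCompact (Metric.sphere (0 : V) 1) := isCompact_sphere 0 1
  obtain ⟨c, hc0, hc⟩ : ∃ c : ℝ, 0 < c ∧ ∀ ξ ∈ Metric.sphere (0 : V) 1, c < Γ x₀ ξ := by
    rcases (Metric.sphere (0 : V) 1).eq_empty_or_nonempty with h | h
    · exact ⟨1, one_pos, by simp [h]⟩
    · obtain ⟨ξ₀, hξ₀, hmin⟩ := hK.exists_isMinOn h
        (hΓ.comp (Continuous.prodMk_right x₀)).continuousOn
      have h1 : 0 < Γ x₀ ξ₀ := hpos ξ₀ (ne_zero_of_mem_unit_sphere ⟨ξ₀, hξ₀⟩)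
      refine ⟨Γ x₀ ξ₀ / 2, by linarith, fun ξ hξ => ?_⟩
      have h2 : Γ x₀ ξ₀ ≤ Γ x₀ ξ := hmin hξ
      linarith
  have h1 : ∀ᶠ x in 𝓝 x₀, ∀ ξ ∈ Metric.sphere (0 : V) 1, c < Γ x ξ :=
    hK.eventually_forall_of_forall_eventually fun ξ hξ =>
      hΓ.continuousAt.eventually_const_lt (hc ξ hξ)
  have h2 : ∀ᶠ x in 𝓝 x₀, ν x < ν x₀ + 1 :=
    hν.continuousAt.eventually_lt_const (by linarith)
  refine ⟨(ν x₀ + 1) / c, ?_⟩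
  filter_upwards [h1, h2] with x hx1 hx2 ξ ξ'
  have key : ∀ ζ : V, √c * ‖ζ‖ ≤ √(Γ x ζ) := by
    intro ζ
    apply Real.le_sqrt_of_sq_le
    rw [mul_pow, Real.sq_sqrt hc0.le]
    rcases eq_or_ne ζ 0 with rfl | h
    · have : Γ x 0 = 0 := by simpa using hsmul x 0 0
      rw [this, norm_zero]
      simp
    · have h3 : ‖ζ‖ ≠ 0 := norm_ne_zero_iff.2 h
      have h4 : ζ = ‖ζ‖ • (‖ζ‖⁻¹ • ζ) := by rw [smul_smul, mul_inv_cancel₀ h3, one_smul]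
      have h5 : ‖ζ‖⁻¹ • ζ ∈ Metric.sphere (0 : V) 1 := by
        rw [mem_sphere_zero_iff_norm, norm_smul, norm_inv, norm_norm, inv_mul_cancel₀ h3]
      have h6 := hx1 _ h5
      have h7 : Γ x ζ = ‖ζ‖ ^ 2 * Γ x (‖ζ‖⁻¹ • ζ) := by
        conv_lhs => rw [h4]
        exact hsmul _ _ _
      rw [h7]
      nlinarith [sq_nonneg ‖ζ‖]
  have h0 : 0 ≤ ν x₀ + 1 := by linarith [hν0 x₀]
  calc |δ x ξ ξ'| ≤ ν x * ‖ξ‖ * ‖ξ'‖ := hδ x ξ ξ'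
    _ ≤ (ν x₀ + 1) * ‖ξ‖ * ‖ξ'‖ := by gcongr
    _ = (ν x₀ + 1) / c * (√c * ‖ξ‖) * (√c * ‖ξ'‖) := by
        rw [show (ν x₀ + 1) / c * (√c * ‖ξ‖) * (√c * ‖ξ'‖) =
          (ν x₀ + 1) / c * (√c * √c) * ‖ξ‖ * ‖ξ'‖ by ring, Real.mul_self_sqrt hc0.le,
          div_mul_cancel₀ _ hc0.ne']
    _ ≤ (ν x₀ + 1) / c * √(Γ x ξ) * √(Γ x ξ') := by
        gcongr
        · exact key ξ
        · exact key ξ'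

/-- The data that determine the metric at a point, in coordinates: the values of `θ` and `β_*`, the
forms `λ`, `ω` and `dλ`, and the almost-complex structure. -/
abbrev CoordData (E : Type*) [NormedAddCommGroup E] [NormedSpace ℝ E] :=
  ℝ × ℝ × (E [⋀^Fin 1]→L[ℝ] ℝ) × (E [⋀^Fin 2]→L[ℝ] ℝ) × (E [⋀^Fin 2]→L[ℝ] ℝ) ×
    ((ℝ × E) →L[ℝ] (ℝ × E))

/-- The quadratic form of the metric in coordinates. -/
def coordMetric {E : Type*} [NormedAddCommGroup E] [NormedSpace ℝ E] (x : CoordData E)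
    (ξ : ℝ × E) : ℝ :=
  x.1 * (ξ.1 * x.2.2.1 ![(x.2.2.2.2.2 ξ).2] - (x.2.2.2.2.2 ξ).1 * x.2.2.1 ![ξ.2]) +
    (x.2.2.2.1 ![ξ.2, (x.2.2.2.2.2 ξ).2] + x.2.1 * x.2.2.2.2.1 ![ξ.2, (x.2.2.2.2.2 ξ).2])

theorem continuous_coordMetric {E : Type*} [NormedAddCommGroup E] [NormedSpace ℝ E] :
    Continuous fun z : CoordData E × (ℝ × E) => coordMetric z.1 z.2 := by
  have hJ : Continuous fun z : CoordData E × (ℝ × E) => z.1.2.2.2.2.2 z.2 := by fun_prop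
  have hl : Continuous fun z : CoordData E × (ℝ × E) => z.1.2.2.1 := by fun_prop
  have ho : Continuous fun z : CoordData E × (ℝ × E) => z.1.2.2.2.1 := by fun_prop
  have hd : Continuous fun z : CoordData E × (ℝ × E) => z.1.2.2.2.2.1 := by fun_prop
  have h1 : Continuous fun z : CoordData E × (ℝ × E) => ![(z.1.2.2.2.2.2 z.2).2] :=
    continuous_pi fun i => by fin_cases i; exact hJ.snd
  have h2 : Continuous fun z : CoordData E × (ℝ × E) => ![z.2.2] :=
    continuous_pi fun i => by fin_cases i; exact continuous_snd.snd
  have h3 : Continuous fun z : CoordData E × (ℝ × E) => ![z.2.2, (z.1.2.2.2.2.2 z.2).2] :=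
    continuous_pi fun i => by
      fin_cases i
      · exact continuous_snd.snd
      · exact hJ.snd
  exact (continuous_fst.fst.mul ((continuous_snd.fst.mul (hl.eval h1)).sub
    (hJ.fst.mul (hl.eval h2)))).add ((ho.eval h3).add (continuous_fst.snd.fst.mul (hd.eval h3)))

theorem coordMetric_smul {E : Type*} [NormedAddCommGroup E] [NormedSpace ℝ E] (x : CoordData E)
    (r : ℝ) (ξ : ℝ × E) : coordMetric x (r • ξ) = r ^ 2 * coordMetric x ξ := by
  simp only [coordMetric, map_smul, Prod.smul_fst, Prod.smul_snd, form_one_smul,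
    form_two_smul_left, form_two_smul_right, smul_eq_mul]
  ring

namespace NeckData

variable {n : ℕ} {ε₀ : ℝ} {β : ℝ → ℝ} {W : Type u} {M : Type v} [TopologicalSpace W]
  [ChartedSpace (ModelW n) W] [IsManifold 𝓘(ℝ, ModelW n) ∞ W] [TopologicalSpace M]
  [ChartedSpace (ModelM n) M] [IsManifold 𝓘(ℝ, ModelM n) ∞ M]

variable (D : NeckData (n := n) ε₀ β W M)

/-- The trivialization of the tangent bundle of `ℝ × M` is the identity in the first factor. -/
theorem symmL_prod (p₀ p : ℝ × M) (hp : p.2 ∈ (chartAt (ModelM n) p₀.2).source)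
    (ξ : ℝ × ModelM n) :
    ((trivializationAt (ℝ × ModelM n) (TangentSpace (𝓘(ℝ, ℝ).prod 𝓘(ℝ, ModelM n))) p₀).symmL ℝ p ξ :
      ℝ × ModelM n) = (ξ.1, frame p₀.2 p.2 ξ.2) := by
  have h1 : p ∈ (chartAt (ModelProd ℝ (ModelM n)) p₀).source := ⟨trivial, hp⟩
  have h2 := TangentBundle.symmL_trivializationAt (I := 𝓘(ℝ, ℝ).prod 𝓘(ℝ, ModelM n)) h1
  have h3 := frame_eq hp
  rw [h2, h3, ModelWithCorners.range_eq_univ, mfderivWithin_univ]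
  have h4 : MDifferentiableAt 𝓘(ℝ, ModelM n) 𝓘(ℝ, ModelM n)
      (extChartAt 𝓘(ℝ, ModelM n) p₀.2).symm (extChartAt 𝓘(ℝ, ModelM n) p₀.2 p.2) :=
    ((contMDiffOn_extChartAt_symm (n := ∞) p₀.2).contMDiffAt
      ((isOpen_extChartAt_target p₀.2).mem_nhds ((extChartAt 𝓘(ℝ, ModelM n) p₀.2).map_source
        (by rwa [extChartAt_source])))).mdifferentiableAt (by simp)
  have h5 : HasMFDerivAt 𝓘(ℝ, ℝ × ModelM n) (𝓘(ℝ, ℝ).prod 𝓘(ℝ, ModelM n))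
      (Prod.map (id : ℝ → ℝ) (extChartAt 𝓘(ℝ, ModelM n) p₀.2).symm)
      (p.1, extChartAt 𝓘(ℝ, ModelM n) p₀.2 p.2)
      ((ContinuousLinearMap.id ℝ ℝ).prodMap (mfderiv 𝓘(ℝ, ModelM n) 𝓘(ℝ, ModelM n)
      (extChartAt 𝓘(ℝ, ModelM n) p₀.2).symm (extChartAt 𝓘(ℝ, ModelM n) p₀.2 p.2))) := by
    rw [modelWithCornersSelf_prod, ← chartedSpaceSelf_prod]
    have h6 := HasMFDerivAt.prodMap (p := (p.1, extChartAt 𝓘(ℝ, ModelM n) p₀.2 p.2))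
      (hasMFDerivAt_id (I := 𝓘(ℝ, ℝ)) p.1) h4.hasMFDerivAt
    rw [mfderiv_id] at h6
    exact h6
  exact congrArg (fun A : (ℝ × ModelM n) →L[ℝ] (ℝ × ModelM n) => A ξ) h5.mfderiv

/-- The matrix of `JBetween` in the chart around `p₀` is continuous at `p₀`. -/
theorem exists_continuousWithinAt_JBetween (p₀ : ℝ × M)
    (hp₀ : p₀ ∈ Set.Icc (-8 * ε₀) (8 * ε₀) ×ˢ (Set.univ : Set M)) :
    ∃ A : ℝ × M → ((ℝ × ModelM n) →L[ℝ] (ℝ × ModelM n)),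
      ContinuousWithinAt A (Set.Icc (-8 * ε₀) (8 * ε₀) ×ˢ Set.univ) p₀ ∧
      ∀ p : ℝ × M, p.2 ∈ (chartAt (ModelM n) p₀.2).source → ∀ ξ,
        D.JBetween p.1 p.2 (ξ.1, frame p₀.2 p.2 ξ.2) =
          ((A p ξ).1, frame p₀.2 p.2 (A p ξ).2) := by
  have h1 := (contMDiffWithinAt_hom_bundle _).1 (D.interpolating.smooth p₀ hp₀)
  refine ⟨_, h1.2.continuousWithinAt, fun p hp ξ => ?_⟩
  have hb : p ∈ (chartAt (ModelProd ℝ (ModelM n)) p₀).source := ⟨trivial, hp⟩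
  have h2 := symmL_prod p₀ p hp
  rw [← h2 ξ, ← h2]
  exact (Bundle.Trivialization.symmL_continuousLinearMapAt
    (trivializationAt (ℝ × ModelM n) (TangentSpace (𝓘(ℝ, ℝ).prod 𝓘(ℝ, ModelM n))) p₀) hb _).symm

/-- Near every point of `[-8ε₀, 8ε₀] × M` the metric bounds `dλ`. -/
theorem eventually_extD_le (hβ : IsCutoff ε₀ β) (hε₀ : 0 < ε₀) (p₀ : ℝ × M)
    (hp₀ : p₀ ∈ Set.Icc (-8 * ε₀) (8 * ε₀) ×ˢ (Set.univ : Set M)) :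
    ∃ C : ℝ, ∀ᶠ p : ℝ × M in 𝓝[Set.Icc (-8 * ε₀) (8 * ε₀) ×ˢ Set.univ] p₀,
      ∀ u u' : ℝ × TangentSpace 𝓘(ℝ, ModelM n) p.2, |extD D.lam p.2 ![u.2, u'.2]| ≤
        C * √(D.metric p.1 p.2 u u) * √(D.metric p.1 p.2 u' u') := by
  obtain ⟨A, hA, hAJ⟩ := D.exists_continuousWithinAt_JBetween p₀ hp₀
  let F : ℝ × M → CoordData (ModelM n) := fun p =>
    (theta β D.χ p.1, β p.1, localForm D.lam p₀.2 (extChartAt 𝓘(ℝ, ModelM n) p₀.2 p.2),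
      localForm D.om p₀.2 (extChartAt 𝓘(ℝ, ModelM n) p₀.2 p.2),
      extDeriv (localForm D.lam p₀.2) (extChartAt 𝓘(ℝ, ModelM n) p₀.2 p.2), A p)
  have hθc : Continuous (theta β D.χ) := by
    have h1 := D.metricCutoff.smooth.continuous
    have h2 := hβ.continuous_deriv
    unfold theta
    fun_prop
  have hF : ContinuousWithinAt F (Set.Icc (-8 * ε₀) (8 * ε₀) ×ˢ Set.univ) p₀ := by
    have hs : ContinuousAt (Prod.snd : ℝ × M → M) p₀ := continuousAt_snd
    refine ContinuousWithinAt.prodMk ?_ (ContinuousWithinAt.prodMk ?_ (ContinuousWithinAt.prodMk ?_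
      (ContinuousWithinAt.prodMk ?_ (ContinuousWithinAt.prodMk ?_ hA))))
    · exact (hθc.comp continuous_fst).continuousWithinAt
    · exact (hβ.smooth.continuous.comp continuous_fst).continuousWithinAt
    · exact (ContinuousAt.comp (f := Prod.snd) (D.framed.smooth_lam.continuousAt_localForm p₀.2)
        hs).continuousWithinAt
    · exact (ContinuousAt.comp (f := Prod.snd) (D.framed.smooth_om.continuousAt_localForm p₀.2)
        hs).continuousWithinAt
    · exact (ContinuousAt.comp (f := Prod.snd) (D.framed.smooth_lam.continuousAt_extDeriv p₀.2)
        hs).continuousWithinAt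
  -- in coordinates the metric and `dλ` are given by the coordinate data
  have hone : ∀ {p : ℝ × M}, p.2 ∈ (chartAt (ModelM n) p₀.2).source → ∀ v : ModelM n,
      D.lam p.2 ![frame p₀.2 p.2 v] =
        localForm D.lam p₀.2 (extChartAt 𝓘(ℝ, ModelM n) p₀.2 p.2) ![v] := by
    intro p hp v
    rw [localForm_apply D.lam hp]
    congr 1
    ext i
    fin_cases i
    rfl
  have htwo : ∀ {p : ℝ × M} (v v' : ModelM n), (fun i => frame p₀.2 p.2 (![v, v'] i)) =
      ![frame p₀.2 p.2 v, frame p₀.2 p.2 v'] := by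
    intro p v v'
    ext i
    fin_cases i <;> rfl
  have hom : ∀ {p : ℝ × M}, p.2 ∈ (chartAt (ModelM n) p₀.2).source → ∀ v v' : ModelM n,
      D.om p.2 ![frame p₀.2 p.2 v, frame p₀.2 p.2 v'] =
        localForm D.om p₀.2 (extChartAt 𝓘(ℝ, ModelM n) p₀.2 p.2) ![v, v'] := by
    intro p hp v v'
    rw [localForm_apply D.om hp, htwo]
  have hext : ∀ {p : ℝ × M}, p.2 ∈ (chartAt (ModelM n) p₀.2).source → ∀ v v' : ModelM n,
      extD D.lam p.2 ![frame p₀.2 p.2 v, frame p₀.2 p.2 v'] =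
        extDeriv (localForm D.lam p₀.2) (extChartAt 𝓘(ℝ, ModelM n) p₀.2 p.2) ![v, v'] := by
    intro p hp v v'
    rw [← extD_apply_frame D.framed.smooth_lam hp, htwo]
  have hmetric : ∀ p : ℝ × M, p.2 ∈ (chartAt (ModelM n) p₀.2).source → ∀ ξ : ℝ × ModelM n,
      D.metric p.1 p.2 (ξ.1, frame p₀.2 p.2 ξ.2) (ξ.1, frame p₀.2 p.2 ξ.2) =
        coordMetric (F p) ξ := by
    intro p hp ξ
    rw [metric, hAJ p hp ξ]
    simp only [daWedge, omegaHat, hone hp, hom hp, hext hp]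
    rfl
  have hpos : ∀ ξ, ξ ≠ 0 → 0 < coordMetric (F p₀) ξ := by
    intro ξ hξ
    rw [← hmetric p₀ (mem_chart_source _ _) ξ]
    apply D.metric_pos hβ hε₀ hp₀.1
    intro h
    apply hξ
    rw [Prod.ext_iff] at h ⊢
    exact ⟨h.1, frame_injective (mem_chart_source _ _) (h.2.trans (map_zero _).symm)⟩
  obtain ⟨C, hC⟩ := eventually_le_sqrt_mul_sqrt
    (δ := fun (x : CoordData (ModelM n)) ξ ξ' => x.2.2.2.2.1 ![ξ.2, ξ'.2])
    (ν := fun x => ‖x.2.2.2.2.1‖) continuous_coordMetric coordMetric_smul (by fun_prop)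
    (fun x => norm_nonneg _) (fun x ξ ξ' => by
      refine (x.2.2.2.2.1.le_opNorm _).trans ?_
      rw [Fin.prod_univ_two, mul_assoc]
      gcongr
      · exact norm_snd_le ξ
      · exact norm_snd_le ξ') hpos
  refine ⟨C, ?_⟩
  have hchart : ∀ᶠ p : ℝ × M in 𝓝[Set.Icc (-8 * ε₀) (8 * ε₀) ×ˢ Set.univ] p₀,
      p.2 ∈ (chartAt (ModelM n) p₀.2).source :=
    nhdsWithin_le_nhds (continuousAt_snd ((chartAt (ModelM n) p₀.2).open_source.mem_nhds
      (mem_chart_source _ _)))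
  filter_upwards [hF hC, hchart] with p hp1 hp2 u u'
  obtain ⟨v, hv⟩ := frame_surjective hp2 u.2
  obtain ⟨v', hv'⟩ := frame_surjective hp2 u'.2
  have h1 := hp1 (u.1, v) (u'.1, v')
  rw [← hmetric p hp2, ← hmetric p hp2] at h1
  change |extDeriv (localForm D.lam p₀.2) (extChartAt 𝓘(ℝ, ModelM n) p₀.2 p.2) ![v, v']| ≤ _ at h1
  rw [← hext hp2] at h1
  simp only [hv, hv'] at h1
  exact h1

/-- The local bounds of `eventually_extD_le` are uniform on the compact set `[-8ε₀, 8ε₀] × M`. -/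
theorem exists_extD_le [CompactSpace M] (hβ : IsCutoff ε₀ β) (hε₀ : 0 < ε₀) :
    ∃ C : ℝ, ∀ s ∈ Set.Icc (-8 * ε₀) (8 * ε₀), ∀ (m : M)
      (u u' : ℝ × TangentSpace 𝓘(ℝ, ModelM n) m), |extD D.lam m ![u.2, u'.2]| ≤
        C * √(D.metric s m u u) * √(D.metric s m u' u') := by
  have hK : IsCompact (Set.Icc (-8 * ε₀) (8 * ε₀) ×ˢ (Set.univ : Set M)) :=
    isCompact_Icc.prod isCompact_univ
  have key : ∃ C : ℝ, ∀ p ∈ Set.Icc (-8 * ε₀) (8 * ε₀) ×ˢ (Set.univ : Set M),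
      ∀ u u' : ℝ × TangentSpace 𝓘(ℝ, ModelM n) p.2, |extD D.lam p.2 ![u.2, u'.2]| ≤
        C * √(D.metric p.1 p.2 u u) * √(D.metric p.1 p.2 u' u') := by
    refine hK.induction_on (p := fun S => ∃ C : ℝ, ∀ p ∈ S,
      ∀ u u' : ℝ × TangentSpace 𝓘(ℝ, ModelM n) p.2, |extD D.lam p.2 ![u.2, u'.2]| ≤
        C * √(D.metric p.1 p.2 u u) * √(D.metric p.1 p.2 u' u')) ?_ ?_ ?_ ?_
    · exact ⟨0, fun p hp => absurd hp (Set.notMem_empty p)⟩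
    · rintro S S' hS ⟨C, hC⟩
      exact ⟨C, fun p hp => hC p (hS hp)⟩
    · rintro S S' ⟨C, hC⟩ ⟨C', hC'⟩
      refine ⟨max C C', ?_⟩
      rintro p (hp | hp) u u'
      · refine (hC p hp u u').trans ?_
        gcongr
        exact le_max_left _ _
      · refine (hC' p hp u u').trans ?_
        gcongr
        exact le_max_right _ _
    · intro p hp
      obtain ⟨C, hC⟩ := D.eventually_extD_le hβ hε₀ p hp
      exact ⟨_, hC, C, fun q hq => hq⟩
  obtain ⟨C, hC⟩ := key
  exact ⟨C, fun s hs m => hC (s, m) ⟨hs, trivial⟩⟩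

/-- The neck data at `t` are those at `collapse L t`, so that a bound on `[-8ε₀, 8ε₀] × M` is
uniform in `L`. -/
theorem exists_uniformBound [CompactSpace M] (hβ : IsCutoff ε₀ β) (hε₀ : 0 < ε₀) :
    ∃ κ₀ : ℝ, 1 ≤ κ₀ ∧ D.UniformBound κ₀ := by
  obtain ⟨C, hC⟩ := D.exists_extD_le hβ hε₀
  have hmem : ∀ {L t : ℝ}, t ∈ Set.Icc (-L - 8 * ε₀) (L + 8 * ε₀) →
      collapse L t ∈ Set.Icc (-8 * ε₀) (8 * ε₀) := by
    intro L t ht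
    rw [neg_mul]
    exact collapse_mem_Icc (by linarith) ht
  refine ⟨max 1 C, le_max_left _ _, ⟨?_, ?_⟩⟩
  · intro L _ t ht m u u'
    rw [D.cylMetric_eq hβ hε₀, D.cylMetric_eq hβ hε₀]
    refine (hC _ (hmem ht) m u u').trans ?_
    gcongr
    exact le_max_right _ _
  · intro L _ t ht m v hv
    rw [D.cylMetric_eq hβ hε₀, D.cylJ_eq hε₀, hβ.betaL_eq hε₀, ← D.metric_eq_omegaHat hv]
    have h1 : 0 ≤ D.metric (collapse L t) m (0, v) (0, v) := by
      by_cases h : v = 0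
      · rw [h, D.metric_eq_omegaHat (form_one_zero _)]
        have : ((0, 0) : ℝ × TangentSpace 𝓘(ℝ, ModelM n) m) = 0 := rfl
        rw [this, map_zero, omegaHat, form_two_self (D.om m), form_two_self (extD D.lam m)]
        simp
      · refine (D.metric_pos hβ hε₀ (hmem ht) m (0, v) fun h' => h ?_).le
        exact (Prod.ext_iff.1 h').2
    exact mul_le_of_le_one_left h1 (inv_le_one_of_one_le₀ (le_max_left _ _))

end NeckData

/-! ### The stretched almost-complex structure is tamed -/

theorem isInvertible_mfderiv {E H E' H' N N' : Type*} [NormedAddCommGroup E]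
    [NormedSpace ℝ E] [TopologicalSpace H] [NormedAddCommGroup E'] [NormedSpace ℝ E']
    [TopologicalSpace H'] {I : ModelWithCorners ℝ E H} {I' : ModelWithCorners ℝ E' H'}
    [TopologicalSpace N] [ChartedSpace H N] [TopologicalSpace N'] [ChartedSpace H' N']
    {c : OpenPartialHomeomorph N N'} (h1 : ContMDiffOn I I' ∞ c c.source)
    (h2 : ContMDiffOn I' I ∞ c.symm c.target) {x : N} (hx : x ∈ c.source) :
    (mfderiv I I' c x).IsInvertible := by
  have h : IsLocalDiffeomorphAt I I' ∞ c x :=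
    ⟨⟨c.toPartialEquiv, c.open_source, c.open_target, h1, h2⟩, hx, fun y _ => rfl⟩
  exact ⟨h.mfderivToContinuousLinearEquiv (by simp),
    h.mfderivToContinuousLinearEquiv_coe (by simp)⟩

theorem isInvertible_mfderiv_subtype_val {E H N : Type*} [NormedAddCommGroup E] [NormedSpace ℝ E]
    [TopologicalSpace H] {I : ModelWithCorners ℝ E H} [TopologicalSpace N] [ChartedSpace H N]
    [IsManifold I ∞ N] (U : TopologicalSpace.Opens N) (w : U) :
    (mfderiv I I ((↑) : U → N) w).IsInvertible := by
  set c := U.openPartialHomeomorphSubtypeCoe ⟨w⟩ with hc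
  refine isInvertible_mfderiv (c := c) contMDiff_subtype_val.contMDiffOn ?_ trivial
  intro x hx
  have h1 : ContMDiffAt I I ∞ (Subtype.val ∘ c.symm) x := by
    refine contMDiffAt_id.congr_of_eventuallyEq ?_
    filter_upwards [c.open_target.mem_nhds hx] with y hy
    exact c.right_inv hy
  exact ((ContMDiffAt.subtypeVal_comp_iff U c.symm x).1 h1).contMDiffWithinAt

namespace NeckData

variable {n : ℕ} {ε₀ : ℝ} {β : ℝ → ℝ} {W : Type u} {M : Type v} [TopologicalSpace W]
  [ChartedSpace (ModelW n) W] [IsManifold 𝓘(ℝ, ModelW n) ∞ W] [TopologicalSpace M]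
  [ChartedSpace (ModelM n) M] [IsManifold 𝓘(ℝ, ModelM n) ∞ M]

variable (D : NeckData (n := n) ε₀ β W M) {L : ℝ} (hL : 0 < L)

/-- The choices in the definition of `stretchedJ` do not matter, since the inclusions into `W_L` are
injective. -/
theorem stretchedJ_fromW (w : D.openPart) (hw : (w : W) ∈ D.core) :
    D.stretchedJ L hL (D.fromW L hL w) = (D.tangentFromW L hL w).comp
      ((D.JCore w).comp (D.tangentFromW L hL w).inverse) := by
  have h : ∃ w' : D.openPart, (w' : W) ∈ D.core ∧ D.fromW L hL w' = D.fromW L hL w :=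
    ⟨w, hw, rfl⟩
  have aux : ∀ (w' : D.openPart) (h' : D.fromW L hL w' = D.fromW L hL w),
      (h' ▸ ((D.tangentFromW L hL w').comp
        ((D.JCore w').comp (D.tangentFromW L hL w').inverse)) :
        TangentSpace 𝓘(ℝ, ModelW n) (D.fromW L hL w) →L[ℝ]
          TangentSpace 𝓘(ℝ, ModelW n) (D.fromW L hL w)) =
      (D.tangentFromW L hL w).comp ((D.JCore w).comp (D.tangentFromW L hL w).inverse) := by
    intro w' h'
    obtain rfl := D.fromW_injective hL h'
    rfl
  rw [stretchedJ, dif_pos h]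
  exact aux h.choose h.choose_spec.2

theorem stretchedJ_fromNeck (p : D.neck L)
    (hp : ¬ ∃ w : D.openPart, (w : W) ∈ D.core ∧ D.fromW L hL w = D.fromNeck L hL p) :
    D.stretchedJ L hL (D.fromNeck L hL p) = (D.tangentFromNeck L hL p).comp
      (ContinuousLinearMap.comp (D.cylJ L (p : ℝ × M).1 (p : ℝ × M).2)
        (D.tangentFromNeck L hL p).inverse) := by
  have h : ∃ q : D.neck L, D.fromNeck L hL q = D.fromNeck L hL p := ⟨p, rfl⟩
  have aux : ∀ (q : D.neck L) (h' : D.fromNeck L hL q = D.fromNeck L hL p),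
      (h' ▸ ((D.tangentFromNeck L hL q).comp
        (ContinuousLinearMap.comp (D.cylJ L (q : ℝ × M).1 (q : ℝ × M).2)
        (D.tangentFromNeck L hL q).inverse)) :
        TangentSpace 𝓘(ℝ, ModelW n) (D.fromNeck L hL p) →L[ℝ]
          TangentSpace 𝓘(ℝ, ModelW n) (D.fromNeck L hL p)) =
      (D.tangentFromNeck L hL p).comp
      (ContinuousLinearMap.comp (D.cylJ L (p : ℝ × M).1 (p : ℝ × M).2)
        (D.tangentFromNeck L hL p).inverse) := by
    intro q h'
    obtain rfl := D.fromNeck_injective hL h'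
    rfl
  rw [stretchedJ, dif_neg hp, dif_pos h]
  exact aux h.choose h.choose_spec

end NeckData

/-- Positivity of `α(B -, B J -)` for `B = A T` means that `α(A -, A -)` tames the endomorphism
`T J T⁻¹`. -/
theorem pos_of_comp {E E' F : Type*} [AddCommGroup E] [Module ℝ E] [TopologicalSpace E]
    [AddCommGroup E'] [Module ℝ E'] [TopologicalSpace E'] [AddCommGroup F] [Module ℝ F]
    [TopologicalSpace F] (α : E' [⋀^Fin 2]→L[ℝ] ℝ) {A : E →L[ℝ] E'} (hA : A.IsInvertible)
    {B : F →L[ℝ] E'} (hB : B.IsInvertible) {T : F →L[ℝ] E} (hT : ∀ z, A (T z) = B z) (J : F →L[ℝ] F)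
    (hpos : ∀ u, u ≠ 0 → 0 < α ![B u, B (J u)]) (u : E) (hu : u ≠ 0) :
    0 < α ![A u, A (T.comp (J.comp T.inverse) u)] := by
  obtain ⟨a, rfl⟩ := hA
  obtain ⟨b, rfl⟩ := hB
  have hT' : T = (b.trans a.symm : F ≃L[ℝ] E) := by
    ext z
    have := congrArg a.symm (hT z)
    simpa using this
  have h := hpos ((b.trans a.symm).symm u) (by simpa using hu)
  subst hT'
  simpa using h

theorem pullbackForm_two {E E' N N' : Type*} [NormedAddCommGroup E] [NormedSpace ℝ E]
    [NormedAddCommGroup E'] [NormedSpace ℝ E'] [TopologicalSpace N] [ChartedSpace E N]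
    [TopologicalSpace N'] [ChartedSpace E' N'] (f : N → N') (α : DiffForm E' N' 2) (x : N)
    (u v : TangentSpace 𝓘(ℝ, E) x) : pullbackForm f α x ![u, v] =
      α (f x) ![mfderiv 𝓘(ℝ, E) 𝓘(ℝ, E') f x u, mfderiv 𝓘(ℝ, E) 𝓘(ℝ, E') f x v] := by
  change α (f x) (fun i => mfderiv 𝓘(ℝ, E) 𝓘(ℝ, E') f x (![u, v] i)) = _
  congr 1
  ext i
  fin_cases i <;> rfl

namespace NeckData

variable {n : ℕ} {ε₀ : ℝ} {β : ℝ → ℝ} {W : Type u} {M : Type v} [TopologicalSpace W]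
  [ChartedSpace (ModelW n) W] [IsManifold 𝓘(ℝ, ModelW n) ∞ W] [TopologicalSpace M]
  [ChartedSpace (ModelM n) M] [IsManifold 𝓘(ℝ, ModelM n) ∞ M]

variable (D : NeckData (n := n) ε₀ β W M) {L : ℝ} (hL : 0 < L)

/-- Where `Φ` is the identity on `W ∖ M`, its differential is inverse to that of the inclusion. -/
theorem mfderiv_comp_tangentFromW (Φ : D.Stretched L hL ≃ₘ^∞⟮𝓘(ℝ, ModelW n), 𝓘(ℝ, ModelW n)⟯ W)
    (w : D.openPart) (hΦ : ∀ᶠ w' in 𝓝 w, Φ (D.fromW L hL w') = w') :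
    ∀ z : ModelW n, (mfderiv 𝓘(ℝ, ModelW n) 𝓘(ℝ, ModelW n) Φ (D.fromW L hL w)
      (D.tangentFromW L hL w z) : ModelW n) = z := by
  intro z
  have hinv := isInvertible_mfderiv_subtype_val (I := 𝓘(ℝ, ModelW n)) D.openPart w
  have h1 : Φ ∘ D.fromW L hL =ᶠ[𝓝 w] ((↑) : D.openPart → W) := hΦ
  have h2 := h1.mfderiv_eq (I := 𝓘(ℝ, ModelW n)) (I' := 𝓘(ℝ, ModelW n))
  rw [mfderiv_comp w ((Φ.contMDiff _).mdifferentiableAt (by simp))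
    ((D.contMDiff_fromW hL w).mdifferentiableAt (by simp))] at h2
  have h3 := congrArg (fun A : ModelW n →L[ℝ] ModelW n => A
    ((mfderiv 𝓘(ℝ, ModelW n) 𝓘(ℝ, ModelW n) ((↑) : D.openPart → W) w).inverse z)) h2
  exact h3.trans (hinv.self_apply_inverse z)

/-- If `Φ` is `f` on the neck, its differential is that of `f`. -/
theorem mfderiv_comp_tangentFromNeck
    (Φ : D.Stretched L hL ≃ₘ^∞⟮𝓘(ℝ, ModelW n), 𝓘(ℝ, ModelW n)⟯ W) (p : D.neck L) {f : ℝ × M → W}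
    (hf : MDifferentiableAt (𝓘(ℝ, ℝ).prod 𝓘(ℝ, ModelM n)) 𝓘(ℝ, ModelW n) f p)
    (hΦ : ∀ q : D.neck L, Φ (D.fromNeck L hL q) = f q) :
    ∀ z : ℝ × ModelM n, (mfderiv 𝓘(ℝ, ModelW n) 𝓘(ℝ, ModelW n) Φ (D.fromNeck L hL p)
      (D.tangentFromNeck L hL p z) : ModelW n) =
      mfderiv (𝓘(ℝ, ℝ).prod 𝓘(ℝ, ModelM n)) 𝓘(ℝ, ModelW n) f p z := by
  intro z
  have hinv := isInvertible_mfderiv_subtype_val (I := 𝓘(ℝ, ℝ).prod 𝓘(ℝ, ModelM n)) (D.neck L) p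
  have h1 : Φ ∘ D.fromNeck L hL =ᶠ[𝓝 p] f ∘ ((↑) : D.neck L → ℝ × M) := .of_forall hΦ
  have h2 := h1.mfderiv_eq (I := 𝓘(ℝ, ℝ).prod 𝓘(ℝ, ModelM n)) (I' := 𝓘(ℝ, ModelW n))
  rw [mfderiv_comp p ((Φ.contMDiff _).mdifferentiableAt (by simp))
    ((D.contMDiff_fromNeck hL p).mdifferentiableAt (by simp)), mfderiv_comp p hf
    ((contMDiff_subtype_val (n := ∞) p).mdifferentiableAt (by simp))] at h2
  have h3 := congrArg (fun A : (ℝ × ModelM n) →L[ℝ] ModelW n => A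
    ((mfderiv (𝓘(ℝ, ℝ).prod 𝓘(ℝ, ModelM n)) (𝓘(ℝ, ℝ).prod 𝓘(ℝ, ModelM n))
      ((↑) : D.neck L → ℝ × M) p).inverse z)) h2
  exact h3.trans (congrArg (mfderiv (𝓘(ℝ, ℝ).prod 𝓘(ℝ, ModelM n)) 𝓘(ℝ, ModelW n) f p)
    (hinv.self_apply_inverse z))

/-- On `Core(W)` the diffeomorphism is the identity, and `JCore` is compatible with `Ω`. -/
theorem tamed_fromW [T2Space W] [CompactSpace M] (hε₀ : 0 < ε₀)
    (Φ : D.Stretched L hL ≃ₘ^∞⟮𝓘(ℝ, ModelW n), 𝓘(ℝ, ModelW n)⟯ W)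
    (hΦ : ∀ w : D.openPart, (w : W) ∈ D.outer → Φ (D.fromW L hL w) = w) (w : D.openPart)
    (hw : (w : W) ∈ D.core)
    (u : TangentSpace 𝓘(ℝ, ModelW n) (D.fromW L hL w)) (hu : u ≠ 0) :
    0 < pullbackForm Φ D.Om (D.fromW L hL w) ![u, D.stretchedJ L hL (D.fromW L hL w) u] := by
  have hout := D.core_subset_outer hε₀ hw
  have hev : ∀ᶠ w' : D.openPart in 𝓝 w, Φ (D.fromW L hL w') = w' := by
    filter_upwards [((D.isOpen_outer hε₀).preimage continuous_subtype_val).mem_nhds hout]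
      with w' hw' using hΦ w' hw'
  have h1 := D.mfderiv_comp_tangentFromW hL Φ w hev
  have h2 : (mfderiv 𝓘(ℝ, ModelW n) 𝓘(ℝ, ModelW n) Φ (D.fromW L hL w)).IsInvertible :=
    ⟨Φ.mfderivToContinuousLinearEquiv (by simp) _, Φ.mfderivToContinuousLinearEquiv_coe (by simp)⟩
  rw [pullbackForm_two, D.stretchedJ_fromW hL w hw]
  refine pos_of_comp (D.Om (Φ (D.fromW L hL w))) h2 (F := TangentSpace 𝓘(ℝ, ModelW n) (w : W))
    (B := ContinuousLinearMap.id ℝ (ModelW n)) ⟨.refl ℝ (ModelW n), rfl⟩ h1 (D.JCore w)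
    (fun z hz => ?_) u hu
  have h3 : modelForm D.Om (Φ (D.fromW L hL w)) ![z, D.JCore w z] =
      modelForm D.Om (w : W) ![z, D.JCore w z] := by rw [hΦ w hout]
  exact (D.compatible.pos w z hz).trans_eq h3.symm

/-- On the neck the form `Φ^*Ω` is `ω + e dλ + e' da ∧ λ`, by the normal form of `Ω` in the collar,
and taming at a point becomes the positivity of this form. -/
theorem tamed_fromNeck (hε₀ : 0 < ε₀) {e : ℝ ≃ₜ ℝ} (he : IsNeckDiffeo ε₀ L e)
    (Φ : D.Stretched L hL ≃ₘ^∞⟮𝓘(ℝ, ModelW n), 𝓘(ℝ, ModelW n)⟯ W)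
    (hΦ : ∀ p : D.neck L, Φ (D.fromNeck L hL p) =
      D.collar.toMap (e (p : ℝ × M).1, (p : ℝ × M).2)) (p : D.neck L)
    (hp : ¬ ∃ w : D.openPart, (w : W) ∈ D.core ∧ D.fromW L hL w = D.fromNeck L hL p)
    (hpos : ∀ u : ℝ × TangentSpace 𝓘(ℝ, ModelM n) (p : ℝ × M).2, u ≠ 0 →
      0 < omegaHat D.lam D.om (e (p : ℝ × M).1) (p : ℝ × M).2 u
          (D.cylJ L (p : ℝ × M).1 (p : ℝ × M).2 u) +
        deriv e (p : ℝ × M).1 * daWedge D.lam (p : ℝ × M).2 u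
          (D.cylJ L (p : ℝ × M).1 (p : ℝ × M).2 u))
    (u : TangentSpace 𝓘(ℝ, ModelW n) (D.fromNeck L hL p)) (hu : u ≠ 0) :
    0 < pullbackForm Φ D.Om (D.fromNeck L hL p)
      ![u, D.stretchedJ L hL (D.fromNeck L hL p) u] := by
  let t : ℝ := (p : ℝ × M).1
  let m : M := (p : ℝ × M).2
  have hte : |e t| < 8 * ε₀ := (he.abs_lt_iff hL hε₀ (by linarith) _).2 p.2
  let c₀ : OpenPartialHomeomorph (ℝ × M) (ℝ × M) :=
    e.toOpenPartialHomeomorph.prod (OpenPartialHomeomorph.refl M)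
  have hc1 : ContMDiff (𝓘(ℝ, ℝ).prod 𝓘(ℝ, ModelM n)) (𝓘(ℝ, ℝ).prod 𝓘(ℝ, ModelM n)) ∞ c₀ :=
    he.contDiff.contMDiff.prodMap contMDiff_id
  have hc2 : ContMDiff (𝓘(ℝ, ℝ).prod 𝓘(ℝ, ModelM n)) (𝓘(ℝ, ℝ).prod 𝓘(ℝ, ModelM n)) ∞
      c₀.symm := he.contDiff_symm.contMDiff.prodMap contMDiff_id
  let c := c₀.trans D.collar.toMap
  have hsrc : (t, m) ∈ c.source := ⟨⟨trivial, trivial⟩, D.mem_collar_source hte.le m⟩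
  have hcs : ContMDiffOn (𝓘(ℝ, ℝ).prod 𝓘(ℝ, ModelM n)) 𝓘(ℝ, ModelW n) ∞ c c.source :=
    D.collar.smooth.comp hc1.contMDiffOn (fun y hy => hy.2)
  have hcs' : ContMDiffOn 𝓘(ℝ, ModelW n) (𝓘(ℝ, ℝ).prod 𝓘(ℝ, ModelM n)) ∞ c.symm c.target :=
    hc2.comp_contMDiffOn (D.collar.smooth_symm.mono fun y hy => hy.1)
  have hB := isInvertible_mfderiv hcs hcs' hsrc
  have h1 := D.mfderiv_comp_tangentFromNeck hL Φ p (f := c)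
    ((hcs.contMDiffAt (c.open_source.mem_nhds hsrc)).mdifferentiableAt (by simp)) hΦ
  have h2 : (mfderiv 𝓘(ℝ, ModelW n) 𝓘(ℝ, ModelW n) Φ (D.fromNeck L hL p)).IsInvertible :=
    ⟨Φ.mfderivToContinuousLinearEquiv (by simp) _, Φ.mfderivToContinuousLinearEquiv_coe (by simp)⟩
  -- the differential of `(t, m) ↦ ι(e(t), m)`
  have hdc : ∀ z : ℝ × ModelM n,
      (mfderiv (𝓘(ℝ, ℝ).prod 𝓘(ℝ, ModelM n)) 𝓘(ℝ, ModelW n) c (t, m) z : ModelW n) =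
      mfderiv (𝓘(ℝ, ℝ).prod 𝓘(ℝ, ModelM n)) 𝓘(ℝ, ModelW n) D.collar.toMap (e t, m)
        (deriv e t * z.1, z.2) := by
    intro z
    have hd1 : MDifferentiableAt 𝓘(ℝ, ℝ) 𝓘(ℝ, ℝ) e t :=
      (he.contDiff.differentiable (by simp)).differentiableAt.mdifferentiableAt
    have hd2 : HasMFDerivAt (𝓘(ℝ, ℝ).prod 𝓘(ℝ, ModelM n)) (𝓘(ℝ, ℝ).prod 𝓘(ℝ, ModelM n))
        (Prod.map e (id : M → M)) (t, m) _ :=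
      HasMFDerivAt.prodMap (p := (t, m)) hd1.hasMFDerivAt (hasMFDerivAt_id (I := 𝓘(ℝ, ModelM n)) m)
    have hd3 : HasMFDerivAt (𝓘(ℝ, ℝ).prod 𝓘(ℝ, ModelM n)) 𝓘(ℝ, ModelW n) D.collar.toMap (e t, m)
        (mfderiv (𝓘(ℝ, ℝ).prod 𝓘(ℝ, ModelM n)) 𝓘(ℝ, ModelW n) D.collar.toMap (e t, m)) :=
      ((D.collar.smooth.contMDiffAt (D.collar.toMap.open_source.mem_nhds
        (D.mem_collar_source hte.le m))).mdifferentiableAt (by simp)).hasMFDerivAt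
    have hd4 := (HasMFDerivAt.comp (t, m) hd3 hd2).mfderiv
    have hd5 : (mfderiv 𝓘(ℝ, ℝ) 𝓘(ℝ, ℝ) e t : ℝ →L[ℝ] ℝ) z.1 = deriv e t * z.1 := by
      have h : (fderiv ℝ e t : ℝ →L[ℝ] ℝ) z.1 = deriv e t * z.1 := by
        rw [fderiv_eq_smul_deriv, smul_eq_mul, mul_comm]
      exact (congrArg (fun A : ℝ →L[ℝ] ℝ => A z.1) mfderiv_eq_fderiv).trans h
    rw [mfderiv_id] at hd4
    refine (congrArg (fun A : (ℝ × ModelM n) →L[ℝ] ModelW n => A z) hd4).trans ?_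
    exact congrArg (fun r : ℝ => (mfderiv (𝓘(ℝ, ℝ).prod 𝓘(ℝ, ModelM n)) 𝓘(ℝ, ModelW n)
      D.collar.toMap (e t, m) (r, z.2) : ModelW n)) hd5
  rw [pullbackForm_two, D.stretchedJ_fromNeck hL p hp]
  refine pos_of_comp (D.Om (Φ (D.fromNeck L hL p))) h2 hB h1 (D.cylJ L t m) (fun z hz => ?_) u hu
  have h5 := D.collar.pullback_eq (e t) (by
    have := D.lt_collar
    rw [abs_lt] at hte
    exact ⟨by linarith, by linarith⟩) m (deriv e t * z.1, z.2)
    (deriv e t * (D.cylJ L t m z).1, (D.cylJ L t m z).2)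
  have h3 : modelForm D.Om (Φ (D.fromNeck L hL p))
      ![mfderiv (𝓘(ℝ, ℝ).prod 𝓘(ℝ, ModelM n)) 𝓘(ℝ, ModelW n) c (t, m) z,
        mfderiv (𝓘(ℝ, ℝ).prod 𝓘(ℝ, ModelM n)) 𝓘(ℝ, ModelW n) c (t, m) (D.cylJ L t m z)] =
      modelForm D.Om (D.collar.toMap (e t, m))
      ![mfderiv (𝓘(ℝ, ℝ).prod 𝓘(ℝ, ModelM n)) 𝓘(ℝ, ModelW n) D.collar.toMap (e t, m)
          (deriv e t * z.1, z.2),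
        mfderiv (𝓘(ℝ, ℝ).prod 𝓘(ℝ, ModelM n)) 𝓘(ℝ, ModelW n) D.collar.toMap (e t, m)
          (deriv e t * (D.cylJ L t m z).1, (D.cylJ L t m z).2)] := by
    rw [hΦ p]
    exact congrArg₂ (fun a b : ModelW n => modelForm D.Om (D.collar.toMap (e t, m)) ![a, b])
      (hdc z) (hdc (D.cylJ L t m z))
  refine lt_of_lt_of_eq (hpos z hz) (Eq.trans ?_ (h5.symm.trans h3.symm))
  simp only [omegaHat, daWedge]
  ring

end NeckData

/-! ### The slope of the squeezing function -/

/-- For the slope `η = κ⁻¹ L⁻²` the function `squeeze` satisfies all the requirements. -/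
theorem isSqueeze_squeeze {ε₀ : ℝ} {β : ℝ → ℝ} (hβ : IsCutoff ε₀ β) (hε₀ : 0 < ε₀) {κ L : ℝ}
    (hκ : 0 < κ) (hL : 0 < L) (hL3 : 3 * ε₀ ≤ L)
    (hd : ∀ t, κ⁻¹ * (L ^ 2)⁻¹ / 2 ≤ deriv (squeeze ε₀ β L (κ⁻¹ * (L ^ 2)⁻¹)) t) :
    IsSqueeze ε₀ β κ L (squeeze ε₀ β L (κ⁻¹ * (L ^ 2)⁻¹)) := by
  have hη : 0 < κ⁻¹ * (L ^ 2)⁻¹ := by positivity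
  have hpos : ∀ t, 0 < deriv (squeeze ε₀ β L (κ⁻¹ * (L ^ 2)⁻¹)) t :=
    fun t => (half_pos hη).trans_le (hd t)
  have hmono := (strictMono_of_deriv_pos hpos).monotone
  refine ⟨hβ.contDiff_squeeze hε₀ hL.le _, ?_, fun t _ => hpos t, ?_, fun t _ => ?_, fun t _ => ?_⟩
  · intro t ht
    have h1 := hmono ht.1
    have h2 := hmono ht.2
    rw [hβ.squeeze_end hε₀ hL.le (by rw [abs_of_neg] <;> linarith), collapse,
      if_pos (by linarith)] at h1
    rw [hβ.squeeze_end (t := L + 8 * ε₀) hε₀ hL.le (by rw [abs_of_pos] <;> linarith),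
      collapse, if_neg (by linarith), if_neg (by linarith)] at h2
    exact ⟨by linarith, by linarith⟩
  · refine ⟨ε₀ / 8, by linarith, fun t _ h => squeeze_eq_betaL hε₀ ?_⟩
    rcases h with h | h
    · exact le_trans (by linarith) (neg_le_abs t)
    · exact le_trans (by linarith) (le_abs_self t)
  · have h1 : κ⁻¹ * (L ^ 2)⁻¹ * L = κ⁻¹ * L⁻¹ := by field_simp
    have h2 := abs_squeeze_sub_le (β := β) (t := t) hε₀ hL3 hη.le
    have h3 : 0 < κ⁻¹ * L⁻¹ := by positivity
    rw [h1] at h2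
    linarith
  · linarith [hd t]

/-- The function `squeeze` is so close to `β_L`, compared with its slope `η = κ⁻¹ L⁻²`, that the
mixed terms of the pulled back form are dominated. -/
theorem mixed_lt_slope {κ₀ L r : ℝ} (hκ₀ : 1 ≤ κ₀) (hL : 1 ≤ L) (hr0 : 0 ≤ r)
    (hr : r ≤ 2 * ((10 ^ 10 * κ₀ ^ 3)⁻¹ * (L ^ 2)⁻¹ * L)) :
    r * κ₀ ≤ 1 / 4 ∧ 2 * (r * κ₀) ^ 2 < (10 ^ 10 * κ₀ ^ 3)⁻¹ * (L ^ 2)⁻¹ / 2 := by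
  have hκ0 : 0 < κ₀ := by linarith
  have hL0 : 0 < L := by linarith
  have h1 : r * κ₀ ≤ 2 * (10 ^ 10 * κ₀ ^ 2 * L)⁻¹ := by
    refine (mul_le_mul_of_nonneg_right hr hκ0.le).trans_eq ?_
    field_simp
  have h2 : (1 : ℝ) ≤ κ₀ ^ 2 * L := one_le_mul_of_one_le_of_one_le (one_le_pow₀ hκ₀) hL
  constructor
  · refine h1.trans ?_
    rw [← div_eq_mul_inv, div_le_iff₀ (by positivity)]
    linarith
  · have h3 : (r * κ₀) ^ 2 ≤ (2 * (10 ^ 10 * κ₀ ^ 2 * L)⁻¹) ^ 2 :=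
      pow_le_pow_left₀ (by positivity) h1 2
    have h4 : (2 * (10 ^ 10 * κ₀ ^ 2 * L)⁻¹) ^ 2 =
        4 * (10 ^ 10 * κ₀)⁻¹ * ((10 ^ 10 * κ₀ ^ 3)⁻¹ * (L ^ 2)⁻¹) := by
      field_simp
      norm_num
    have h5 : (10 ^ 10 * κ₀)⁻¹ ≤ ((10 : ℝ) ^ 10)⁻¹ :=
      inv_anti₀ (by positivity) (by linarith)
    have h6 : 0 < (10 ^ 10 * κ₀ ^ 3)⁻¹ * (L ^ 2)⁻¹ := by positivity
    rw [h4] at h3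
    have h7 : (10 ^ 10 * κ₀)⁻¹ * ((10 ^ 10 * κ₀ ^ 3)⁻¹ * (L ^ 2)⁻¹) ≤
      ((10 : ℝ) ^ 10)⁻¹ * ((10 ^ 10 * κ₀ ^ 3)⁻¹ * (L ^ 2)⁻¹) := mul_le_mul_of_nonneg_right h5 h6.le
    norm_num at h7 h3 h6 ⊢
    linarith

namespace NeckData

variable {n : ℕ} {ε₀ : ℝ} {β : ℝ → ℝ} {W : Type u} {M : Type v} [TopologicalSpace W]
  [ChartedSpace (ModelW n) W] [IsManifold 𝓘(ℝ, ModelW n) ∞ W] [TopologicalSpace M]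
  [ChartedSpace (ModelM n) M] [IsManifold 𝓘(ℝ, ModelM n) ∞ M]

variable (D : NeckData (n := n) ε₀ β W M) {L : ℝ} (hL : 0 < L)

/-- The images of `Core(W)` and of the open neck cover `W_L`. -/
theorem exists_core_or_fromNeck (hε₀ : 0 < ε₀) (x : D.Stretched L hL) :
    (∃ w : D.openPart, (w : W) ∈ D.core ∧ D.fromW L hL w = x) ∨ ∃ p, D.fromNeck L hL p = x := by
  obtain ⟨w, rfl⟩ | h := D.exists_rep hL x
  · by_cases hw : (w : W) ∈ D.core
    · exact Or.inl ⟨w, hw, rfl⟩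
    · obtain ⟨⟨t, m⟩, ⟨ht, -⟩, hm⟩ := not_not.1 hw
      exact Or.inr (D.exists_fromNeck_eq hL
        (abs_lt.2 ⟨by linarith [ht.1], by linarith [ht.2]⟩) m w hm)
  · exact Or.inr h

/-- The form `ω + b dλ + b' da ∧ λ` tames the almost-complex structure of the neck at `(t, m)` if
`b` and `b'` are the value and the derivative of the squeezing function at `t`. -/
theorem tames_neck (hβ : IsCutoff ε₀ β) (hε₀ : 0 < ε₀) {κ₀ : ℝ} (hκ₀ : 1 ≤ κ₀)
    (hUB : D.UniformBound κ₀) (hL1 : 1 ≤ L) (hL3 : 3 * ε₀ ≤ L) {η : ℝ}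
    (hη : η = (10 ^ 10 * κ₀ ^ 3)⁻¹ * (L ^ 2)⁻¹)
    (hd : ∀ t, η / 2 ≤ deriv (squeeze ε₀ β L η) t) {t : ℝ} (ht : |t| < L + 8 * ε₀) (m : M)
    (u : ℝ × TangentSpace 𝓘(ℝ, ModelM n) m) (hu : u ≠ 0) :
    0 < omegaHat D.lam D.om (squeeze ε₀ β L η t) m u (D.cylJ L t m u) +
      deriv (squeeze ε₀ β L η) t * daWedge D.lam m u (D.cylJ L t m u) := by
  have hL0 : 0 < L := by linarith
  have hκ0 : 0 < κ₀ := by linarith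
  have hη0 : 0 < η := by rw [hη]; positivity
  rw [abs_lt] at ht
  have hIcc : t ∈ Set.Icc (-L - 8 * ε₀) (L + 8 * ε₀) := ⟨by linarith, by linarith⟩
  rw [D.cylJ_eq hε₀]
  refine D.tames_of_close ?_ m hκ0 ?_ ((half_pos hη0).trans_le (hd t)) ?_ u hu
  · simpa using collapse_mem_Icc (by linarith) hIcc
  · intro w w'
    have h := hUB.extD_le L hL0 t hIcc m w w'
    rwa [D.cylMetric_eq hβ hε₀, D.cylMetric_eq hβ hε₀] at h
  · rw [← hβ.betaL_eq hε₀]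
    rcases le_or_gt (L + 21 / 8 * ε₀) |t| with h | h
    · exact Or.inl (squeeze_eq_betaL hε₀ h)
    · refine Or.inr ⟨theta_eq_one D.metricCutoff ?_, ?_⟩
      · rcases le_or_gt L |t| with h1 | h1
        · rw [abs_collapse hL0.le h1]
          linarith
        · rw [collapse_of_abs_le h1.le, abs_zero]
          linarith
      · have h1 := abs_squeeze_sub_le (β := β) (t := t) hε₀ hL3 hη0.le
        obtain ⟨h2, h3⟩ := mixed_lt_slope hκ₀ hL1 (abs_nonneg _) (hη ▸ h1)
        rw [← hη] at h2 h3
        exact ⟨h2, h3.trans_le (hd t)⟩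

end NeckData

end NeckStretch

theorem mainTheorem4 (ε₀ : ℝ) (hε₀ : 0 < ε₀) (β : ℝ → ℝ) (hβ : NeckStretch.IsCutoff ε₀ β) :
    ∃ L₀ : ℝ → ℝ, (∀ κ₀, 1 ≤ L₀ κ₀) ∧
      ∀ (n : ℕ) (W : Type u) (M : Type v)
        [TopologicalSpace W] [T2Space W] [CompactSpace W]
        [ChartedSpace (NeckStretch.ModelW n) W] [IsManifold 𝓘(ℝ, NeckStretch.ModelW n) ∞ W]
        [TopologicalSpace M] [CompactSpace M]
        [ChartedSpace (NeckStretch.ModelM n) M] [IsManifold 𝓘(ℝ, NeckStretch.ModelM n) ∞ M]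
        (D : NeckStretch.NeckData (n := n) ε₀ β W M),
        (∃ κ₀ : ℝ, 1 ≤ κ₀ ∧ D.UniformBound κ₀) ∧
        ∀ κ₀ : ℝ, 1 ≤ κ₀ → D.UniformBound κ₀ → ∀ (L : ℝ) (hL : 0 < L), L₀ κ₀ ≤ L →
          ∃ (h : ℝ → ℝ) (Φ : D.Stretched L hL ≃ₘ^∞⟮𝓘(ℝ, NeckStretch.ModelW n),
              𝓘(ℝ, NeckStretch.ModelW n)⟯ W),
            NeckStretch.IsSqueeze ε₀ β (10 ^ 10 * κ₀ ^ 3) L h ∧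
            (∀ w : D.openPart, (w : W) ∈ D.core → Φ (D.fromW L hL w) = w) ∧
            (∀ p : D.neck L, Φ (D.fromNeck L hL p) =
              D.collar.toMap (h (p : ℝ × M).1, (p : ℝ × M).2)) ∧
            NeckStretch.IsTamedBy (D.stretchedJ L hL) (NeckStretch.pullbackForm Φ D.Om) := by
  obtain ⟨L₁, hL₁, hL₁', hd⟩ := hβ.exists_le_deriv_squeeze hε₀
  -- the threshold does not depend on `κ₀`: all that it needs is `η L² = κ_*⁻¹ ≤ 1`
  refine ⟨fun _ => L₁, fun _ => hL₁, ?_⟩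
  intro n W M _ _ _ _ _ _ _ _ _ D
  refine ⟨D.exists_uniformBound hβ hε₀, fun κ₀ hκ₀ hUB L hL hLL => ?_⟩
  have hκ : (1 : ℝ) ≤ 10 ^ 10 * κ₀ ^ 3 :=
    one_le_mul_of_one_le_of_one_le (by norm_num) (one_le_pow₀ hκ₀)
  obtain ⟨η, hη⟩ : ∃ η, η = (10 ^ 10 * κ₀ ^ 3)⁻¹ * (L ^ 2)⁻¹ := ⟨_, rfl⟩
  have hη0 : 0 < η := by rw [hη]; positivity
  have hηL : η * L ^ 2 ≤ 1 := by
    rw [hη, mul_assoc, inv_mul_cancel₀ (by positivity), mul_one]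
    exact inv_le_one_of_one_le₀ hκ
  have hd' := hd L hLL η hη0 hηL
  obtain ⟨e, he, hmono, hsm, hsm'⟩ :=
    hβ.exists_homeomorph_squeeze hε₀ hL fun t => (half_pos hη0).trans_le (hd' t)
  have hfun : (e : ℝ → ℝ) = NeckStretch.squeeze ε₀ β L η := funext he
  have hneck : NeckStretch.IsNeckDiffeo ε₀ L e :=
    ⟨hmono, hsm, hsm', fun t ht => (he t).trans (hβ.squeeze_end hε₀ hL.le ht)⟩
  obtain ⟨Φ, hΦ, hΦ'⟩ := D.exists_diffeomorph hL hneck hε₀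
  refine ⟨e, Φ, ?_, fun w hw => hΦ w (D.core_subset_outer hε₀ hw), hΦ', ?_⟩
  · rw [hfun, hη]
    exact NeckStretch.isSqueeze_squeeze hβ hε₀ (by positivity) hL (hL₁'.trans hLL) (hη ▸ hd')
  · intro x u hu
    by_cases hx : ∃ w : D.openPart, (w : W) ∈ D.core ∧ D.fromW L hL w = x
    · obtain ⟨w, hw, rfl⟩ := hx
      exact D.tamed_fromW hL hε₀ Φ hΦ w hw u hu
    · obtain ⟨p, rfl⟩ := (D.exists_core_or_fromNeck hL hε₀ x).resolve_left hx
      refine D.tamed_fromNeck hL hε₀ hneck Φ hΦ' p hx (fun z hz => ?_) u hu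
      rw [hfun]
      exact D.tames_neck hβ hε₀ hκ₀ hUB (hL₁.trans hLL) (hL₁'.trans hLL) hη hd' p.2 _ z hz
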